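/- Let $n\ge 1$ agents have valuations $v_1,\dots,v_n: 2^M\to\mathbb{R}_{\ge 0}$ over a set $M$ of $m$ indivisible goods, each normalized ($v_i(\emptyset)=0$), monotone and subadditive ($v_i(A\cup B)\le v_i(A)+v_i(B)$). An allocation $X=(X_1,\dots,X_n)$ consists of pairwise disjoint subsets of $M$, and $P=M\setminus\bigcup_i X_i$ is its set of unallocated goods. It is $\alpha$-EFX if $v_i(X_i)\ge\alpha\, v_i(X_j\setminus\{g\})$ for all agents $i,j$ and all $g\in X_j$, and EF1 if for all $i,j$ with $X_j\neq\emptyset$ we have $v_i(X_i)\ge v_i(X_j\setminus\{g\})$ for some $g\in X_j$. For $c\in\{0,1\}$ it is $(\alpha,c)$-EFX if it is $\alpha$-EFX and EF1, $|P|<n$, $v_i(X_i)\ge v_i(P)$ for all $i$, and, when $c=1$, $P=\emptyset$. For $p\in[-\infty,1]$ the $p$-mean welfare is $M_p(X)=\big(\tfrac1n\sum_i v_i(X_i)^p\big)^{1/p}$ for $p\ne 0,-\infty$ (read as $0$ if $p<0$ and some $v_i(X_i)=0$), $M_0(X)=\big(\prod_i v_i(X_i)\big)^{1/n}$ (the Nash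 welfare) and $M_{-\infty}(X)=\min_i v_i(X_i)$. Then for each of the two choices $(\alpha,c)=(1-\varepsilon,0)$ and $(\alpha,c)=(\tfrac12-\varepsilon,1)$ there is an algorithm that, given $n$, $m$, any $\varepsilon>0$, any $p\in[-\infty,1]$ and access to the valuations by value queries, computes in time $\mathrm{poly}(n,m,1/\varepsilon)$ an $(\alpha,c)$-EFX allocation $Z$ with $$M_p(Z)\ \ge\ \frac{\alpha}{4(n+1)}\,M_p(X^*),$$ where $X^*$ is an allocation of maximum $p$-mean welfare. (The machine is a real random access machine: arithmetic, powers and logarithms of reals, comparisons, memory accesses and value queries take one step each.) In particular, in time $\mathrm{poly}(n,m)$ one can compute a complete allocation whose Nash welfare is within a factor $O(n)$ of the optimum. -/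

import Mathlib

/-! Fair division instances, fairness notions and welfare.  The agents are `Fin n`, the goods are
`Fin m`, and `v i S` is the value of agent `i` for the set `S` of goods. -/

/-- A nonnegative valuation that is normalized, monotone and subadditive. -/
structure IsSubadditiveValuation {m : ℕ} (v : Finset (Fin m) → ℝ) : Prop where
  nonneg : ∀ A, 0 ≤ v A
  normalized : v ∅ = 0
  mono : ∀ A B, A ⊆ B → v A ≤ v B
  subadd : ∀ A B, v (A ∪ B) ≤ v A + v B

/-- A (possibly partial) allocation: pairwise disjoint bundles. -/
def IsAllocation {n m : ℕ} (X : Fin n → Finset (Fin m)) : Prop :=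
  ∀ i j, i ≠ j → Disjoint (X i) (X j)

/-- The set of goods that are not allocated. -/
def unallocated {n m : ℕ} (X : Fin n → Finset (Fin m)) : Finset (Fin m) :=
  Finset.univ \ Finset.univ.biUnion X

/-- `α`-EFX: no agent's value is below `α` times her value for another bundle with any one good
removed. -/
def IsAlphaEFX {n m : ℕ} (v : Fin n → Finset (Fin m) → ℝ) (α : ℝ)
    (X : Fin n → Finset (Fin m)) : Prop :=
  ∀ i j, ∀ g ∈ X j, α * v i (X j \ {g}) ≤ v i (X i)

/-- EF1: every nonempty bundle has a good whose removal eliminates the envy of agent `i`. -/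
def IsEF1 {n m : ℕ} (v : Fin n → Finset (Fin m) → ℝ) (X : Fin n → Finset (Fin m)) : Prop :=
  ∀ i j, (X j).Nonempty → ∃ g ∈ X j, v i (X j \ {g}) ≤ v i (X i)

/-- `(α, c)`-EFX allocations: `α`-EFX and EF1, fewer than `n` goods unallocated, nobody prefers the
unallocated goods to her bundle, and every good is allocated if `c` is `true`. -/
structure IsAlphaCEFX {n m : ℕ} (v : Fin n → Finset (Fin m) → ℝ) (α : ℝ) (c : Bool)
    (X : Fin n → Finset (Fin m)) : Prop where
  alloc : IsAllocation X
  efx : IsAlphaEFX v α X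
  ef1 : IsEF1 v X
  card_lt : (unallocated X).card < n
  charity : ∀ i, v i (unallocated X) ≤ v i (X i)
  complete : c = true → unallocated X = ∅

/-- The `p`-mean of nonnegative reals: the minimum for `p = -∞` (written `⊥`), the geometric mean
for `p = 0`, and `((1/n) ∑ xᵢ ^ p) ^ (1/p)` otherwise.  For `p < 0` it is `0` as soon as
some `xᵢ = 0`, which is the usual convention (`0 ^ p = ∞` and `∞ ^ (1/p) = 0`). -/
noncomputable def pMean {n : ℕ} (p : WithBot ℝ) (x : Fin n → ℝ) : ℝ :=
  open Classical in
  match p with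
  | ⊥ => ⨅ i, x i
  | (q : ℝ) =>
    if q = 0 then (∏ i, x i) ^ (1 / (n : ℝ))
    else if q < 0 ∧ ∃ i, x i = 0 then 0
    else ((1 / (n : ℝ)) * ∑ i, x i ^ q) ^ (1 / q)

/-- The `p`-mean welfare of the allocation `X`. -/
noncomputable def pMeanWelfare {n m : ℕ} (p : WithBot ℝ) (v : Fin n → Finset (Fin m) → ℝ)
    (X : Fin n → Finset (Fin m)) : ℝ :=
  pMean p (fun i => v i (X i))

/-! The machine model: a real random access machine with value queries, programmed in a small
imperative language.  The memory consists of two-dimensional arrays of natural numbers (used for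
indices and sets) and of two-dimensional arrays of real numbers, numbered by `ℕ` and initially
`0` outside the input; a program mentions only finitely many arrays. -/

/-- The memory: `σ.nat a r k` and `σ.real a r k` are the entries in row `r` and column `k` of the
arrays number `a`. -/
structure Store where
  nat : ℕ → ℕ → ℕ → ℕ
  real : ℕ → ℕ → ℕ → ℝ

/-- The set of goods whose indicator vector is row `r` of the natural number array `a`. -/
def Store.row (σ : Store) (m a r : ℕ) : Finset (Fin m) :=
  Finset.univ.filter (fun g : Fin m => σ.nat a r g ≠ 0)

/-- Expressions for natural numbers: literals, array entries, sum and truncated difference. -/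
inductive NExp : Type
  | lit (k : ℕ)
  | get (a : ℕ) (r k : NExp)
  | add (e f : NExp)
  | sub (e f : NExp)

def NExp.size : NExp → ℕ
  | .lit _ => 1
  | .get _ r k => r.size + k.size + 1
  | .add e f => e.size + f.size + 1
  | .sub e f => e.size + f.size + 1

def NExp.eval (σ : Store) : NExp → ℕ
  | .lit k => k
  | .get a r k => σ.nat a (r.eval σ) (k.eval σ)
  | .add e f => e.eval σ + f.eval σ
  | .sub e f => e.eval σ - f.eval σ

/-- Expressions for real numbers: natural numbers, array entries, field operations, power and
logarithm, and the value query `value i a r`, which asks agent number `i` for her value of the set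
stored in row `r` of the natural number array `a`. -/
inductive RExp : Type
  | ofNat (e : NExp)
  | get (a : ℕ) (r k : NExp)
  | add (e f : RExp)
  | sub (e f : RExp)
  | mul (e f : RExp)
  | div (e f : RExp)
  | pow (e f : RExp)
  | log (e : RExp)
  | value (i : NExp) (a : ℕ) (r : NExp)

def RExp.size : RExp → ℕ
  | .ofNat e => e.size + 1
  | .get _ r k => r.size + k.size + 1
  | .add e f => e.size + f.size + 1
  | .sub e f => e.size + f.size + 1
  | .mul e f => e.size + f.size + 1
  | .div e f => e.size + f.size + 1
  | .pow e f => e.size + f.size + 1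
  | .log e => e.size + 1
  | .value i _ r => i.size + r.size + 1

/-- Power and logarithm return `0` unless the base, respectively the argument, is positive. -/
noncomputable def RExp.eval {n m : ℕ} (v : Fin n → Finset (Fin m) → ℝ) (σ : Store) : RExp → ℝ
  | .ofNat e => (e.eval σ : ℝ)
  | .get a r k => σ.real a (r.eval σ) (k.eval σ)
  | .add e f => e.eval v σ + f.eval v σ
  | .sub e f => e.eval v σ - f.eval v σ
  | .mul e f => e.eval v σ * f.eval v σ
  | .div e f => e.eval v σ / f.eval v σ
  | .pow e f => if 0 < e.eval v σ then e.eval v σ ^ f.eval v σ else 0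
  | .log e => if 0 < e.eval v σ then Real.log (e.eval v σ) else 0
  | .value i a r => if h : i.eval σ < n then v ⟨i.eval σ, h⟩ (σ.row m a (r.eval σ)) else 0

/-- Tests: comparisons of natural numbers and of real numbers, and Boolean combinations. -/
inductive BExp : Type
  | natLT (e f : NExp)
  | realLT (e f : RExp)
  | not (b : BExp)
  | and (b c : BExp)

def BExp.size : BExp → ℕ
  | .natLT e f => e.size + f.size + 1
  | .realLT e f => e.size + f.size + 1
  | .not b => b.size + 1
  | .and b c => b.size + c.size + 1

def BExp.Holds {n m : ℕ} (v : Fin n → Finset (Fin m) → ℝ) (σ : Store) : BExp → Prop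
  | .natLT e f => e.eval σ < f.eval σ
  | .realLT e f => e.eval v σ < f.eval v σ
  | .not b => ¬ b.Holds v σ
  | .and b c => b.Holds v σ ∧ c.Holds v σ

/-- Programs: assignments to array entries, composition, branching and while loops. -/
inductive Program : Type
  | skip
  | setNat (a : ℕ) (r k e : NExp)
  | setReal (a : ℕ) (r k : NExp) (e : RExp)
  | seq (s u : Program)
  | ite (b : BExp) (s u : Program)
  | loop (b : BExp) (s : Program)

def Store.updateNat (σ : Store) (a r k x : ℕ) : Store :=
  { σ with nat := fun a' r' k' => if a' = a ∧ r' = r ∧ k' = k then x else σ.nat a' r' k' }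

noncomputable def Store.updateReal (σ : Store) (a r k : ℕ) (x : ℝ) : Store :=
  { σ with real := fun a' r' k' => if a' = a ∧ r' = r ∧ k' = k then x else σ.real a' r' k' }

/-- `Runs v A σ t τ`: with the valuations `v` answering the value queries, the program `A` started
in the memory `σ` halts after `t` steps in the memory `τ`.  Every memory access, operation,
comparison, value query and assignment counts as one step. -/
inductive Runs {n m : ℕ} (v : Fin n → Finset (Fin m) → ℝ) : Program → Store → ℕ → Store → Prop
  | skip (σ : Store) : Runs v .skip σ 1 σ
  | setNat (σ : Store) (a : ℕ) (r k e : NExp) :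
      Runs v (.setNat a r k e) σ (r.size + k.size + e.size + 1)
        (σ.updateNat a (r.eval σ) (k.eval σ) (e.eval σ))
  | setReal (σ : Store) (a : ℕ) (r k : NExp) (e : RExp) :
      Runs v (.setReal a r k e) σ (r.size + k.size + e.size + 1)
        (σ.updateReal a (r.eval σ) (k.eval σ) (e.eval v σ))
  | seq {s u : Program} {σ τ ρ : Store} {t t' : ℕ} :
      Runs v s σ t τ → Runs v u τ t' ρ → Runs v (.seq s u) σ (t + t') ρ
  | iteTrue {b : BExp} {s u : Program} {σ τ : Store} {t : ℕ} :
      b.Holds v σ → Runs v s σ t τ → Runs v (.ite b s u) σ (b.size + t) τ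
  | iteFalse {b : BExp} {s u : Program} {σ τ : Store} {t : ℕ} :
      ¬ b.Holds v σ → Runs v u σ t τ → Runs v (.ite b s u) σ (b.size + t) τ
  | loopTrue {b : BExp} {s : Program} {σ τ ρ : Store} {t t' : ℕ} :
      b.Holds v σ → Runs v s σ t τ → Runs v (.loop b s) τ t' ρ →
        Runs v (.loop b s) σ (b.size + t + t') ρ
  | loopFalse {b : BExp} {s : Program} {σ : Store} :
      ¬ b.Holds v σ → Runs v (.loop b s) σ b.size σ

/-- The input: row `0` of the natural number array `0` holds `n`, `m` and a flag that is `1` if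
`p = -∞` and `0` otherwise, and row `0` of the real array `0` holds `ε` and `p` (`0` if `p = -∞`).
The valuations are accessible only through value queries. -/
noncomputable def inputStore (n m : ℕ) (ε : ℝ) (p : WithBot ℝ) : Store where
  nat := fun a r k =>
    if a = 0 ∧ r = 0 then
      (if k = 0 then n else if k = 1 then m else if k = 2 then
        (match p with
          | ⊥ => 1
          | (_ : ℝ) => 0)
      else 0)
    else 0
  real := fun a r k =>
    if a = 0 ∧ r = 0 then
      (if k = 0 then ε else if k = 1 then
        (match p with
          | ⊥ => 0
          | (q : ℝ) => q)
      else 0)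
    else 0

/-- The output: row `i` of the natural number array `1` is the indicator vector of the bundle of
agent `i`. -/
def Store.output (τ : Store) (n m : ℕ) : Fin n → Finset (Fin m) :=
  fun i => τ.row m 1 i

/-! Programs with bounds on the number of iterations of each loop, and a calculus of weakest
preconditions for them. -/

/-! Welfare and fairness are linked by a single matching. For agent `i` a good is low if more than
`n` goods are at least as valuable to her, so at most `n` goods are not low. The edge between `i`
and `g` has weight `v i {g}` plus `1 / n` times the value of all low goods. In any allocation the
non-low goods of a bundle are worth at most `n` times the best of them, so each bundle is worth at
most `n` times the weight of an edge, with distinct columns for distinct agents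
(`exists_edgeWeight_ge`). Conversely, `α`-EFX and the charity bound alone guarantee that `α` times
the low goods are worth at most `2 n` times an agent's own bundle (`value_low_le`). So a fair
allocation that leaves everybody at least as happy as with her matched good retains the edge weights
up to the factor `α / 4`, and it suffices to start from a matching whose weights have nearly maximum
`p`-mean (`pMeanWelfare_ge`).

For finite `p` this is an assignment problem with costs `-w ^ p`, `w ^ p` or `-log w`. For `p = -∞`
the exponent `-n ^ 2` loses a factor `(n + 1) / n`, which turns the factor `n` into `n + 1`. Edges
of weight zero are excluded, where possible, by large penalties (`sum_edgeCost_le`). The primal-dual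
method solves the problem, and its certificate is `IsDualMatching.sum_le`.

The matched goods are turned into a fair allocation by moves after which no agent is worse off
(`FairState`). A bag of unallocated goods is swapped with the bundle of an agent who prefers it.
Otherwise it absorbs goods, and when this would violate EFX, it is cut down until the last objecting
agent takes it, gaining a factor of at least `1 + ε`. Once an unenvied bag contains all unallocated
goods and has at least `n` of them, a separate good is offered with each bundle: a bundle goes to
somebody who envies it, or a part of it with its extra good goes to somebody who gains a factor `1 +
ε`, or its owner may simply keep the extra good. If no owner may, the bundles move along a cycle of
improvements. With fewer than `n` goods in the bag the process stops or, for complete allocations,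
an unenvied agent receives a good, where subadditivity costs the factor `1 / 2`; envy cycles are
rotated as before.

The number of moves is polynomial independently of the size of the values: `level` measures values
against the powers of `1 + ε` times the values of single goods, subadditivity bounds the number of
relevant powers, and moves without a gain in level decrease a lexicographic count of goods and envy
(`potential_lt_of_major`, `potential_lt_of_minor`). Since loops carry exponents bounding their
iterations, `wp_loop` proves correctness and running time together. -/

/-- Programs in which every loop carries an exponent `d`; the loop is meant to be iterated at most
`N ^ d` times, where `N` measures the size of the input. -/
inductive BProgram : Type
  | skip
  | setNat (a : ℕ) (r k e : NExp)
  | setReal (a : ℕ) (r k : NExp) (e : RExp)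
  | seq (s u : BProgram)
  | ite (b : BExp) (s u : BProgram)
  | loop (d : ℕ) (b : BExp) (s : BProgram)

namespace BProgram

/-- The underlying program. -/
def erase : BProgram → Program
  | skip => .skip
  | setNat a r k e => .setNat a r k e
  | setReal a r k e => .setReal a r k e
  | seq s u => .seq s.erase u.erase
  | ite b s u => .ite b s.erase u.erase
  | loop _ b s => .loop b s.erase

/-- A bound on the running time. -/
def cost (N : ℕ) : BProgram → ℕ
  | skip => 1
  | setNat _ r k e => r.size + k.size + e.size + 1
  | setReal _ r k e => r.size + k.size + e.size + 1
  | seq s u => s.cost N + u.cost N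
  | ite b s u => b.size + (s.cost N + u.cost N)
  | loop d b s => N ^ d * (b.size + s.cost N) + b.size

/-- The natural number arrays that the program writes to. -/
def natWrites : BProgram → List ℕ
  | skip => []
  | setNat a _ _ _ => [a]
  | setReal _ _ _ _ => []
  | seq s u => s.natWrites ++ u.natWrites
  | ite _ s u => s.natWrites ++ u.natWrites
  | loop _ _ s => s.natWrites

/-- The real arrays that the program writes to. -/
def realWrites : BProgram → List ℕ
  | skip => []
  | setNat _ _ _ _ => []
  | setReal a _ _ _ => [a]
  | seq s u => s.realWrites ++ u.realWrites
  | ite _ s u => s.realWrites ++ u.realWrites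
  | loop _ _ s => s.realWrites

/-- Exponents of nested loops add up, so the static cost is bounded by a polynomial in `N` whose
coefficient and degree depend only on the program text. This makes the time bound uniform in the
input. -/
theorem exists_cost_le (A : BProgram) :
    ∃ C k : ℕ, ∀ N : ℕ, 1 ≤ N → A.cost N ≤ C * N ^ k := by
  induction A with
  | skip => exact ⟨1, 0, fun N _ => by simp [cost]⟩
  | setNat a r k e => exact ⟨r.size + k.size + e.size + 1, 0, fun N _ => by simp [cost]⟩
  | setReal a r k e => exact ⟨r.size + k.size + e.size + 1, 0, fun N _ => by simp [cost]⟩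
  | seq s u hs hu =>
    obtain ⟨C, k, h⟩ := hs
    obtain ⟨C', k', h'⟩ := hu
    refine ⟨C + C', k + k', fun N hN => ?_⟩
    have h1 : N ^ k ≤ N ^ (k + k') := Nat.pow_le_pow_right hN (by omega)
    have h2 : N ^ k' ≤ N ^ (k + k') := Nat.pow_le_pow_right hN (by omega)
    calc s.cost N + u.cost N ≤ C * N ^ k + C' * N ^ k' := add_le_add (h N hN) (h' N hN)
      _ ≤ C * N ^ (k + k') + C' * N ^ (k + k') := by gcongr
      _ = _ := by ring
  | ite b s u hs hu =>
    obtain ⟨C, k, h⟩ := hs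
    obtain ⟨C', k', h'⟩ := hu
    refine ⟨b.size + (C + C'), k + k', fun N hN => ?_⟩
    have h0 : 1 ≤ N ^ (k + k') := Nat.one_le_pow _ _ hN
    have h1 : N ^ k ≤ N ^ (k + k') := Nat.pow_le_pow_right hN (by omega)
    have h2 : N ^ k' ≤ N ^ (k + k') := Nat.pow_le_pow_right hN (by omega)
    calc b.size + (s.cost N + u.cost N) ≤ b.size * 1 + (C * N ^ k + C' * N ^ k') := by
          have := h N hN
          have := h' N hN
          omega
      _ ≤ b.size * N ^ (k + k') + (C * N ^ (k + k') + C' * N ^ (k + k')) := by gcongr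
      _ = _ := by ring
  | loop d b s hs =>
    obtain ⟨C, k, h⟩ := hs
    refine ⟨b.size + C + b.size, d + k, fun N hN => ?_⟩
    have h0 : 1 ≤ N ^ (d + k) := Nat.one_le_pow _ _ hN
    have h1 : N ^ d ≤ N ^ (d + k) := Nat.pow_le_pow_right hN (by omega)
    calc N ^ d * (b.size + s.cost N) + b.size
        ≤ N ^ d * (b.size + C * N ^ k) + b.size * 1 := by
          have := h N hN
          gcongr
          omega
      _ = N ^ d * b.size + C * N ^ (d + k) + b.size * 1 := by ring
      _ ≤ N ^ (d + k) * b.size + C * N ^ (d + k) + b.size * N ^ (d + k) := by gcongr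
      _ = _ := by ring

end BProgram

/-- The equation `P = A.erase` is a hypothesis so that the induction can follow the derivation of
the run, while the set of written arrays is read off the annotated program. -/
theorem Runs.nat_eq {n m : ℕ} {v : Fin n → Finset (Fin m) → ℝ} {A : BProgram} {P : Program}
    {σ τ : Store} {t : ℕ} (h : Runs v P σ t τ) (hP : P = A.erase) {a : ℕ}
    (ha : a ∉ A.natWrites) : τ.nat a = σ.nat a := by
  induction h generalizing A with
  | skip => rfl
  | setNat σ b r k e =>
    cases A <;> simp_all [BProgram.erase, BProgram.natWrites, Store.updateNat]
  | setReal σ b r k e => rfl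
  | seq h₁ h₂ ih₁ ih₂ =>
    cases A with
    | seq s u =>
      simp only [BProgram.erase, Program.seq.injEq] at hP
      simp only [BProgram.natWrites, List.mem_append, not_or] at ha
      rw [ih₂ hP.2 ha.2, ih₁ hP.1 ha.1]
    | _ => simp [BProgram.erase] at hP
  | iteTrue hb h₁ ih =>
    cases A with
    | ite b s u =>
      simp only [BProgram.erase, Program.ite.injEq] at hP
      simp only [BProgram.natWrites, List.mem_append, not_or] at ha
      exact ih hP.2.1 ha.1
    | _ => simp [BProgram.erase] at hP
  | iteFalse hb h₁ ih =>
    cases A with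
    | ite b s u =>
      simp only [BProgram.erase, Program.ite.injEq] at hP
      simp only [BProgram.natWrites, List.mem_append, not_or] at ha
      exact ih hP.2.2 ha.2
    | _ => simp [BProgram.erase] at hP
  | loopTrue hb h₁ h₂ ih₁ ih₂ =>
    cases A with
    | loop d b s =>
      have hP' := hP
      simp only [BProgram.erase, Program.loop.injEq] at hP
      rw [ih₂ hP' ha, ih₁ hP.2 ha]
    | _ => simp [BProgram.erase] at hP
  | loopFalse hb => rfl

theorem Runs.real_eq {n m : ℕ} {v : Fin n → Finset (Fin m) → ℝ} {A : BProgram} {P : Program}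
    {σ τ : Store} {t : ℕ} (h : Runs v P σ t τ) (hP : P = A.erase) {a : ℕ}
    (ha : a ∉ A.realWrites) : τ.real a = σ.real a := by
  induction h generalizing A with
  | skip => rfl
  | setReal σ b r k e =>
    cases A <;> simp_all [BProgram.erase, BProgram.realWrites, Store.updateReal]
  | setNat σ b r k e => rfl
  | seq h₁ h₂ ih₁ ih₂ =>
    cases A with
    | seq s u =>
      simp only [BProgram.erase, Program.seq.injEq] at hP
      simp only [BProgram.realWrites, List.mem_append, not_or] at ha
      rw [ih₂ hP.2 ha.2, ih₁ hP.1 ha.1]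
    | _ => simp [BProgram.erase] at hP
  | iteTrue hb h₁ ih =>
    cases A with
    | ite b s u =>
      simp only [BProgram.erase, Program.ite.injEq] at hP
      simp only [BProgram.realWrites, List.mem_append, not_or] at ha
      exact ih hP.2.1 ha.1
    | _ => simp [BProgram.erase] at hP
  | iteFalse hb h₁ ih =>
    cases A with
    | ite b s u =>
      simp only [BProgram.erase, Program.ite.injEq] at hP
      simp only [BProgram.realWrites, List.mem_append, not_or] at ha
      exact ih hP.2.2 ha.2
    | _ => simp [BProgram.erase] at hP
  | loopTrue hb h₁ h₂ ih₁ ih₂ =>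
    cases A with
    | loop d b s =>
      have hP' := hP
      simp only [BProgram.erase, Program.loop.injEq] at hP
      rw [ih₂ hP' ha, ih₁ hP.2 ha]
    | _ => simp [BProgram.erase] at hP
  | loopFalse hb => rfl

/-- `A`, started in `σ`, halts within its time bound for size `N` in a memory satisfying `Q`. -/
def wp {n m : ℕ} (v : Fin n → Finset (Fin m) → ℝ) (N : ℕ) (A : BProgram) (Q : Store → Prop)
    (σ : Store) : Prop :=
  ∃ t τ, Runs v A.erase σ t τ ∧ t ≤ A.cost N ∧ Q τ

section Wp

variable {n m : ℕ} {v : Fin n → Finset (Fin m) → ℝ} {N : ℕ} {Q Q' : Store → Prop} {σ : Store}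

theorem wp_mono {A : BProgram} (h : wp v N A Q σ) (hQ : ∀ τ, Q τ → Q' τ) : wp v N A Q' σ := by
  obtain ⟨t, τ, h₁, h₂, h₃⟩ := h
  exact ⟨t, τ, h₁, h₂, hQ _ h₃⟩

/-- The arrays not written to may be assumed to be unchanged in the postcondition. -/
theorem wp_frame {A : BProgram} (h : wp v N A Q σ)
    (hQ : ∀ τ, (∀ a, a ∉ A.natWrites → τ.nat a = σ.nat a) →
      (∀ a, a ∉ A.realWrites → τ.real a = σ.real a) → Q τ → Q' τ) : wp v N A Q' σ := by
  obtain ⟨t, τ, h₁, h₂, h₃⟩ := h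
  exact ⟨t, τ, h₁, h₂, hQ _ (fun a ha => h₁.nat_eq rfl ha) (fun a ha => h₁.real_eq rfl ha) h₃⟩

theorem wp_skip (h : Q σ) : wp v N .skip Q σ := ⟨1, σ, .skip σ, le_rfl, h⟩

theorem wp_setNat {a : ℕ} {r k e : NExp}
    (h : Q (σ.updateNat a (r.eval σ) (k.eval σ) (e.eval σ))) : wp v N (.setNat a r k e) Q σ :=
  ⟨_, _, .setNat σ a r k e, le_rfl, h⟩

theorem wp_setReal {a : ℕ} {r k : NExp} {e : RExp}
    (h : Q (σ.updateReal a (r.eval σ) (k.eval σ) (e.eval v σ))) :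
    wp v N (.setReal a r k e) Q σ :=
  ⟨_, _, .setReal σ a r k e, le_rfl, h⟩

theorem wp_seq {s u : BProgram} (h : wp v N s (wp v N u Q) σ) : wp v N (.seq s u) Q σ := by
  obtain ⟨t, τ, h₁, h₂, t', ρ, h₃, h₄, h₅⟩ := h
  exact ⟨t + t', ρ, .seq h₁ h₃, add_le_add h₂ h₄, h₅⟩

theorem wp_ite {b : BExp} {s u : BProgram} (h₁ : b.Holds v σ → wp v N s Q σ)
    (h₂ : ¬ b.Holds v σ → wp v N u Q σ) : wp v N (.ite b s u) Q σ := by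
  by_cases hb : b.Holds v σ
  · obtain ⟨t, τ, h, ht, hQ⟩ := h₁ hb
    refine ⟨_, τ, .iteTrue hb h, ?_, hQ⟩
    simp only [BProgram.cost]
    omega
  · obtain ⟨t, τ, h, ht, hQ⟩ := h₂ hb
    refine ⟨_, τ, .iteFalse hb h, ?_, hQ⟩
    simp only [BProgram.cost]
    omega

/-- Loops, with an invariant `I` and a variant `μ`. -/
theorem wp_loop {d : ℕ} {b : BExp} {s : BProgram} (I : Store → Prop) (μ : Store → ℕ) (hI : I σ)
    (hμ : μ σ ≤ N ^ d)
    (hs : ∀ σ, I σ → b.Holds v σ → wp v N s (fun τ => I τ ∧ μ τ < μ σ) σ)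
    (hQ : ∀ σ, I σ → ¬ b.Holds v σ → Q σ) : wp v N (.loop d b s) Q σ := by
  -- The induction is on an arbitrary bound `j` of the variant; `N ^ d` is only its initial value.
  suffices H : ∀ j σ, I σ → μ σ ≤ j → ∃ t τ, Runs v (.loop b s.erase) σ t τ ∧
      t ≤ j * (b.size + s.cost N) + b.size ∧ Q τ by
    exact H _ σ hI hμ
  intro j
  induction j with
  | zero =>
    intro σ hI hμ
    by_cases hb : b.Holds v σ
    · obtain ⟨t, τ, -, -, -, h⟩ := hs σ hI hb
      omega
    · exact ⟨_, _, .loopFalse hb, by omega, hQ _ hI hb⟩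
  | succ j ih =>
    intro σ hI hμ
    by_cases hb : b.Holds v σ
    · obtain ⟨t, τ, h₁, h₂, h₃, h₄⟩ := hs σ hI hb
      obtain ⟨t', ρ, h₅, h₆, h₇⟩ := ih τ h₃ (by omega)
      refine ⟨_, ρ, .loopTrue hb h₁ h₅, ?_, h₇⟩
      calc b.size + t + t' ≤ b.size + s.cost N + (j * (b.size + s.cost N) + b.size) := by omega
        _ = _ := by ring
    · exact ⟨_, _, .loopFalse hb, by omega, hQ _ hI hb⟩

end Wp

/-! ### Memory updates and evaluation of expressions -/

namespace Store

@[simp] theorem updateNat_real (σ : Store) (a r k x : ℕ) : (σ.updateNat a r k x).real = σ.real :=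
  rfl

@[simp] theorem updateReal_nat (σ : Store) (a r k : ℕ) (x : ℝ) :
    (σ.updateReal a r k x).nat = σ.nat := rfl

@[simp] theorem updateNat_nat_ne (σ : Store) {a a' : ℕ} (r k x : ℕ) (h : a' ≠ a) :
    (σ.updateNat a r k x).nat a' = σ.nat a' := by
  funext r' k'
  simp [updateNat, h]

@[simp] theorem updateReal_real_ne (σ : Store) {a a' : ℕ} (r k : ℕ) (x : ℝ) (h : a' ≠ a) :
    (σ.updateReal a r k x).real a' = σ.real a' := by
  funext r' k'
  simp [updateReal, h]

theorem updateNat_nat_same (σ : Store) (a r k x r' k' : ℕ) :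
    (σ.updateNat a r k x).nat a r' k' = if r' = r ∧ k' = k then x else σ.nat a r' k' := by
  simp [updateNat]

theorem updateReal_real_same (σ : Store) (a r k : ℕ) (x : ℝ) (r' k' : ℕ) :
    (σ.updateReal a r k x).real a r' k' = if r' = r ∧ k' = k then x else σ.real a r' k' := by
  simp [updateReal]

@[simp] theorem updateNat_nat_self (σ : Store) (a r k x : ℕ) :
    (σ.updateNat a r k x).nat a r k = x := by
  simp [updateNat]

@[simp] theorem updateReal_real_self (σ : Store) (a r k : ℕ) (x : ℝ) :
    (σ.updateReal a r k x).real a r k = x := by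
  simp [updateReal]

@[simp] theorem updateNat_updateNat (σ : Store) (a r k x y : ℕ) :
    (σ.updateNat a r k x).updateNat a r k y = σ.updateNat a r k y := by
  simp only [updateNat, mk.injEq, and_true]
  funext a' r' k'
  split_ifs <;> rfl

theorem row_congr {σ τ : Store} {a : ℕ} (h : τ.nat a = σ.nat a) (m r : ℕ) :
    τ.row m a r = σ.row m a r := by
  simp [row, h]

theorem mem_row {σ : Store} {m a r : ℕ} {g : Fin m} : g ∈ σ.row m a r ↔ σ.nat a r g ≠ 0 := by
  simp [row]

@[simp] theorem row_updateNat_ne (σ : Store) {a a' : ℕ} (m r k x r' : ℕ) (h : a' ≠ a) :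
    (σ.updateNat a r k x).row m a' r' = σ.row m a' r' :=
  row_congr (updateNat_nat_ne _ _ _ _ h) _ _

theorem row_updateNat_row_ne (σ : Store) (m a k x : ℕ) {r r' : ℕ} (h : r' ≠ r) :
    (σ.updateNat a r k x).row m a r' = σ.row m a r' := by
  simp [row, updateNat, h]

theorem row_updateNat_zero (σ : Store) {m : ℕ} (a r : ℕ) (k : Fin m) :
    (σ.updateNat a r k 0).row m a r = σ.row m a r \ {k} := by
  ext g
  simp only [mem_row, updateNat_nat_same, true_and, Finset.mem_sdiff, Finset.mem_singleton,
    Fin.ext_iff]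
  split_ifs <;> simp_all

theorem row_updateNat_pos (σ : Store) {m x : ℕ} (a r : ℕ) (k : Fin m) (hx : x ≠ 0) :
    (σ.updateNat a r k x).row m a r = insert k (σ.row m a r) := by
  ext g
  simp only [mem_row, updateNat_nat_same, true_and, Finset.mem_insert, Fin.ext_iff]
  split_ifs <;> simp_all

end Store

/-- The value query of agent number `i`, with value `0` if there is no such agent. -/
def query {n m : ℕ} (v : Fin n → Finset (Fin m) → ℝ) (i : ℕ) (S : Finset (Fin m)) : ℝ :=
  if h : i < n then v ⟨i, h⟩ S else 0

theorem query_of_lt {n m : ℕ} (v : Fin n → Finset (Fin m) → ℝ) {i : ℕ} (h : i < n)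
    (S : Finset (Fin m)) : query v i S = v ⟨i, h⟩ S := dif_pos h

@[simp] theorem query_val {n m : ℕ} (v : Fin n → Finset (Fin m) → ℝ) (i : Fin n)
    (S : Finset (Fin m)) : query v i S = v i S := dif_pos i.2

attribute [simp] NExp.eval BExp.Holds

section EvalLemmas

variable {n m : ℕ} (v : Fin n → Finset (Fin m) → ℝ) (σ : Store)

@[simp] theorem RExp.eval_ofNat (e : NExp) : (RExp.ofNat e).eval v σ = e.eval σ := rfl

@[simp] theorem RExp.eval_get (a : ℕ) (r k : NExp) :
    (RExp.get a r k).eval v σ = σ.real a (r.eval σ) (k.eval σ) := rfl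

@[simp] theorem RExp.eval_add (e f : RExp) :
    (RExp.add e f).eval v σ = e.eval v σ + f.eval v σ := rfl

@[simp] theorem RExp.eval_sub (e f : RExp) :
    (RExp.sub e f).eval v σ = e.eval v σ - f.eval v σ := rfl

@[simp] theorem RExp.eval_mul (e f : RExp) :
    (RExp.mul e f).eval v σ = e.eval v σ * f.eval v σ := rfl

@[simp] theorem RExp.eval_div (e f : RExp) :
    (RExp.div e f).eval v σ = e.eval v σ / f.eval v σ := rfl

@[simp] theorem RExp.eval_pow (e f : RExp) :
    (RExp.pow e f).eval v σ = if 0 < e.eval v σ then e.eval v σ ^ f.eval v σ else 0 := rfl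

@[simp] theorem RExp.eval_log (e : RExp) :
    (RExp.log e).eval v σ = if 0 < e.eval v σ then Real.log (e.eval v σ) else 0 := rfl

end EvalLemmas

@[simp] theorem RExp.eval_value {n m : ℕ} (v : Fin n → Finset (Fin m) → ℝ) (σ : Store) (i : NExp) (a : ℕ)
    (r : NExp) : (RExp.value i a r).eval v σ = query v (i.eval σ) (σ.row m a (r.eval σ)) := rfl

/-- The arrays that occur in an expression. -/
def NExp.arrays : NExp → List ℕ
  | .lit _ => []
  | .get a r k => a :: (r.arrays ++ k.arrays)
  | .add e f => e.arrays ++ f.arrays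
  | .sub e f => e.arrays ++ f.arrays

theorem NExp.eval_congr {σ τ : Store} {e : NExp} (h : ∀ a ∈ e.arrays, τ.nat a = σ.nat a) :
    e.eval τ = e.eval σ := by
  induction e with
  | lit k => rfl
  | get a r k hr hk =>
    simp only [arrays, List.mem_cons, List.mem_append] at h
    simp only [eval, hr fun a ha => h a (.inr (.inl ha)), hk fun a ha => h a (.inr (.inr ha)),
      h a (.inl rfl)]
  | add e f he hf =>
    simp only [arrays, List.mem_append] at h
    simp only [eval, he fun a ha => h a (.inl ha), hf fun a ha => h a (.inr ha)]
  | sub e f he hf =>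
    simp only [arrays, List.mem_append] at h
    simp only [eval, he fun a ha => h a (.inl ha), hf fun a ha => h a (.inr ha)]

/-- The scalar variable stored at the origin of array `a`. -/
abbrev NExp.var (a : ℕ) : NExp := .get a (.lit 0) (.lit 0)

/-- The number of agents. -/
abbrev NExp.agents : NExp := .get 0 (.lit 0) (.lit 0)

/-- The number of goods. -/
abbrev NExp.goods : NExp := .get 0 (.lit 0) (.lit 1)

/-! ### Counted loops and linear search -/

namespace BProgram

/-- Assignment to a scalar variable. -/
abbrev assign (a : ℕ) (e : NExp) : BProgram := .setNat a (.lit 0) (.lit 0) e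

/-- `for x < e do s` -/
def forLoop (x : ℕ) (e : NExp) (s : BProgram) : BProgram :=
  .seq (assign x (.lit 0)) (.loop 1 (.natLT (.var x) e)
    (.seq s (assign x (.add (.var x) (.lit 1)))))

/-- `x` becomes the first number below `e` with the property `b`, or `e` if there is none. -/
def find (x : ℕ) (e : NExp) (b : BExp) : BProgram :=
  .seq (assign x (.lit 0)) (.loop 1 (.and (.natLT (.var x) e) (.not b))
    (assign x (.add (.var x) (.lit 1))))

end BProgram

section Wp

variable {n m : ℕ} {v : Fin n → Finset (Fin m) → ℝ} {N : ℕ} {Q Q' : Store → Prop} {σ : Store}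

/-- For loops: the body must not write to the loop variable or to an array in the bound. -/
theorem wp_forLoop {x : ℕ} {e : NExp} {s : BProgram} (bd : ℕ) (I : ℕ → Store → Prop)
    (hx : x ∉ s.natWrites)
    (he : ∀ k, e.eval (σ.updateNat x 0 0 k) = bd) (hN : bd ≤ N)
    (he' : ∀ σ τ : Store, (∀ a, a ∉ s.natWrites → a ≠ x → τ.nat a = σ.nat a) →
      e.eval τ = e.eval σ)
    (h0 : I 0 (σ.updateNat x 0 0 0))
    (hs : ∀ i τ, i < bd → τ.nat x 0 0 = i → (∀ a, a ∉ s.natWrites → a ≠ x → τ.nat a = σ.nat a) →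
      (∀ a, a ∉ s.realWrites → τ.real a = σ.real a) →
      I i τ → wp v N s (fun ρ => I (i + 1) (ρ.updateNat x 0 0 (i + 1))) τ)
    (hQ : ∀ τ, τ.nat x 0 0 = bd → I bd τ → Q τ) : wp v N (.forLoop x e s) Q σ := by
  refine wp_seq (wp_setNat ?_)
  refine wp_loop (fun τ => τ.nat x 0 0 ≤ bd ∧ I (τ.nat x 0 0) τ ∧
    (∀ a, a ∉ s.natWrites → a ≠ x → τ.nat a = σ.nat a) ∧
      (∀ a, a ∉ s.realWrites → τ.real a = σ.real a)) (fun τ => bd - τ.nat x 0 0) ?_ ?_ ?_ ?_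
  · refine ⟨by simp [NExp.eval], by simpa [NExp.eval] using h0, ?_, ?_⟩
    · intro a _ hax
      exact Store.updateNat_nat_ne _ _ _ _ hax
    · intro a _
      rfl
  · simp only [pow_one]
    omega
  · rintro τ ⟨h1, h2, h3, h3'⟩ hb
    have hev : e.eval τ = bd := by
      rw [← he 0]
      exact he' _ _ fun a ha hax => by rw [h3 a ha hax, Store.updateNat_nat_ne _ _ _ _ hax]
    simp only [BExp.Holds, NExp.eval, hev] at hb
    refine wp_seq (wp_frame (hs _ τ hb rfl h3 h3' h2) fun ρ hρ hρ' hI => wp_setNat ?_)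
    have hxρ : ρ.nat x 0 0 = τ.nat x 0 0 := by rw [hρ x hx]
    simp only [NExp.eval, hxρ]
    refine ⟨⟨?_, ?_, ?_, ?_⟩, ?_⟩
    · simpa using hb
    · simpa using hI
    · intro a ha hax
      rw [Store.updateNat_nat_ne _ _ _ _ hax, hρ a ha, h3 a ha hax]
    · intro a ha
      rw [Store.updateNat_real, hρ' a ha, h3' a ha]
    · simp only [Store.updateNat_nat_self]
      omega
  · rintro τ ⟨h1, h2, h3, -⟩ hb
    have hev : e.eval τ = bd := by
      rw [← he 0]
      exact he' _ _ fun a ha hax => by rw [h3 a ha hax, Store.updateNat_nat_ne _ _ _ _ hax]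
    simp only [BExp.Holds, NExp.eval, hev] at hb
    have : τ.nat x 0 0 = bd := by omega
    exact hQ τ this (this ▸ h2)

/-- For loops: the body writes neither to the loop variable nor to an array in the bound. -/
theorem wp_for {x : ℕ} {e : NExp} {s : BProgram} (bd : ℕ) (I : ℕ → Store → Prop)
    (hx : x ∉ s.natWrites) (he : ∀ a ∈ e.arrays, a ≠ x ∧ a ∉ s.natWrites)
    (hbd : e.eval σ = bd) (hN : bd ≤ N) (h0 : I 0 (σ.updateNat x 0 0 0))
    (hs : ∀ i τ, i < bd → τ.nat x 0 0 = i → (∀ a, a ∉ s.natWrites → a ≠ x → τ.nat a = σ.nat a) →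
      (∀ a, a ∉ s.realWrites → τ.real a = σ.real a) →
      I i τ → wp v N s (fun ρ => I (i + 1) (ρ.updateNat x 0 0 (i + 1))) τ)
    (hQ : ∀ τ, τ.nat x 0 0 = bd → I bd τ → Q τ) : wp v N (.forLoop x e s) Q σ := by
  refine wp_forLoop bd I hx (fun k => ?_) hN (fun σ τ h => ?_) h0 hs hQ
  · rw [← hbd]
    exact NExp.eval_congr fun a ha => Store.updateNat_nat_ne _ _ _ _ (he a ha).1
  · exact NExp.eval_congr fun a ha => h a (he a ha).2 (he a ha).1

/-- The outcome `k = bd` certifies that no index below `bd` has the property. Callers rely on this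
negative information as much as on a positive find. -/
theorem wp_find {x : ℕ} {e : NExp} {b : BExp} (bd : ℕ) (p : ℕ → Prop)
    (he' : ∀ a ∈ e.arrays, a ≠ x) (hbd : e.eval σ = bd) (hN : bd ≤ N)
    (hp : ∀ k, b.Holds v (σ.updateNat x 0 0 k) ↔ p k)
    (hQ : ∀ k, k ≤ bd → (∀ j < k, ¬ p j) → (k < bd → p k) → Q (σ.updateNat x 0 0 k)) :
    wp v N (.find x e b) Q σ := by
  have he : ∀ k, e.eval (σ.updateNat x 0 0 k) = bd := fun k => hbd ▸
    NExp.eval_congr fun a ha => Store.updateNat_nat_ne _ _ _ _ (he' a ha)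
  refine wp_seq (wp_setNat ?_)
  refine wp_loop (fun τ => ∃ k, k ≤ bd ∧ τ = σ.updateNat x 0 0 k ∧ ∀ j < k, ¬ p j)
    (fun τ => bd - τ.nat x 0 0) ?_ ?_ ?_ ?_
  · exact ⟨0, by omega, rfl, by omega⟩
  · simp only [pow_one]
    omega
  · rintro τ ⟨k, h1, rfl, h3⟩ ⟨hb, hb'⟩
    simp only [BExp.Holds, NExp.eval, he, Store.updateNat_nat_self, hp] at hb hb'
    refine wp_setNat ⟨⟨k + 1, hb, ?_, ?_⟩, ?_⟩
    · simp [NExp.eval]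
    · intro j hj
      rcases Nat.lt_succ_iff_lt_or_eq.1 hj with h | rfl
      · exact h3 j h
      · exact hb'
    · simp [NExp.eval]
      omega
  · rintro τ ⟨k, h1, rfl, h3⟩ hb
    simp only [BExp.Holds, NExp.eval, he, Store.updateNat_nat_self, hp, not_and, not_not] at hb
    exact hQ k h1 h3 hb

end Wp

/-! Fair division: the moves of the algorithm and its potential function. -/

section Bundles

variable {n m : ℕ}

/-- No agent violates `α`-EFX towards the bundle `S`. -/
def EFXBundle (v : Fin n → Finset (Fin m) → ℝ) (α : ℝ) (X : Fin n → Finset (Fin m))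
    (S : Finset (Fin m)) : Prop :=
  ∀ k, ∀ h ∈ S, α * v k (S \ {h}) ≤ v k (X k)

/-- No agent violates EF1 towards the bundle `S`. -/
def EF1Bundle (v : Fin n → Finset (Fin m) → ℝ) (X : Fin n → Finset (Fin m))
    (S : Finset (Fin m)) : Prop :=
  ∀ k, S.Nonempty → ∃ h ∈ S, v k (S \ {h}) ≤ v k (X k)

/-- No agent prefers the bundle `S` to her own. -/
def Unenvied (v : Fin n → Finset (Fin m) → ℝ) (X : Fin n → Finset (Fin m))
    (S : Finset (Fin m)) : Prop :=
  ∀ k, v k S ≤ v k (X k)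

variable {v : Fin n → Finset (Fin m) → ℝ} {X X' : Fin n → Finset (Fin m)}
  {S B B' Z : Finset (Fin m)} {α ε : ℝ}

theorem EFXBundle.mono (h : EFXBundle v α X S) (hX : ∀ i, v i (X i) ≤ v i (X' i)) :
    EFXBundle v α X' S :=
  fun k g hg => (h k g hg).trans (hX k)

theorem EF1Bundle.mono (h : EF1Bundle v X S) (hX : ∀ i, v i (X i) ≤ v i (X' i)) :
    EF1Bundle v X' S :=
  fun k hS => (h k hS).imp fun _ hg => ⟨hg.1, hg.2.trans (hX k)⟩

theorem Unenvied.mono (h : Unenvied v X S) (hX : ∀ i, v i (X i) ≤ v i (X' i)) :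
    Unenvied v X' S :=
  fun k => (h k).trans (hX k)

theorem Unenvied.subset (hv : ∀ i, IsSubadditiveValuation (v i)) (h : Unenvied v X S)
    (hZ : Z ⊆ S) : Unenvied v X Z :=
  fun k => ((hv k).mono _ _ hZ).trans (h k)

theorem Unenvied.efx (hv : ∀ i, IsSubadditiveValuation (v i)) (h : Unenvied v X S) (hα : α ≤ 1) :
    EFXBundle v α X S := by
  intro k g _
  have h1 := (hv k).nonneg (S \ {g})
  have h2 := (h.subset hv (Finset.sdiff_subset (s := S) (t := {g}))) k
  nlinarith

theorem Unenvied.ef1 (hv : ∀ i, IsSubadditiveValuation (v i)) (h : Unenvied v X S) :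
    EF1Bundle v X S :=
  fun k ⟨g, hg⟩ => ⟨g, hg, h.subset hv Finset.sdiff_subset k⟩

/-- Removing `g` leaves a part of an unenvied set. This is how EF1 is obtained for every bundle or
bag formed with an additional good. -/
theorem Unenvied.ef1_of_subset_insert (hv : ∀ i, IsSubadditiveValuation (v i))
    (h : Unenvied v X S) {g : Fin m} (hZ : Z ⊆ insert g S) : EF1Bundle v X Z := by
  intro k hne
  by_cases hg : g ∈ Z
  · refine ⟨g, hg, h.subset hv ?_ k⟩
    intro x hx
    simp only [Finset.mem_sdiff, Finset.mem_singleton] at hx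
    exact Finset.mem_of_mem_insert_of_ne (hZ hx.1) hx.2
  · refine (h.subset hv ?_).ef1 hv k hne
    intro x hx
    exact Finset.mem_of_mem_insert_of_ne (hZ hx) fun e => hg (e ▸ hx)

theorem EFXBundle.of_le (hv : ∀ i, IsSubadditiveValuation (v i)) {β : ℝ}
    (h : EFXBundle v α X S) (hβ : β ≤ α) : EFXBundle v β X S :=
  fun k g hg => (mul_le_mul_of_nonneg_right hβ ((hv k).nonneg _)).trans (h k g hg)

end Bundles

/-! ### The potential function: geometric levels of values and counts of envy -/

section Potential

variable {n m : ℕ} (v : Fin n → Finset (Fin m) → ℝ) (ε : ℝ)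

/-- The number of powers of `1 + ε` by which the value of a set can exceed that of its best good. -/
noncomputable def levelBound (m : ℕ) (ε : ℝ) : ℕ := m * ⌈1 / ε⌉₊

/-- The number of pairs `(g, k)` such that `(1 + ε) ^ k` times the value of `g` is positive and at
most the value of `S`. -/
noncomputable def level (i : Fin n) (S : Finset (Fin m)) : ℕ :=
  open Classical in
  ((Finset.univ ×ˢ Finset.range (levelBound m ε + 1)).filter fun q : Fin m × ℕ =>
    0 < v i {q.1} ∧ v i {q.1} * (1 + ε) ^ q.2 ≤ v i S).card

theorem level_le (i : Fin n) (S : Finset (Fin m)) : level v ε i S ≤ m * (levelBound m ε + 1) := by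
  classical
  unfold level
  refine (Finset.card_filter_le _ _).trans ?_
  simp

variable {v ε}

theorem level_mono {i : Fin n} {S T : Finset (Fin m)} (h : v i S ≤ v i T) :
    level v ε i S ≤ level v ε i T := by
  classical
  unfold level
  refine Finset.card_le_card fun q hq => ?_
  simp only [Finset.mem_filter] at hq ⊢
  exact ⟨hq.1, hq.2.1, hq.2.2.trans h⟩

theorem IsSubadditiveValuation.le_sum {w : Finset (Fin m) → ℝ} (hw : IsSubadditiveValuation w)
    (S : Finset (Fin m)) : w S ≤ ∑ g ∈ S, w {g} := by
  induction S using Finset.induction_on with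
  | empty => simp [hw.normalized]
  | insert g S hg ih =>
    rw [Finset.sum_insert hg, Finset.insert_eq]
    exact (hw.subadd _ _).trans (by linarith)

theorem IsSubadditiveValuation.exists_good {w : Finset (Fin m) → ℝ}
    (hw : IsSubadditiveValuation w) {S : Finset (Fin m)} (hS : S.Nonempty) :
    ∃ g ∈ S, w S ≤ S.card * w {g} := by
  obtain ⟨g, hg, hmax⟩ := S.exists_max_image (fun g => w {g}) hS
  refine ⟨g, hg, (hw.le_sum S).trans ?_⟩
  calc ∑ h ∈ S, w {h} ≤ ∑ _h ∈ S, w {g} := Finset.sum_le_sum hmax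
    _ = _ := by simp

/-- Let `g` be a best good of `T` and `k` the largest exponent with `v {g} * (1 + ε) ^ k ≤ v T`. The
pair `(g, k)` counts for `T` but not for `S`: since `(1 + ε) * (1 - ε) ≤ 1`, the value `(1 + ε) * v
S` is less than `v T`, hence less than `v {g} * (1 + ε) ^ (k + 1)`. -/
theorem level_lt (hv : ∀ i, IsSubadditiveValuation (v i)) (hε : 0 < ε) {i : Fin n}
    {S T : Finset (Fin m)} (h : v i S < (1 - ε) * v i T) : level v ε i S < level v ε i T := by
  classical
  have hS := (hv i).nonneg S
  have hT0 := (hv i).nonneg T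
  have hT : 0 < v i T := by
    rcases hT0.lt_or_eq with h' | h'
    · exact h'
    · rw [← h'] at h
      linarith
  have hTne : T.Nonempty := by
    rw [Finset.nonempty_iff_ne_empty]
    rintro rfl
    rw [(hv i).normalized] at hT
    exact lt_irrefl _ hT
  obtain ⟨g, hg, hgT⟩ := (hv i).exists_good hTne
  have hcard : (T.card : ℝ) ≤ m := by
    have := T.card_le_univ
    simp only [Fintype.card_fin] at this
    exact_mod_cast this
  have hg0 : 0 < v i {g} := by
    by_contra hle
    have : v i {g} = 0 := le_antisymm (not_lt.1 hle) ((hv i).nonneg _)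
    rw [this, mul_zero] at hgT
    linarith
  have hgle : v i {g} ≤ v i T := (hv i).mono _ _ (by simpa using hg)
  -- By Bernoulli's inequality `m * ⌈1 / ε⌉` factors `1 + ε` have a product above `m`, while
  -- subadditivity gives `v T ≤ m * v {g}`. So the exponent sought lies in the range that `level`
  -- counts.
  have hpow : (m : ℝ) < (1 + ε) ^ (levelBound m ε + 1) := by
    have h1 : 1 + ((levelBound m ε : ℕ) : ℝ) * ε ≤ (1 + ε) ^ (levelBound m ε) :=
      one_add_mul_le_pow (by linarith) _
    have h2 : (m : ℝ) ≤ (levelBound m ε : ℕ) * ε := by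
      have : 1 / ε ≤ (⌈1 / ε⌉₊ : ℝ) := Nat.le_ceil _
      unfold levelBound
      push_cast
      rw [div_le_iff₀ hε] at this
      nlinarith [(Nat.cast_nonneg m : (0 : ℝ) ≤ m)]
    have h3 : (1 + ε) ^ (levelBound m ε) ≤ (1 + ε) ^ (levelBound m ε + 1) :=
      pow_le_pow_right₀ (by linarith) (by omega)
    linarith
  have hex : ∃ k, v i T < v i {g} * (1 + ε) ^ (k + 1) := by
    refine ⟨levelBound m ε, hgT.trans_lt ?_⟩
    rw [mul_comm]
    exact mul_lt_mul_of_pos_left (hcard.trans_lt hpow) hg0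
  have hk := Nat.find_spec hex
  have hkle : Nat.find hex ≤ levelBound m ε := Nat.find_min' hex (by
    refine hgT.trans_lt ?_
    rw [mul_comm]
    exact mul_lt_mul_of_pos_left (hcard.trans_lt hpow) hg0)
  have hk' : v i {g} * (1 + ε) ^ (Nat.find hex) ≤ v i T := by
    rcases Nat.eq_zero_or_pos (Nat.find hex) with h0 | h0
    · rw [h0]
      simpa using hgle
    · have := Nat.find_min hex (Nat.sub_lt h0 one_pos)
      rw [show Nat.find hex - 1 + 1 = Nat.find hex by omega] at this
      exact not_lt.1 this
  unfold level
  refine Finset.card_lt_card ⟨fun q hq => ?_, fun hsub => ?_⟩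
  · simp only [Finset.mem_filter] at hq ⊢
    refine ⟨hq.1, hq.2.1, hq.2.2.trans ?_⟩
    nlinarith
  · have := @hsub (g, Nat.find hex) (by
      simp only [Finset.mem_filter, Finset.mem_product, Finset.mem_univ, Finset.mem_range, true_and]
      exact ⟨by omega, hg0, hk'⟩)
    simp only [Finset.mem_filter] at this
    have h5 := this.2.2
    have h6 : (1 + ε) * v i S < v i T := by
      have h7 := mul_lt_mul_of_pos_left h (show 0 < 1 + ε by linarith)
      have h8 := mul_nonneg (sq_nonneg ε) hT0
      nlinarith
    rw [pow_succ] at hk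
    nlinarith

variable (v ε)

/-- The number of preferences of agents for other bundles, counting `B` as a bundle. -/
noncomputable def envyCount (X : Fin n → Finset (Fin m)) (B : Finset (Fin m)) : ℕ :=
  open Classical in
  ∑ i, ((insert B (Finset.univ.image X)).filter fun S => v i (X i) < v i S).card

theorem envyCount_le (X : Fin n → Finset (Fin m)) (B : Finset (Fin m)) :
    envyCount v X B ≤ n * (n + 1) := by
  classical
  unfold envyCount
  refine (Finset.sum_le_card_nsmul _ _ (n + 1) fun i _ => ?_).trans (by simp)
  refine (Finset.card_filter_le _ _).trans ((Finset.card_insert_le _ _).trans ?_)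
  have := Finset.card_image_le (s := (Finset.univ : Finset (Fin n))) (f := X)
  simp only [Finset.card_univ, Fintype.card_fin] at this
  omega

variable {v ε}

/-- When the sets in play are only passed around, no new preference arises, because each agent
compares with a value that has not decreased. The agent who improves has lost one preference, namely
that for the set she now owns. Counting distinct sets makes their owners irrelevant. -/
theorem envyCount_lt {X X' : Fin n → Finset (Fin m)} {B B' : Finset (Fin m)}
    (hB : B' = B ∨ ∃ j, B' = X j) (hX : ∀ i, X' i = B ∨ ∃ j, X' i = X j)
    (hmono : ∀ i, v i (X i) ≤ v i (X' i)) (hlt : ∃ i, v i (X i) < v i (X' i)) :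
    envyCount v X' B' < envyCount v X B := by
  classical
  have hsub : insert B' (Finset.univ.image X') ⊆ insert B (Finset.univ.image X) := by
    intro S hS
    simp only [Finset.mem_insert, Finset.mem_image, Finset.mem_univ, true_and] at hS ⊢
    rcases hS with rfl | ⟨i, rfl⟩
    · rcases hB with h | ⟨j, h⟩
      · exact .inl h
      · exact .inr ⟨j, h.symm⟩
    · rcases hX i with h | ⟨j, h⟩
      · exact .inl h
      · exact .inr ⟨j, h.symm⟩
  have hsub' : ∀ i, (insert B' (Finset.univ.image X')).filter (fun S => v i (X' i) < v i S) ⊆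
      (insert B (Finset.univ.image X)).filter fun S => v i (X i) < v i S := by
    intro i S hS
    simp only [Finset.mem_filter] at hS ⊢
    exact ⟨hsub hS.1, (hmono i).trans_lt hS.2⟩
  unfold envyCount
  refine Finset.sum_lt_sum (fun i _ => Finset.card_le_card (hsub' i)) ?_
  obtain ⟨i, hi⟩ := hlt
  refine ⟨i, Finset.mem_univ _, Finset.card_lt_card ⟨hsub' i, fun h => ?_⟩⟩
  have := @h (X' i) (by
    simp only [Finset.mem_filter]
    refine ⟨hsub (by simp), hi⟩)
  simp at this

variable (v ε)

/-- The potential between two moves that increase the value of an agent by a factor `1 + ε`. -/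
noncomputable def minorPotential (X : Fin n → Finset (Fin m)) (B : Finset (Fin m)) : ℕ :=
  open Classical in
  -- Two phases share one number. While the bag is envied or incomplete, the goods still outside are
  -- counted, with an offset above every bag size; afterwards the bag itself has to shrink. The
  -- factor `n * (n + 1) + 1` exceeds every `envyCount`, so the comparison is lexicographic.
  (if Unenvied v X B ∧ unallocated X ⊆ B then B.card else m + 1 + (unallocated X \ B).card) *
    (n * (n + 1) + 1) + envyCount v X B

/-- The potential function of the algorithm. -/
noncomputable def potential (X : Fin n → Finset (Fin m)) (B : Finset (Fin m)) : ℕ :=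
  -- The weight of one missing level exceeds every value of `minorPotential`, so a gained level pays
  -- for any change of the rest.
  (∑ i, (m * (levelBound m ε + 1) - level v ε i (X i))) * ((2 * m + 2) * (n * (n + 1) + 1)) +
    minorPotential v X B

theorem minorPotential_lt (X : Fin n → Finset (Fin m)) (B : Finset (Fin m)) :
    minorPotential v X B < (2 * m + 2) * (n * (n + 1) + 1) := by
  classical
  have h1 := envyCount_le v X B
  have h2 : (unallocated X \ B).card ≤ m := by simpa using (unallocated X \ B).card_le_univ
  have h3 : B.card ≤ m := by simpa using B.card_le_univ
  unfold minorPotential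
  have h4 : (if Unenvied v X B ∧ unallocated X ⊆ B then B.card
      else m + 1 + (unallocated X \ B).card) ≤ 2 * m + 1 := by
    split_ifs <;> omega
  calc _ ≤ (2 * m + 1) * (n * (n + 1) + 1) + n * (n + 1) := by gcongr
    _ < _ := by ring_nf; omega

theorem potential_le (X : Fin n → Finset (Fin m)) (B : Finset (Fin m)) :
    potential v ε X B ≤
      (n * (m * (levelBound m ε + 1)) + 1) * ((2 * m + 2) * (n * (n + 1) + 1)) := by
  have h : ∑ i, (m * (levelBound m ε + 1) - level v ε i (X i)) ≤ n * (m * (levelBound m ε + 1)) := by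
    refine (Finset.sum_le_card_nsmul _ _ _ fun i _ => Nat.sub_le _ _).trans ?_
    simp
  have h' := minorPotential_lt v X B
  unfold potential
  generalize (2 * m + 2) * (n * (n + 1) + 1) = K at h' ⊢
  rw [Nat.add_mul _ 1, Nat.one_mul]
  exact add_le_add (Nat.mul_le_mul_right _ h) h'.le

variable {v ε}

theorem potential_lt_of_minor {X X' : Fin n → Finset (Fin m)} {B B' : Finset (Fin m)}
    (hmono : ∀ i, v i (X i) ≤ v i (X' i)) (h : minorPotential v X' B' < minorPotential v X B) :
    potential v ε X' B' < potential v ε X B := by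
  unfold potential
  refine add_lt_add_of_le_of_lt (Nat.mul_le_mul_right _ (Finset.sum_le_sum fun i _ => ?_)) h
  exact Nat.sub_le_sub_left (level_mono (hmono i)) _

theorem potential_lt_of_major (hv : ∀ i, IsSubadditiveValuation (v i)) (hε : 0 < ε)
    {X X' : Fin n → Finset (Fin m)} {B B' : Finset (Fin m)}
    (hmono : ∀ i, v i (X i) ≤ v i (X' i)) (h : ∃ i, v i (X i) < (1 - ε) * v i (X' i)) :
    potential v ε X' B' < potential v ε X B := by
  have h1 : ∑ i, (m * (levelBound m ε + 1) - level v ε i (X' i)) <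
      ∑ i, (m * (levelBound m ε + 1) - level v ε i (X i)) := by
    refine Finset.sum_lt_sum (fun i _ => Nat.sub_le_sub_left (level_mono (hmono i)) _) ?_
    obtain ⟨i, hi⟩ := h
    refine ⟨i, Finset.mem_univ _, ?_⟩
    have h2 := level_lt hv hε hi
    have h3 := level_le v ε i (X' i)
    omega
  have h2 := minorPotential_lt v X' B'
  unfold potential
  calc _ < (∑ i, (m * (levelBound m ε + 1) - level v ε i (X' i))) *
        ((2 * m + 2) * (n * (n + 1) + 1)) + (2 * m + 2) * (n * (n + 1) + 1) := by omega
    _ = (∑ i, (m * (levelBound m ε + 1) - level v ε i (X' i)) + 1) *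
        ((2 * m + 2) * (n * (n + 1) + 1)) := by ring
    _ ≤ (∑ i, (m * (levelBound m ε + 1) - level v ε i (X i))) *
        ((2 * m + 2) * (n * (n + 1) + 1)) := Nat.mul_le_mul_right _ h1
    _ ≤ _ := Nat.le_add_right _ _

end Potential

/-! ### The moves preserve the invariant and decrease the potential -/

section Moves

variable {n m : ℕ}

/-- The invariant of the algorithm: `X` is the current allocation, `B` a set of unallocated goods
and `Y` the initial allocation.  In the complete mode (`c = true`) it may also hold with `1 - ε`
weakened to `1 / 2 - ε`, once the goods outside `X` are few and not envied. -/
structure FairState (v : Fin n → Finset (Fin m) → ℝ) (ε : ℝ) (c : Bool)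
    (Y X : Fin n → Finset (Fin m)) (B : Finset (Fin m)) : Prop where
  alloc : IsAllocation X
  disj : ∀ j, Disjoint (X j) B
  ef1 : ∀ j, EF1Bundle v X (X j)
  ef1_bag : EF1Bundle v X B
  efx : ((∀ j, EFXBundle v (1 - ε) X (X j)) ∧ EFXBundle v (1 - ε) X B) ∨
    (c = true ∧ Unenvied v X B ∧ unallocated X ⊆ B ∧ B.card < n ∧
      ∀ j, EFXBundle v (1 / 2 - ε) X (X j))
  dominates : ∀ i, v i (Y i) ≤ v i (X i)

variable {v : Fin n → Finset (Fin m) → ℝ} {ε : ℝ} {c : Bool} {Y X X' : Fin n → Finset (Fin m)}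
  {B B' Z : Finset (Fin m)}

theorem mem_unallocated {g : Fin m} : g ∈ unallocated X ↔ ∀ i, g ∉ X i := by
  simp [unallocated]

theorem FairState.subset_unallocated (h : FairState v ε c Y X B) : B ⊆ unallocated X :=
  fun _ hg => mem_unallocated.2 fun i hi => Finset.disjoint_left.1 (h.disj i) hi hg

/-- A bundle with at most one good has value zero after a removal, so all fairness conditions hold
at once. -/
theorem FairState.init (hv : ∀ i, IsSubadditiveValuation (v i)) (hX : IsAllocation X)
    (h1 : ∀ i, (X i).card ≤ 1) : FairState v ε c X X ∅ where
  alloc := hX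
  disj _ := Finset.disjoint_empty_right _
  ef1 j k hne := by
    obtain ⟨g, hg⟩ := hne
    refine ⟨g, hg, ?_⟩
    rw [Finset.sdiff_eq_empty_iff_subset.2 fun x hx => Finset.mem_singleton.2
      (Finset.card_le_one.1 (h1 j) x hx g hg), (hv k).normalized]
    exact (hv k).nonneg _
  ef1_bag k hne := by simp at hne
  efx := by
    refine .inl ⟨fun j k g hg => ?_, fun k g hg => by simp at hg⟩
    rw [Finset.sdiff_eq_empty_iff_subset.2 fun x hx => Finset.mem_singleton.2
      (Finset.card_le_one.1 (h1 j) x hx g hg), (hv k).normalized, mul_zero]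
    exact (hv k).nonneg _
  dominates _ := le_rfl

theorem FairState.isAlphaCEFX (hv : ∀ i, IsSubadditiveValuation (v i))
    (h : FairState v ε c Y X B) (hB : Unenvied v X B) (hR : unallocated X ⊆ B)
    (hn : B.card < n) (hc : c = true → B = ∅) :
    IsAlphaCEFX v (if c then 1 / 2 - ε else 1 - ε) c X := by
  have hBR : unallocated X = B := Finset.Subset.antisymm hR h.subset_unallocated
  refine ⟨h.alloc, ?_, fun i j hj => h.ef1 j i hj, hBR ▸ hn, fun i => hBR ▸ hB i, hBR ▸ hc⟩
  rcases h.efx with ⟨h1, -⟩ | ⟨rfl, -, -, -, h1⟩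
  · intro i j g hg
    refine (h1 j).of_le hv ?_ i g hg
    split_ifs <;> linarith
  · intro i j g hg
    simpa using h1 j i g hg

/-- An agent who prefers the bag to her bundle swaps the two. -/
theorem FairState.swap (h : FairState v ε c Y X B)
    {k : Fin n} (hk : v k (X k) < v k B) :
    FairState v ε c Y (Function.update X k B) (X k) ∧
      potential v ε (Function.update X k B) (X k) < potential v ε X B := by
  classical
  set X' := Function.update X k B with hX'
  have hself : X' k = B := by simp [hX']
  have hne : ∀ j, j ≠ k → X' j = X j := fun j hj => by simp [hX', hj]
  have hmono : ∀ i, v i (X i) ≤ v i (X' i) := by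
    intro i
    by_cases hi : i = k
    · subst hi
      rw [hself]
      exact hk.le
    · rw [hne i hi]
  -- An envied bag excludes the relaxed alternative of the invariant.
  obtain ⟨h1, h1'⟩ : (∀ j, EFXBundle v (1 - ε) X (X j)) ∧ EFXBundle v (1 - ε) X B := by
    rcases h.efx with h1 | ⟨-, h1, -⟩
    · exact h1
    · exact absurd (h1 k) (not_le.2 hk)
  -- The goods outside both the bundles and the bag stay the same. Hence the first coordinate of
  -- `minorPotential` does not increase, and `envyCount` decides.
  have hU : ∀ g, g ∈ unallocated X' \ X k ↔ g ∈ unallocated X \ B := by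
    intro g
    simp only [Finset.mem_sdiff, mem_unallocated]
    constructor
    · rintro ⟨h2, h3⟩
      refine ⟨fun i => ?_, by simpa [hself] using h2 k⟩
      by_cases hi : i = k
      · rwa [hi]
      · rw [← hne i hi]
        exact h2 i
    · rintro ⟨h2, h3⟩
      refine ⟨fun i => ?_, h2 k⟩
      by_cases hi : i = k
      · rwa [hi, hself]
      · rw [hne i hi]
        exact h2 i
  refine ⟨⟨?_, ?_, ?_, ?_, .inl ⟨?_, (h1 k).mono hmono⟩, fun i => (h.dominates i).trans (hmono i)⟩,
    potential_lt_of_minor hmono ?_⟩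
  · intro i j hij
    by_cases hi : i = k
    · subst hi
      rw [hself, hne j hij.symm]
      exact (h.disj j).symm
    · rw [hne i hi]
      by_cases hj : j = k
      · rw [hj, hself]
        exact h.disj i
      · rw [hne j hj]
        exact h.alloc i j hij
  · intro j
    by_cases hj : j = k
    · rw [hj, hself]
      exact (h.disj k).symm
    · rw [hne j hj]
      exact h.alloc j k hj
  · intro j
    by_cases hj : j = k
    · rw [hj, hself]
      exact h.ef1_bag.mono hmono
    · rw [hne j hj]
      exact (h.ef1 j).mono hmono
  · exact (h.ef1 k).mono hmono
  · intro j
    by_cases hj : j = k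
    · rw [hj, hself]
      exact h1'.mono hmono
    · rw [hne j hj]
      exact (h1 j).mono hmono
  · have hrank : envyCount v X' (X k) < envyCount v X B := by
      refine envyCount_lt (.inr ⟨k, rfl⟩) (fun i => ?_) hmono ⟨k, by rwa [hself]⟩
      by_cases hi : i = k
      · exact .inl (by rw [hi, hself])
      · exact .inr ⟨i, hne i hi⟩
    have hR : unallocated X' \ X k = unallocated X \ B := Finset.ext hU
    have hcard : (X k).card ≤ m := by simpa using (X k).card_le_univ
    unfold minorPotential
    rw [hR, if_neg (c := Unenvied v X B ∧ _) fun h' => absurd (h'.1 k) (not_le.2 hk)]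
    refine add_lt_add_of_le_of_lt (Nat.mul_le_mul_right _ ?_) hrank
    split_ifs
    · omega
    · exact le_rfl

/-- An unallocated good is put into the bag. -/
theorem FairState.grow_bag (hv : ∀ i, IsSubadditiveValuation (v i)) (h : FairState v ε c Y X B)
    (hB : Unenvied v X B) {g : Fin m} (hg : g ∈ unallocated X) (hgB : g ∉ B)
    (hefx : EFXBundle v (1 - ε) X (insert g B)) :
    FairState v ε c Y X (insert g B) ∧ potential v ε X (insert g B) < potential v ε X B := by
  classical
  obtain ⟨h1, h1'⟩ : (∀ j, EFXBundle v (1 - ε) X (X j)) ∧ EFXBundle v (1 - ε) X B := by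
    rcases h.efx with h1 | ⟨-, -, h1, -⟩
    · exact h1
    · exact absurd (h1 hg) hgB
  refine ⟨⟨h.alloc, ?_, h.ef1, hB.ef1_of_subset_insert hv (Finset.Subset.refl _), .inl ⟨h1, hefx⟩,
    h.dominates⟩, potential_lt_of_minor (fun _ => le_rfl) ?_⟩
  · intro j
    rw [Finset.disjoint_insert_right]
    exact ⟨mem_unallocated.1 hg j, h.disj j⟩
  · have hlt : (unallocated X \ insert g B).card < (unallocated X \ B).card := by
      refine Finset.card_lt_card ⟨Finset.sdiff_subset_sdiff (Finset.Subset.refl _)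
        (Finset.subset_insert _ _), fun h' => ?_⟩
      have := @h' g (Finset.mem_sdiff.2 ⟨hg, hgB⟩)
      simp at this
    have hcard : (insert g B).card ≤ m := by simpa using (insert g B).card_le_univ
    have hK := envyCount_le v X (insert g B)
    unfold minorPotential
    rw [if_neg (c := Unenvied v X B ∧ unallocated X ⊆ B) fun h' => hgB (h'.2 hg)]
    set a := (unallocated X \ insert g B).card
    -- If the bag has just become complete and is unenvied, the phase changes, and its size is still
    -- below the offset `m + 1`.
    have h3 : (if Unenvied v X (insert g B) ∧ unallocated X ⊆ insert g B then (insert g B).card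
        else m + 1 + a) ≤ m + 1 + a := by
      split_ifs <;> omega
    calc _ ≤ (m + 1 + a) * (n * (n + 1) + 1) + n * (n + 1) := by gcongr
      _ < (m + 1 + a + 1) * (n * (n + 1) + 1) := by ring_nf; omega
      _ ≤ (m + 1 + (unallocated X \ B).card) * (n * (n + 1) + 1) :=
        Nat.mul_le_mul_right _ (by omega)
      _ ≤ _ := Nat.le_add_right _ _

/-- An agent takes a part of the bag and one more good, improving by a factor `1 + ε`. -/
theorem FairState.take_bag (hv : ∀ i, IsSubadditiveValuation (v i)) (hε : 0 < ε)
    (h : FairState v ε c Y X B)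
    (hB : Unenvied v X B) {g : Fin m} (hg : g ∈ unallocated X) (hgB : g ∉ B)
    (hZ : Z ⊆ insert g B) (hefx : EFXBundle v (1 - ε) X Z) {k : Fin n}
    (hk : v k (X k) < (1 - ε) * v k Z) :
    FairState v ε c Y (Function.update X k Z) (B ∩ unallocated (Function.update X k Z)) ∧
      potential v ε (Function.update X k Z) (B ∩ unallocated (Function.update X k Z)) <
        potential v ε X B := by
  classical
  set X' := Function.update X k Z with hX'
  have hself : X' k = Z := by simp [hX']
  have hne : ∀ j, j ≠ k → X' j = X j := fun j hj => by simp [hX', hj]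
  obtain ⟨h1, h1'⟩ : (∀ j, EFXBundle v (1 - ε) X (X j)) ∧ EFXBundle v (1 - ε) X B := by
    rcases h.efx with h1 | ⟨-, -, h1, -⟩
    · exact h1
    · exact absurd (h1 hg) hgB
  have hmono : ∀ i, v i (X i) ≤ v i (X' i) := by
    intro i
    by_cases hi : i = k
    · subst hi
      rw [hself]
      nlinarith [(hv i).nonneg Z]
    · rw [hne i hi]
  have hdisj : ∀ j, Disjoint (X j) Z := by
    intro j
    refine Finset.disjoint_of_subset_right hZ ?_
    rw [Finset.disjoint_insert_right]
    exact ⟨mem_unallocated.1 hg j, h.disj j⟩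
  -- What remains in the bag is part of an unenvied set, which yields EF1 and EFX for it. The former
  -- bundle of `k` becomes unallocated without entering the bag; the minor potential may therefore
  -- rise, but a level has been gained.
  have hB' : Unenvied v X' (B ∩ unallocated X') :=
    (hB.subset hv Finset.inter_subset_left).mono hmono
  refine ⟨⟨?_, ?_, ?_, hB'.ef1 hv, .inl ⟨?_, hB'.efx hv (by linarith)⟩,
    fun i => (h.dominates i).trans (hmono i)⟩, potential_lt_of_major hv hε hmono ⟨k, by rwa [hself]⟩⟩
  · intro i j hij
    by_cases hi : i = k
    · subst hi
      rw [hself, hne j hij.symm]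
      exact (hdisj j).symm
    · rw [hne i hi]
      by_cases hj : j = k
      · rw [hj, hself]
        exact hdisj i
      · rw [hne j hj]
        exact h.alloc i j hij
  · intro j
    rw [Finset.disjoint_left]
    intro x hx hx'
    exact mem_unallocated.1 (Finset.mem_inter.1 hx').2 j hx
  · intro j
    by_cases hj : j = k
    · rw [hj, hself]
      exact (hB.ef1_of_subset_insert hv hZ).mono hmono
    · rw [hne j hj]
      exact (h.ef1 j).mono hmono
  · intro j
    by_cases hj : j = k
    · rw [hj, hself]
      exact hefx.mono hmono
    · rw [hne j hj]
      exact (h1 j).mono hmono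

/-- An agent whom nobody envies receives one more good. -/
theorem FairState.add_good (hv : ∀ i, IsSubadditiveValuation (v i)) (hε : 0 < ε)
    (h : FairState v ε c Y X B)
    (hB : Unenvied v X B) (hR : unallocated X ⊆ B) {g : Fin m} (hgB : g ∈ B) {s : Fin n}
    (hs : Unenvied v X (X s))
    (hefx : (n ≤ B.card ∧ EFXBundle v (1 - ε) X (insert g (X s))) ∨ (c = true ∧ B.card < n)) :
    FairState v ε c Y (Function.update X s (insert g (X s))) (B \ {g}) ∧
      potential v ε (Function.update X s (insert g (X s))) (B \ {g}) < potential v ε X B := by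
  classical
  set X' := Function.update X s (insert g (X s)) with hX'
  have hself : X' s = insert g (X s) := by simp [hX']
  have hne : ∀ j, j ≠ s → X' j = X j := fun j hj => by simp [hX', hj]
  have hmono : ∀ i, v i (X i) ≤ v i (X' i) := by
    intro i
    by_cases hi : i = s
    · rw [hi, hself]
      exact (hv s).mono _ _ (Finset.subset_insert _ _)
    · rw [hne i hi]
  have hgX : ∀ j, g ∉ X j := mem_unallocated.1 (h.subset_unallocated hgB)
  have hB' : Unenvied v X' (B \ {g}) := (hB.subset hv Finset.sdiff_subset).mono hmono
  have hR' : unallocated X' ⊆ B \ {g} := by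
    intro x hx
    rw [mem_unallocated] at hx
    have hxs := hx s
    rw [hself, Finset.mem_insert, not_or] at hxs
    rw [Finset.mem_sdiff, Finset.mem_singleton]
    refine ⟨hR (mem_unallocated.2 fun i => ?_), hxs.1⟩
    by_cases hi : i = s
    · rw [hi]
      exact hxs.2
    · rw [← hne i hi]
      exact hx i
  have hcard : (B \ {g}).card < B.card := Finset.card_lt_card
    ⟨Finset.sdiff_subset, fun h' => by simpa using h' hgB⟩
  refine ⟨⟨?_, ?_, ?_, hB'.ef1 hv, ?_, fun i => (h.dominates i).trans (hmono i)⟩,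
    potential_lt_of_minor hmono ?_⟩
  · intro i j hij
    by_cases hi : i = s
    · subst hi
      rw [hself, hne j hij.symm, Finset.disjoint_insert_left]
      exact ⟨hgX j, h.alloc i j hij⟩
    · rw [hne i hi]
      by_cases hj : j = s
      · rw [hj, hself, Finset.disjoint_insert_right]
        exact ⟨hgX i, h.alloc i s hi⟩
      · rw [hne j hj]
        exact h.alloc i j hij
  · intro j
    by_cases hj : j = s
    · rw [hj, hself, Finset.disjoint_insert_left]
      exact ⟨by simp, Finset.disjoint_of_subset_right Finset.sdiff_subset (h.disj s)⟩
    · rw [hne j hj]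
      exact Finset.disjoint_of_subset_right Finset.sdiff_subset (h.disj j)
  · intro j
    by_cases hj : j = s
    · rw [hj, hself]
      exact (hs.ef1_of_subset_insert hv (Finset.Subset.refl _)).mono hmono
    · rw [hne j hj]
      exact (h.ef1 j).mono hmono
  · rcases hefx with ⟨hn, hefx⟩ | ⟨hc, hn⟩
    · rcases h.efx with ⟨h1, -⟩ | ⟨-, -, -, h1, -⟩
      · refine .inl ⟨fun j => ?_, hB'.efx hv (by linarith)⟩
        by_cases hj : j = s
        · rw [hj, hself]
          exact hefx.mono hmono
        · rw [hne j hj]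
          exact (h1 j).mono hmono
      · omega
    · refine .inr ⟨hc, hB', hR', by omega, fun j => ?_⟩
      have h2 : ∀ j, EFXBundle v (1 / 2 - ε) X (X j) := by
        rcases h.efx with ⟨h1, -⟩ | ⟨-, -, -, -, h1⟩
        · exact fun j => (h1 j).of_le hv (by linarith)
        · exact h1
      by_cases hj : j = s
      · rw [hj, hself]
        refine EFXBundle.mono (fun k x _ => ?_) hmono
        -- The bundle `X s` and, as part of the bag, the set `{g}` are both unenvied, so their union
        -- is worth at most twice the bundle of any agent. This is the origin of the factor `1 / 2`.
        have h3 : v k (insert g (X s) \ {x}) ≤ v k {g} + v k (X s) :=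
          ((hv k).mono _ _ Finset.sdiff_subset).trans (by
            rw [Finset.insert_eq]
            exact (hv k).subadd _ _)
        have h4 : v k {g} ≤ v k B := (hv k).mono _ _ (by simpa using hgB)
        have h5 := hB k
        have h6 := hs k
        have h7 := (hv k).nonneg (insert g (X s) \ {x})
        nlinarith
      · rw [hne j hj]
        exact (h2 j).mono hmono
  · have hK := envyCount_le v X' (B \ {g})
    unfold minorPotential
    rw [if_pos ⟨hB', hR'⟩, if_pos ⟨hB, hR⟩]
    calc _ ≤ (B \ {g}).card * (n * (n + 1) + 1) + n * (n + 1) := by gcongr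
      _ < ((B \ {g}).card + 1) * (n * (n + 1) + 1) := by ring_nf; omega
      _ ≤ B.card * (n * (n + 1) + 1) := Nat.mul_le_mul_right _ (by omega)
      _ ≤ _ := Nat.le_add_right _ _

/-- Bundles are passed along a cycle `C` of the map `f`, where `f d` either envies `d` or prefers,
by a factor `1 + ε`, a part of the bundle of `d` together with one more good. -/
theorem FairState.rotate (hv : ∀ i, IsSubadditiveValuation (v i)) (hε : 0 < ε)
    (h : FairState v ε c Y X B) (hB : Unenvied v X B) (hR : unallocated X ⊆ B)
    {f : Fin n → Fin n} {W : Fin n → Finset (Fin m)} {C : Finset (Fin n)} (hC : C.Nonempty)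
    (G : Fin n → Fin m) (hG : n ≤ B.card → G.Injective)
    (hW : ∀ d ∈ C, (W d = X d ∧ v (f d) (X (f d)) < v (f d) (X d)) ∨
      (n ≤ B.card ∧ W d ⊆ insert (G d) (X d) ∧ G d ∈ B ∧ Unenvied v X (X d) ∧
        EFXBundle v (1 - ε) X (W d) ∧ v (f d) (X (f d)) < (1 - ε) * v (f d) (W d)))
    (hf : ∀ e ∈ C, ∃ d ∈ C, f d = e)
    (hX' : ∀ e ∉ C, X' e = X e) (hWX' : ∀ d ∈ C, X' (f d) = W d) :
    FairState v ε c Y X' (B ∩ unallocated X') ∧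
      potential v ε X' (B ∩ unallocated X') < potential v ε X B := by
  classical
  have hX'' : ∀ e ∈ C, ∃ d ∈ C, f d = e ∧ X' e = W d := by
    intro e he
    obtain ⟨d, hd, rfl⟩ := hf e he
    exact ⟨d, hd, rfl, hWX' d hd⟩
  have hsub : (∀ d ∈ C, W d = X d) → unallocated X' ⊆ B := by
    intro hWd x hx
    refine hR (mem_unallocated.2 fun i hi => ?_)
    rw [mem_unallocated] at hx
    by_cases hiC : i ∈ C
    · refine hx (f i) ?_
      rwa [hWX' i hiC, hWd i hiC]
    · exact hx i (by rwa [hX' i hiC])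
  have himp : ∀ d ∈ C, v (f d) (X (f d)) < v (f d) (W d) := by
    intro d hd
    rcases hW d hd with ⟨h1, h2⟩ | ⟨-, -, -, -, -, h2⟩
    · rwa [h1]
    · nlinarith [(hv (f d)).nonneg (W d)]
  have hstrict : ∀ e ∈ C, v e (X e) < v e (X' e) := by
    intro e he
    obtain ⟨d, hd, rfl, h1⟩ := hX'' e he
    rw [h1]
    exact himp d hd
  have hmono : ∀ i, v i (X i) ≤ v i (X' i) := by
    intro i
    by_cases hi : i ∈ C
    · exact (hstrict i hi).le
    · rw [hX' i hi]
  have hgX : ∀ g ∈ B, ∀ j, g ∉ X j := fun g hg => mem_unallocated.1 (h.subset_unallocated hg)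
  have hWX : ∀ d ∈ C, ∀ j, d ≠ j → Disjoint (W d) (X j) := by
    intro d hd j hdj
    rcases hW d hd with ⟨h1, -⟩ | ⟨-, h1, h2, -⟩
    · rw [h1]
      exact h.alloc d j hdj
    · refine Finset.disjoint_of_subset_left h1 ?_
      rw [Finset.disjoint_insert_left]
      exact ⟨hgX _ h2 j, h.alloc d j hdj⟩
  -- Injectivity of `G` matters only here: two passed bundles that both contain an extra good must
  -- not contain the same one.
  have hWW : ∀ d ∈ C, ∀ e ∈ C, d ≠ e → Disjoint (W d) (W e) := by
    intro d hd e he hde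
    rcases hW e he with ⟨h1, -⟩ | ⟨hn, h1, h2, -⟩
    · rw [h1]
      exact hWX d hd e hde
    · refine Finset.disjoint_of_subset_right h1 ?_
      rw [Finset.disjoint_insert_right]
      refine ⟨?_, hWX d hd e hde⟩
      rcases hW d hd with ⟨h3, -⟩ | ⟨-, h3, h4, -⟩
      · rw [h3]
        exact hgX _ h2 d
      · intro h5
        rcases Finset.mem_insert.1 (h3 h5) with h6 | h6
        · exact hde (hG hn h6).symm
        · exact hgX _ h2 d h6
  have hB' : Unenvied v X' (B ∩ unallocated X') :=
    (hB.subset hv Finset.inter_subset_left).mono hmono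
  have hWef1 : ∀ d ∈ C, EF1Bundle v X (W d) := by
    intro d hd
    rcases hW d hd with ⟨h1, -⟩ | ⟨-, h1, h2, h3, -⟩
    · rw [h1]
      exact h.ef1 d
    · exact h3.ef1_of_subset_insert hv h1
  refine ⟨⟨?_, ?_, ?_, hB'.ef1 hv, ?_, fun i => (h.dominates i).trans (hmono i)⟩, ?_⟩
  · intro i j hij
    by_cases hi : i ∈ C
    · obtain ⟨d, hd, hfd, h1⟩ := hX'' i hi
      rw [h1]
      by_cases hj : j ∈ C
      · obtain ⟨e, he, hfe, h2⟩ := hX'' j hj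
        rw [h2]
        exact hWW d hd e he fun h3 => hij (by rw [← hfd, ← hfe, h3])
      · rw [hX' j hj]
        exact hWX d hd j fun h3 => hj (h3 ▸ hd)
    · rw [hX' i hi]
      by_cases hj : j ∈ C
      · obtain ⟨e, he, hfe, h2⟩ := hX'' j hj
        rw [h2]
        exact (hWX e he i fun h3 => hi (h3 ▸ he)).symm
      · rw [hX' j hj]
        exact h.alloc i j hij
  · intro j
    rw [Finset.disjoint_left]
    intro x hx hx'
    exact mem_unallocated.1 (Finset.mem_inter.1 hx').2 j hx
  · intro j
    by_cases hj : j ∈ C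
    · obtain ⟨d, hd, -, h1⟩ := hX'' j hj
      rw [h1]
      exact (hWef1 d hd).mono hmono
    · rw [hX' j hj]
      exact (h.ef1 j).mono hmono
  · rcases h.efx with ⟨h1, -⟩ | ⟨h1, -, -, h2, h3⟩
    · refine .inl ⟨fun j => ?_, hB'.efx hv (by linarith)⟩
      by_cases hj : j ∈ C
      · obtain ⟨d, hd, -, h2⟩ := hX'' j hj
        rw [h2]
        rcases hW d hd with ⟨h3, -⟩ | ⟨-, -, -, -, h3, -⟩
        · rw [h3]
          exact (h1 d).mono hmono
        · exact h3.mono hmono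
      · rw [hX' j hj]
        exact (h1 j).mono hmono
    -- The relaxed alternative has fewer than `n` goods in the bag, which rules out bundles with an
    -- extra good. So bundles are merely permuted and their EFX property is inherited.
    · have hWd : ∀ d ∈ C, W d = X d := by
        intro d hd
        rcases hW d hd with ⟨h4, -⟩ | ⟨h4, -⟩
        · exact h4
        · omega
      refine .inr ⟨h1, hB', fun x hx => Finset.mem_inter.2 ⟨hsub hWd hx, hx⟩, ?_, fun j => ?_⟩
      · exact (Finset.card_le_card Finset.inter_subset_left).trans_lt h2
      · by_cases hj : j ∈ C
        · obtain ⟨d, hd, -, h4⟩ := hX'' j hj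
          rw [h4, hWd d hd]
          exact (h3 d).mono hmono
        · rw [hX' j hj]
          exact (h3 j).mono hmono
  -- Either the cycle consists of envy only, so that bundles are permuted and `envyCount` falls, or
  -- an agent on it gains a level.
  · by_cases hmaj : ∀ d ∈ C, W d = X d
    · have hBeq : B ∩ unallocated X' = B := by
        refine Finset.inter_eq_left.2 fun x hx => mem_unallocated.2 fun i => ?_
        by_cases hi : i ∈ C
        · obtain ⟨d, hd, -, h4⟩ := hX'' i hi
          rw [h4, hmaj d hd]
          exact hgX x hx d
        · rw [hX' i hi]
          exact hgX x hx i
      obtain ⟨e, he⟩ := hC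
      have hrank : envyCount v X' B < envyCount v X B := by
        refine envyCount_lt (.inl rfl) (fun i => .inr ?_) hmono ⟨e, hstrict e he⟩
        by_cases hi : i ∈ C
        · obtain ⟨d, hd, -, h4⟩ := hX'' i hi
          exact ⟨d, by rw [h4, hmaj d hd]⟩
        · exact ⟨i, hX' i hi⟩
      refine potential_lt_of_minor hmono ?_
      rw [hBeq] at hB' ⊢
      unfold minorPotential
      rw [if_pos ⟨hB', hsub hmaj⟩, if_pos ⟨hB, hR⟩]
      omega
    · push Not at hmaj
      obtain ⟨d, hd, hne⟩ := hmaj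
      refine potential_lt_of_major hv hε hmono ⟨f d, ?_⟩
      rcases hW d hd with ⟨h4, -⟩ | ⟨-, -, -, -, -, h4⟩
      · exact absurd h4 hne
      · rwa [hWX' d hd]

end Moves

/-! Power means, and the welfare guarantee of fair allocations. -/

section PMean

variable {n : ℕ} {x y : Fin n → ℝ}

theorem pMean_nonneg (p : WithBot ℝ) (hx : ∀ i, 0 ≤ x i) : 0 ≤ pMean p x := by
  induction p using WithBot.recBotCoe with
  | bot => exact Real.iInf_nonneg hx
  | coe q =>
    simp only [pMean]
    split_ifs
    · exact Real.rpow_nonneg (Finset.prod_nonneg fun i _ => hx i) _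
    · exact le_rfl
    · exact Real.rpow_nonneg (mul_nonneg (by positivity)
        (Finset.sum_nonneg fun i _ => Real.rpow_nonneg (hx i) _)) _

/-- For a negative exponent the order is reversed twice, by the powers of the entries and by the
outer power; both reversals need positive numbers, and the convention for zero entries covers the
remaining cases. -/
theorem pMean_mono (hn : 0 < n) (p : WithBot ℝ) (hx : ∀ i, 0 ≤ x i) (hxy : ∀ i, x i ≤ y i) :
    pMean p x ≤ pMean p y := by
  have : Nonempty (Fin n) := ⟨⟨0, hn⟩⟩
  have hy : ∀ i, 0 ≤ y i := fun i => (hx i).trans (hxy i)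
  induction p using WithBot.recBotCoe with
  | bot => exact ciInf_mono ⟨0, by rintro _ ⟨i, rfl⟩; exact hx i⟩ hxy
  | coe q =>
    have h0 := pMean_nonneg (q : WithBot ℝ) hy
    simp only [pMean] at h0 ⊢
    split_ifs at h0 ⊢ with hq h1 h2 h2
    · exact Real.rpow_le_rpow (Finset.prod_nonneg fun i _ => hx i)
        (Finset.prod_le_prod (fun i _ => hx i) fun i _ => hxy i) (by positivity)
    · exact le_rfl
    · exact h0
    · obtain ⟨hq', i, hi⟩ := h2
      exact absurd ⟨hq', i, le_antisymm (hi ▸ hxy i) (hx i)⟩ h1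
    · rcases lt_or_gt_of_ne hq with hq' | hq'
      · have hpos : ∀ i, 0 < x i := fun i => (hx i).lt_of_ne fun h => h1 ⟨hq', i, h.symm⟩
        refine Real.rpow_le_rpow_of_nonpos ?_ ?_ (one_div_neg.2 hq').le
        · refine mul_pos (by positivity) (Finset.sum_pos (fun i _ => ?_) Finset.univ_nonempty)
          exact Real.rpow_pos_of_pos ((hpos i).trans_le (hxy i)) _
        · refine mul_le_mul_of_nonneg_left (Finset.sum_le_sum fun i _ => ?_) (by positivity)
          exact Real.rpow_le_rpow_of_nonpos (hpos i) (hxy i) hq'.le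
      · refine Real.rpow_le_rpow ?_ ?_ (by positivity)
        · exact mul_nonneg (by positivity)
            (Finset.sum_nonneg fun i _ => Real.rpow_nonneg (hx i) _)
        · refine mul_le_mul_of_nonneg_left (Finset.sum_le_sum fun i _ => ?_) (by positivity)
          exact Real.rpow_le_rpow (hx i) (hxy i) hq'.le

theorem pMean_const_mul (hn : 0 < n) (p : WithBot ℝ) {c : ℝ} (hc : 0 < c) (hx : ∀ i, 0 ≤ x i) :
    pMean p (fun i => c * x i) = c * pMean p x := by
  have hn' : (n : ℝ) ≠ 0 := by positivity
  induction p using WithBot.recBotCoe with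
  | bot => exact (Real.mul_iInf_of_nonneg hc.le _).symm
  | coe q =>
    simp only [pMean, mul_eq_zero, hc.ne', false_or]
    split_ifs with hq h1
    · rw [Finset.prod_mul_distrib, Real.mul_rpow (by positivity)
        (Finset.prod_nonneg fun i _ => hx i)]
      simp only [Finset.prod_const, Finset.card_univ, Fintype.card_fin]
      rw [← Real.rpow_natCast, ← Real.rpow_mul hc.le, mul_one_div_cancel hn', Real.rpow_one]
    · simp
    · have : ∀ i, (c * x i) ^ q = c ^ q * x i ^ q := fun i => Real.mul_rpow hc.le (hx i)
      simp only [this]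
      rw [← Finset.mul_sum, mul_left_comm, Real.mul_rpow (by positivity) (mul_nonneg (by positivity)
        (Finset.sum_nonneg fun i _ => Real.rpow_nonneg (hx i) _)), ← Real.rpow_mul hc.le,
        mul_one_div_cancel hq, Real.rpow_one]

/-- Minimizing the sum of these costs maximizes the mean with exponent `q`; for `q ≤ 0` the value
`w = 0` is to be avoided. -/
noncomputable def meanCost (q w : ℝ) : ℝ :=
  if 0 < q then -(w ^ q) else if 0 < w then (if q < 0 then w ^ q else -Real.log w) else 0

/-- In each range of `q` the mean is a decreasing function of the sum of the costs. For `q ≤ 0` a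
zero entry of `y` makes its mean zero, so sums need to be compared only when `y` is positive, and
then `h0` makes `x` positive as well. -/
theorem pMean_le_of_meanCost_le (hn : 0 < n) (q : ℝ) (hx : ∀ i, 0 ≤ x i) (hy : ∀ i, 0 ≤ y i)
    (h0 : q ≤ 0 → (∀ i, 0 < y i) → ∀ i, 0 < x i)
    (h : (0 < q ∨ ∀ i, 0 < y i) → ∑ i, meanCost q (x i) ≤ ∑ i, meanCost q (y i)) :
    pMean (q : WithBot ℝ) y ≤ pMean (q : WithBot ℝ) x := by
  have : Nonempty (Fin n) := ⟨⟨0, hn⟩⟩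
  have hpos := pMean_nonneg (q : WithBot ℝ) hx
  rcases lt_trichotomy q 0 with hq | rfl | hq
  · by_cases hy0 : ∃ i, y i = 0
    · have : pMean (q : WithBot ℝ) y = 0 := by simp [pMean, hq, hq.ne, hy0]
      rwa [this]
    · have hy' : ∀ i, 0 < y i := fun i => (hy i).lt_of_ne fun h => hy0 ⟨i, h.symm⟩
      have hx' := h0 hq.le hy'
      have hx0 : ¬ ∃ i, x i = 0 := fun ⟨i, hi⟩ => (hx' i).ne' hi
      have h2 := h (.inr hy')
      simp only [meanCost, not_lt.2 hq.le, if_false, hx', hy', if_true, hq] at h2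
      simp only [pMean, hq.ne, if_false, hy0, hx0, and_false]
      refine Real.rpow_le_rpow_of_nonpos ?_ ?_ (one_div_neg.2 hq).le
      · exact mul_pos (by positivity) (Finset.sum_pos (fun i _ => Real.rpow_pos_of_pos (hx' i) _)
          Finset.univ_nonempty)
      · exact mul_le_mul_of_nonneg_left h2 (by positivity)
  · by_cases hy0 : ∃ i, y i = 0
    · obtain ⟨i, hi⟩ := hy0
      have : pMean ((0 : ℝ) : WithBot ℝ) y = 0 := by
        simp only [pMean, if_true]
        rw [Finset.prod_eq_zero (Finset.mem_univ i) hi, Real.zero_rpow]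
        positivity
      rwa [this]
    · have hy' : ∀ i, 0 < y i := fun i => (hy i).lt_of_ne fun h => hy0 ⟨i, h.symm⟩
      have hx' := h0 le_rfl hy'
      have h2 := h (.inr hy')
      simp only [meanCost, lt_irrefl, if_false, hx', hy', if_true, Finset.sum_neg_distrib,
        neg_le_neg_iff] at h2
      rw [← Real.log_prod (fun i _ => (hx' i).ne'), ← Real.log_prod (fun i _ => (hy' i).ne')] at h2
      simp only [pMean, if_true]
      refine Real.rpow_le_rpow (Finset.prod_nonneg fun i _ => hy i) ?_ (by positivity)
      exact (Real.log_le_log_iff (Finset.prod_pos fun i _ => hy' i)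
        (Finset.prod_pos fun i _ => hx' i)).1 h2
  · have h2 := h (.inl hq)
    simp only [meanCost, hq, if_true, Finset.sum_neg_distrib, neg_le_neg_iff] at h2
    simp only [pMean, hq.ne', if_false, not_lt.2 hq.le, false_and]
    refine Real.rpow_le_rpow ?_ (mul_le_mul_of_nonneg_left h2 (by positivity)) (by positivity)
    exact mul_nonneg (by positivity) (Finset.sum_nonneg fun i _ => Real.rpow_nonneg (hy i) _)

/-- The exponent that serves to approximate the `p`-mean of `n` numbers. -/
noncomputable def effectiveExponent (n : ℕ) : WithBot ℝ → ℝ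
  | ⊥ => -((n : ℝ) * n)
  | (q : ℝ) => q

theorem iInf_le_pMean (hn : 0 < n) {q : ℝ} (hq : q < 0) (hx : ∀ i, 0 < x i) :
    ⨅ i, x i ≤ pMean (q : WithBot ℝ) x := by
  have : Nonempty (Fin n) := ⟨⟨0, hn⟩⟩
  obtain ⟨i, hi⟩ := exists_eq_ciInf_of_finite (f := x)
  have hle : ∀ j, x i ≤ x j := fun j => hi ▸ ciInf_le (Set.finite_range x).bddBelow j
  rw [← hi]
  have hc : pMean (q : WithBot ℝ) (fun _ : Fin n => x i) = x i := by
    simp only [pMean, hq.ne, if_false, (hx i).ne', exists_const, and_false, Finset.sum_const,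
      Finset.card_univ, Fintype.card_fin, nsmul_eq_mul]
    rw [← mul_assoc, one_div_mul_cancel (by positivity), one_mul, ← Real.rpow_mul (hx i).le,
      mul_one_div_cancel hq.ne, Real.rpow_one]
  rw [← hc]
  exact pMean_mono hn _ (fun _ => (hx i).le) hle

/-- Keeping only the least entry in the sum gives the factor `n ^ (1 / n ^ 2)`, and `n ≤ (1 + 1 / n)
^ (n * n)` by Bernoulli's inequality. The exponent `-n ^ 2` is chosen to make this factor at most
`(n + 1) / n`. -/
theorem pMean_le_iInf (hn : 0 < n) (hx : ∀ i, 0 < x i) :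
    pMean ((-((n : ℝ) * n) : ℝ) : WithBot ℝ) x ≤ ((n : ℝ) + 1) / n * ⨅ i, x i := by
  have : Nonempty (Fin n) := ⟨⟨0, hn⟩⟩
  have hn' : (0 : ℝ) < n := by positivity
  obtain ⟨i, hi⟩ := exists_eq_ciInf_of_finite (f := x)
  rw [← hi]
  set q : ℝ := -((n : ℝ) * n) with hqdef
  have hq : q < 0 := by
    rw [hqdef]
    have := mul_pos hn' hn'
    linarith
  have hx0 : ¬ ∃ i, x i = 0 := fun ⟨i, hi⟩ => (hx i).ne' hi
  simp only [pMean, hq.ne, if_false, hx0, and_false]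
  have h1 : 1 / (n : ℝ) * x i ^ q ≤ 1 / (n : ℝ) * ∑ j, x j ^ q :=
    mul_le_mul_of_nonneg_left (Finset.single_le_sum (f := fun j => x j ^ q)
      (fun j _ => Real.rpow_nonneg (hx j).le _) (Finset.mem_univ i)) (by positivity)
  have h2 : 0 < 1 / (n : ℝ) * x i ^ q := mul_pos (by positivity) (Real.rpow_pos_of_pos (hx i) _)
  refine (Real.rpow_le_rpow_of_nonpos h2 h1 (one_div_neg.2 hq).le).trans ?_
  rw [Real.mul_rpow (by positivity) (Real.rpow_nonneg (hx i).le _), ← Real.rpow_mul (hx i).le,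
    mul_one_div_cancel hq.ne, Real.rpow_one]
  refine mul_le_mul_of_nonneg_right ?_ (hx i).le
  have h3 : (1 / (n : ℝ)) ^ (1 / q) = (n : ℝ) ^ (1 / ((n : ℝ) * n)) := by
    rw [one_div (n : ℝ), Real.inv_rpow hn'.le, ← Real.rpow_neg hn'.le]
    congr 1
    rw [hqdef]
    rw [one_div, one_div, inv_neg, neg_neg]
  have h4 : (n : ℝ) ≤ (((n : ℝ) + 1) / n) ^ (n * n) := by
    have h5 := one_add_mul_le_pow (a := 1 / (n : ℝ)) (by
      have : 0 < 1 / (n : ℝ) := by positivity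
      linarith) (n * n)
    have h6 : 1 + ((n * n : ℕ) : ℝ) * (1 / n) = 1 + n := by
      push_cast
      field_simp
    have h7 : ((n : ℝ) + 1) / n = 1 + 1 / n := by field_simp
    rw [h7]
    linarith
  rw [h3]
  calc (n : ℝ) ^ (1 / ((n : ℝ) * n))
      ≤ ((((n : ℝ) + 1) / n) ^ (n * n)) ^ (1 / ((n : ℝ) * n)) :=
        Real.rpow_le_rpow hn'.le h4 (by positivity)
    _ = _ := by
        rw [← Real.rpow_natCast, ← Real.rpow_mul (by positivity)]
        push_cast
        rw [mul_one_div_cancel (by positivity), Real.rpow_one]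

/-- A minimum is not governed by a sum of costs, so `p = -∞` is treated through the exponent `-n ^
2`. That mean does not underestimate the minimum of `y` and overestimates the minimum of `x` by at
most `(n + 1) / n`. For finite `p` nothing is lost. -/
theorem pMean_le_of_effective (hn : 0 < n) (p : WithBot ℝ) (hx : ∀ i, 0 ≤ x i)
    (hy : ∀ i, 0 ≤ y i)
    (h0 : effectiveExponent n p ≤ 0 → (∀ i, 0 < y i) → ∀ i, 0 < x i)
    (h : (0 < effectiveExponent n p ∨ ∀ i, 0 < y i) →
      ∑ i, meanCost (effectiveExponent n p) (x i) ≤ ∑ i, meanCost (effectiveExponent n p) (y i)) :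
    pMean p y ≤ ((n : ℝ) + 1) / n * pMean p x := by
  have : Nonempty (Fin n) := ⟨⟨0, hn⟩⟩
  have hn' : (0 : ℝ) < n := by positivity
  have hpos := pMean_nonneg p hx
  have hfac : 1 ≤ ((n : ℝ) + 1) / n := by
    rw [le_div_iff₀ hn']
    linarith
  induction p using WithBot.recBotCoe with
  | bot =>
    have hq : effectiveExponent n ⊥ < 0 := by
      have := mul_pos hn' hn'
      simp only [effectiveExponent]
      linarith
    by_cases hy0 : ∃ i, y i = 0
    · obtain ⟨i, hi⟩ := hy0
      have h1 : pMean ⊥ y ≤ 0 := hi ▸ ciInf_le (Set.finite_range y).bddBelow i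
      exact h1.trans (mul_nonneg (by positivity) hpos)
    · have hy' : ∀ i, 0 < y i := fun i => (hy i).lt_of_ne fun h => hy0 ⟨i, h.symm⟩
      have hx' := h0 hq.le hy'
      exact (iInf_le_pMean hn hq hy').trans
        ((pMean_le_of_meanCost_le hn _ hx hy h0 h).trans (pMean_le_iInf hn hx'))
  | coe q =>
    refine (pMean_le_of_meanCost_le hn _ hx hy h0 h).trans ?_
    exact le_mul_of_one_le_left hpos hfac

end PMean

/-! ### Fair allocations compared with matchings -/

section Welfare

variable {n m : ℕ}

/-- The goods for which more than `n` goods (including itself) have at least the same value. -/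
noncomputable def lowGoods (w : Finset (Fin m) → ℝ) (n : ℕ) : Finset (Fin m) :=
  Finset.univ.filter fun g => n < (Finset.univ.filter fun g' => w {g} ≤ w {g'}).card

/-- The set consisting of good number `g`; it is empty if there is no such good. -/
def goodSet (m g : ℕ) : Finset (Fin m) := Finset.univ.filter fun x => (x : ℕ) = g

theorem goodSet_val (g : Fin m) : goodSet m g = {g} := by
  ext x
  simp [goodSet, Fin.ext_iff]

theorem mem_goodSet {g : ℕ} {x : Fin m} : x ∈ goodSet m g ↔ (x : ℕ) = g := by simp [goodSet]

theorem card_goodSet_le (g : ℕ) : (goodSet m g).card ≤ 1 :=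
  Finset.card_le_one.2 fun _ hx _ hy => Fin.ext ((mem_goodSet.1 hx).trans (mem_goodSet.1 hy).symm)

/-- The weight of matching agent `i` to good number `g`. -/
noncomputable def edgeWeight (v : Fin n → Finset (Fin m) → ℝ) (i : Fin n) (g : ℕ) : ℝ :=
  v i (goodSet m g) + v i (lowGoods (v i) n) / n

variable {v : Fin n → Finset (Fin m) → ℝ}

theorem edgeWeight_nonneg (hv : ∀ i, IsSubadditiveValuation (v i)) (i : Fin n) (g : ℕ) :
    0 ≤ edgeWeight v i g :=
  add_nonneg ((hv i).nonneg _) (div_nonneg ((hv i).nonneg _) (by positivity))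

/-- All goods that are not low are at least as valuable as the least valuable among them, and at
most `n` goods are. -/
theorem card_high_le (w : Finset (Fin m) → ℝ) (n : ℕ) : (Finset.univ \ lowGoods w n).card ≤ n := by
  rcases (Finset.univ \ lowGoods w n).eq_empty_or_nonempty with h | h
  · simp [h]
  · obtain ⟨g, hg, hmin⟩ := Finset.exists_min_image _ (fun g => w {g}) h
    have h1 : (Finset.univ.filter fun g' => w {g} ≤ w {g'}).card ≤ n := by
      simpa [lowGoods] using hg
    refine (Finset.card_le_card fun x hx => ?_).trans h1
    simpa using hmin x hx

/-- The goods of `X i` that are not low number at most `n`, so they are worth at most `n` times the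
best one; the others are worth at most all low goods together. If every good of `X i` is low, the
private dummy column `m + i` serves. Disjointness of the bundles makes the choice injective. -/
theorem exists_edgeWeight_ge (hv : ∀ i, IsSubadditiveValuation (v i)) (hn : 0 < n)
    {X : Fin n → Finset (Fin m)} (hX : IsAllocation X) :
    ∃ μ : Fin n → ℕ, μ.Injective ∧ (∀ i, μ i < m + n) ∧
      ∀ i, v i (X i) ≤ n * edgeWeight v i (μ i) := by
  have hn' : (0 : ℝ) < n := by positivity
  have key : ∀ i, ∃ g : ℕ, ((∃ h : g < m, ⟨g, h⟩ ∈ X i) ∨ g = m + i) ∧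
      v i (X i) ≤ n * edgeWeight v i g := by
    intro i
    have h1 : v i (X i) ≤ v i (X i \ lowGoods (v i) n) + v i (lowGoods (v i) n) := by
      refine le_trans ((hv i).mono _ _ fun x hx => ?_) ((hv i).subadd _ _)
      by_cases h : x ∈ lowGoods (v i) n <;> simp [h, hx]
    have h2 : ∀ g, (n : ℝ) * edgeWeight v i g =
        n * v i (goodSet m g) + v i (lowGoods (v i) n) := by
      intro g
      unfold edgeWeight
      field_simp
    rcases (X i \ lowGoods (v i) n).eq_empty_or_nonempty with h | h
    · refine ⟨m + i, .inr rfl, ?_⟩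
      rw [h2]
      rw [h, (hv i).normalized] at h1
      have := mul_nonneg hn'.le ((hv i).nonneg (goodSet m (m + i)))
      linarith
    · obtain ⟨g, hg, hgle⟩ := (hv i).exists_good h
      refine ⟨g, .inl ⟨g.2, (Finset.mem_sdiff.1 hg).1⟩, ?_⟩
      rw [h2, goodSet_val]
      have h3 : (X i \ lowGoods (v i) n).card ≤ n :=
        (Finset.card_le_card (Finset.sdiff_subset_sdiff (Finset.subset_univ _)
          (Finset.Subset.refl _))).trans (card_high_le (v i) n)
      have h4 : ((X i \ lowGoods (v i) n).card : ℝ) * v i {g} ≤ n * v i {g} :=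
        mul_le_mul_of_nonneg_right (by exact_mod_cast h3) ((hv i).nonneg _)
      linarith
  choose μ hμ hμ' using key
  refine ⟨μ, fun i j hij => ?_, fun i => ?_, hμ'⟩
  · by_contra hne
    rcases hμ i with ⟨h1, h2⟩ | h1 <;> rcases hμ j with ⟨h3, h4⟩ | h3
    · simp only [hij] at h2
      exact Finset.disjoint_left.1 (hX i j hne) h2 h4
    · omega
    · omega
    · exact hne (Fin.ext (by omega))
  · rcases hμ i with ⟨h1, -⟩ | h1 <;> omega

/-- For a low good `h`, more than `n` goods are at least as valuable. If one of them is unallocated,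
the charity bound applies to it; otherwise two of them share a bundle, and EFX with one removed
bounds the other. So `α * v {h} ≤ v (Z i)`. Removing one low good from another bundle now shows, by
EFX and subadditivity, that `α` times its low part is at most `2 * v (Z i)`. The own bundle and the
unallocated goods count once each, which gives `2 * (n - 1) + 2 = 2 * n`. -/
theorem value_low_le (hv : ∀ i, IsSubadditiveValuation (v i)) {α : ℝ} (hα : 0 < α) (hα1 : α ≤ 1)
    {c : Bool} {Z : Fin n → Finset (Fin m)} (hZ : IsAlphaCEFX v α c Z) (i : Fin n) :
    α * v i (lowGoods (v i) n) ≤ 2 * n * v i (Z i) := by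
  classical
  have hnn := (hv i).nonneg
  have hle : ∀ S, α * v i S ≤ v i S := fun S => by nlinarith [hnn S]
  have hgood : ∀ h ∈ lowGoods (v i) n, α * v i {h} ≤ v i (Z i) := by
    intro h hh
    simp only [lowGoods, Finset.mem_filter, Finset.mem_univ, true_and] at hh
    set T := Finset.univ.filter fun g' => v i {h} ≤ v i {g'} with hT
    have hTle : ∀ g ∈ T, v i {h} ≤ v i {g} := fun g hg => by simpa [hT] using hg
    by_cases hP : ∃ g ∈ T, g ∈ unallocated Z
    · obtain ⟨g, hg, hg'⟩ := hP
      calc α * v i {h} ≤ v i {h} := hle _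
        _ ≤ v i {g} := hTle g hg
        _ ≤ v i (unallocated Z) := (hv i).mono _ _ (by simpa using hg')
        _ ≤ _ := hZ.charity i
    · push Not at hP
      have hex : ∀ g ∈ T, ∃ j, g ∈ Z j := by
        intro g hg
        have := hP g hg
        rw [mem_unallocated] at this
        push Not at this
        exact this
      have : Nonempty (Fin n) := ⟨i⟩
      choose! f hf using hex
      obtain ⟨g₁, h₁, g₂, h₂, hne, heq⟩ := Finset.exists_ne_map_eq_of_card_lt_of_maps_to
        (t := (Finset.univ : Finset (Fin n))) (by simpa using hh) (f := f) (fun _ _ => by simp)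
      calc α * v i {h} ≤ α * v i {g₁} := mul_le_mul_of_nonneg_left (hTle _ h₁) hα.le
        _ ≤ α * v i (Z (f g₁) \ {g₂}) := by
          refine mul_le_mul_of_nonneg_left ((hv i).mono _ _ ?_) hα.le
          simp only [Finset.singleton_subset_iff, Finset.mem_sdiff, Finset.mem_singleton]
          exact ⟨hf _ h₁, hne⟩
        _ ≤ _ := hZ.efx i _ g₂ (heq ▸ hf _ h₂)
  have hbundle : ∀ j, α * v i (Z j ∩ lowGoods (v i) n) ≤ 2 * v i (Z i) := by
    intro j
    rcases (Z j ∩ lowGoods (v i) n).eq_empty_or_nonempty with h | ⟨h, hh⟩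
    · rw [h, (hv i).normalized, mul_zero]
      linarith [hnn (Z i)]
    · have hh' := Finset.mem_inter.1 hh
      have h1 : v i (Z j ∩ lowGoods (v i) n) ≤ v i (Z j \ {h}) + v i {h} := by
        refine le_trans ((hv i).mono _ _ fun x hx => ?_) ((hv i).subadd _ _)
        by_cases hxh : x = h
        · simp [hxh]
        · simp [hxh, (Finset.mem_inter.1 hx).1]
      have h2 := hZ.efx i j h hh'.1
      have h3 := hgood h hh'.2
      nlinarith
  have hsum : ∀ s : Finset (Fin n),
      v i (s.biUnion fun j => Z j ∩ lowGoods (v i) n) ≤ ∑ j ∈ s, v i (Z j ∩ lowGoods (v i) n) := by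
    intro s
    induction s using Finset.induction_on with
    | empty => simp [(hv i).normalized]
    | insert j s hj ih =>
      rw [Finset.biUnion_insert, Finset.sum_insert hj]
      exact ((hv i).subadd _ _).trans (by linarith)
  have hcover : v i (lowGoods (v i) n) ≤
      v i (unallocated Z) + (v i (Z i) + ∑ j ∈ Finset.univ.erase i, v i (Z j ∩ lowGoods (v i) n)) := by
    refine le_trans ((hv i).mono _ (unallocated Z ∪ (Z i ∪
      (Finset.univ.erase i).biUnion fun j => Z j ∩ lowGoods (v i) n)) fun x hx => ?_) ?_
    · by_cases hxU : x ∈ unallocated Z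
      · simp [hxU]
      · rw [mem_unallocated] at hxU
        push Not at hxU
        obtain ⟨j, hj⟩ := hxU
        by_cases hji : j = i
        · subst hji
          simp [hj]
        · simp only [Finset.mem_union, Finset.mem_biUnion, Finset.mem_erase, Finset.mem_univ,
            and_true, Finset.mem_inter]
          exact .inr (.inr ⟨j, hji, hj, hx⟩)
    · refine ((hv i).subadd _ _).trans (add_le_add le_rfl (((hv i).subadd _ _).trans ?_))
      exact add_le_add le_rfl (hsum _)
  have h5 : α * ∑ j ∈ Finset.univ.erase i, v i (Z j ∩ lowGoods (v i) n) ≤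
      (n - 1) * (2 * v i (Z i)) := by
    rw [Finset.mul_sum]
    refine (Finset.sum_le_card_nsmul _ _ _ fun j _ => hbundle j).trans ?_
    rw [Finset.card_erase_of_mem (Finset.mem_univ _), Finset.card_univ, Fintype.card_fin,
      nsmul_eq_mul, Nat.cast_sub i.pos]
    simp
  have h6 := hZ.charity i
  have h7 := mul_le_mul_of_nonneg_left hcover hα.le
  rw [mul_add, mul_add] at h7
  have h8 := hle (unallocated Z)
  have h9 := hle (Z i)
  linarith

/-- The welfare guarantee for fair allocations that dominate a matching of maximum weight. -/
theorem pMeanWelfare_ge (hv : ∀ i, IsSubadditiveValuation (v i)) (hn : 0 < n) (p : WithBot ℝ)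
    {α : ℝ} (hα1 : α ≤ 1) {c : Bool} {Z : Fin n → Finset (Fin m)} (hZ : IsAlphaCEFX v α c Z)
    {a : Fin n → ℕ} (ha : ∀ i, v i (goodSet m (a i)) ≤ v i (Z i))
    (hopt : ∀ μ : Fin n → ℕ, μ.Injective → (∀ i, μ i < m + n) →
      (effectiveExponent n p ≤ 0 → (∀ i, 0 < edgeWeight v i (μ i)) →
        ∀ i, 0 < edgeWeight v i (a i)) ∧
      ((0 < effectiveExponent n p ∨ ∀ i, 0 < edgeWeight v i (μ i)) →
        ∑ i, meanCost (effectiveExponent n p) (edgeWeight v i (a i)) ≤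
          ∑ i, meanCost (effectiveExponent n p) (edgeWeight v i (μ i))))
    {X : Fin n → Finset (Fin m)} (hX : IsAllocation X) :
    α / (4 * ((n : ℝ) + 1)) * pMeanWelfare p v X ≤ pMeanWelfare p v Z := by
  have hn' : (0 : ℝ) < n := by positivity
  have hXn : 0 ≤ pMeanWelfare p v X := pMean_nonneg p fun i => (hv i).nonneg _
  have hZn : 0 ≤ pMeanWelfare p v Z := pMean_nonneg p fun i => (hv i).nonneg _
  -- For large `ε` the ratio is not positive and the bound is trivial.
  rcases le_or_gt α 0 with hα | hα
  · exact (mul_nonpos_of_nonpos_of_nonneg (div_nonpos_of_nonpos_of_nonneg hα (by positivity))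
      hXn).trans hZn
  obtain ⟨μ, h1, h2, h3⟩ := exists_edgeWeight_ge hv hn hX
  have hwa := fun i => edgeWeight_nonneg hv i (a i)
  have hwμ := fun i => edgeWeight_nonneg hv i (μ i)
  have h4 : pMeanWelfare p v X ≤ n * pMean p fun i => edgeWeight v i (μ i) := by
    rw [← pMean_const_mul hn p hn' hwμ]
    exact pMean_mono hn p (fun i => (hv i).nonneg _) h3
  have h5 : (pMean p fun i => edgeWeight v i (μ i)) ≤
      ((n : ℝ) + 1) / n * pMean p fun i => edgeWeight v i (a i) :=
    pMean_le_of_effective hn p hwa hwμ (hopt μ h1 h2).1 (hopt μ h1 h2).2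
  -- The two parts of the weight contribute at most `1` and `2` times `v (Z i)` after multiplication
  -- by `α`, so `4` leaves room.
  have h6 : α / 4 * (pMean p fun i => edgeWeight v i (a i)) ≤ pMeanWelfare p v Z := by
    rw [← pMean_const_mul hn p (by positivity) hwa]
    refine pMean_mono hn p (fun i => mul_nonneg (by positivity) (hwa i)) fun i => ?_
    have h7 := value_low_le hv hα hα1 hZ i
    have h8 := ha i
    have h9 := (hv i).nonneg (goodSet m (a i))
    have h10 : α * (v i (lowGoods (v i) n) / n) ≤ 2 * v i (Z i) := by
      rw [← mul_div_assoc, div_le_iff₀ hn']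
      linarith
    unfold edgeWeight
    nlinarith
  -- The factor `n` for the best good and the factor `(n + 1) / n` for the effective exponent
  -- combine to `n + 1`.
  calc α / (4 * ((n : ℝ) + 1)) * pMeanWelfare p v X
      ≤ α / (4 * ((n : ℝ) + 1)) *
        (n * (((n : ℝ) + 1) / n * pMean p fun i => edgeWeight v i (a i))) := by
        refine mul_le_mul_of_nonneg_left (h4.trans ?_) (by positivity)
        exact mul_le_mul_of_nonneg_left h5 hn'.le
    _ = α / 4 * (pMean p fun i => edgeWeight v i (a i)) := by field_simp
    _ ≤ _ := h6

end Welfare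

/-! The subroutines of the algorithm.  The natural number arrays are used as follows:
`1`: current allocation, `2`: bag, `3`: candidate bundles, `4`: allocated goods and bag, `5`: list of
the goods in the bag, `6`: successor map, `7`: sets with one good, `8`: low goods,
`9`: matching, `10`: labels of goods, `11`: parents of goods; the others hold scalar variables. -/

namespace BProgram

/-- Copies row `r` of array `a` to row `s` of array `b`. -/
def copyRow (a : ℕ) (r : NExp) (b : ℕ) (s : NExp) : BProgram :=
  forLoop 21 .goods (.setNat b s (.var 21) (.get a r (.var 21)))

/-- Goods are removed from the candidate bundle in row `var 30` as long as some agent violates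
EFX towards it; variable `24` becomes the last such agent, or `n`. -/
def trim : BProgram :=
  .seq (assign 24 .agents) (forLoop 20 .agents (forLoop 22 .goods
    (.ite (.natLT (.lit 0) (.get 3 (.var 30) (.var 22)))
      (.seq (.setNat 3 (.var 30) (.var 22) (.lit 0))
        (.ite (.realLT (.value (.var 20) 1 (.var 20))
            (.mul (.sub (.ofNat (.lit 1)) (.get 0 (.lit 0) (.lit 0))) (.value (.var 20) 3 (.var 30))))
          (assign 24 (.var 20))
          (.setNat 3 (.var 30) (.var 22) (.lit 1))))
      .skip)))

/-- Removes allocated goods from the bag. -/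
def cleanBag : BProgram :=
  forLoop 20 .agents (forLoop 21 .goods
    (.ite (.natLT (.lit 0) (.get 1 (.var 20) (.var 21)))
      (.setNat 2 (.lit 0) (.var 21) (.lit 0)) .skip))

/-- Array `4` becomes the set of the goods that are allocated or in the bag. -/
def markUsed : BProgram :=
  .seq (copyRow 2 (.lit 0) 4 (.lit 0)) (forLoop 20 .agents (forLoop 21 .goods
    (.ite (.natLT (.lit 0) (.get 1 (.var 20) (.var 21)))
      (.setNat 4 (.lit 0) (.var 21) (.lit 1)) .skip)))

/-- Lists the goods in the bag in array `5`; variable `25` becomes their number. -/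
def listBag : BProgram :=
  .seq (assign 25 (.lit 0)) (forLoop 21 .goods
    (.ite (.natLT (.lit 0) (.get 2 (.lit 0) (.var 21)))
      (.seq (.setNat 5 (.lit 0) (.var 25) (.var 21)) (assign 25 (.add (.var 25) (.lit 1)))) .skip))

/-- Extends the list of goods by repetitions of its first entry to a list of length at least `n`. -/
def padList : BProgram :=
  forLoop 20 .agents (.ite (.natLT (.var 20) (.var 25)) .skip
    (.setNat 5 (.lit 0) (.var 20) (.get 5 (.lit 0) (.lit 0))))

end BProgram

open BProgram

/-! ### Correctness of trimming and of the bookkeeping for the bag -/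

section Specs

variable {n m : ℕ} {v : Fin n → Finset (Fin m) → ℝ} {N : ℕ} {Q : Store → Prop} {σ : Store}

theorem wp_copyRow {a b : ℕ} {r s : NExp} (hm0 : σ.nat 0 0 1 = m) (hm : m ≤ N)
    (ha : a ≠ 21 ∧ a ≠ b) (hb : b ≠ 21 ∧ b ≠ 0)
    (hr : ∀ c ∈ r.arrays, c ≠ 21 ∧ c ≠ b) (hs : ∀ c ∈ s.arrays, c ≠ 21 ∧ c ≠ b)
    (hQ : ∀ τ : Store, (∀ c, c ≠ b → c ≠ 21 → τ.nat c = σ.nat c) → τ.real = σ.real →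
      τ.row m b (s.eval σ) = σ.row m a (r.eval σ) →
      (∀ s', s' ≠ s.eval σ → τ.row m b s' = σ.row m b s') → Q τ) :
    wp v N (copyRow a r b s) Q σ := by
  have hw : ∀ c, c ∉ (copyRow a r b s).natWrites ↔ c ≠ b ∧ c ≠ 21 := by
    simp [copyRow, forLoop, natWrites, not_or]
  have hw' : (copyRow a r b s).realWrites = [] := rfl
  refine wp_frame (Q := fun τ => (∀ g : Fin m, (τ.nat b (s.eval σ) g ≠ 0 ↔
    σ.nat a (r.eval σ) g ≠ 0)) ∧ ∀ s', s' ≠ s.eval σ → τ.nat b s' = σ.nat b s') ?_ ?_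
  · refine wp_for m (fun k τ => (∀ g : ℕ, g < k → (τ.nat b (s.eval σ) g ≠ 0 ↔
      σ.nat a (r.eval σ) g ≠ 0)) ∧ ∀ s', s' ≠ s.eval σ → τ.nat b s' = σ.nat b s') ?_ ?_ ?_ hm ?_ ?_ ?_
    · simp [natWrites, hb.1.symm]
    · simp [NExp.arrays, natWrites, hb.2.symm]
    · simpa [NExp.eval] using hm0
    · refine ⟨by omega, fun s' _ => ?_⟩
      rw [Store.updateNat_nat_ne _ _ _ _ hb.1]
    · rintro i τ hi hxi hfr hfr' ⟨h1, h2⟩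
      simp only [natWrites, List.mem_singleton] at hfr
      have hsτ : s.eval τ = s.eval σ := NExp.eval_congr fun c hc => hfr c (hs c hc).2 (hs c hc).1
      have hrτ : r.eval τ = r.eval σ := NExp.eval_congr fun c hc => hfr c (hr c hc).2 (hr c hc).1
      refine wp_setNat ?_
      simp only [hsτ, hrτ, NExp.eval, hxi, hfr a ha.2 ha.1]
      rw [Store.updateNat_nat_ne _ _ _ _ hb.1]
      refine ⟨fun g hg => ?_, fun s' hs' => ?_⟩
      · rw [Store.updateNat_nat_same]
        split_ifs with h
        · rw [h.2]
        · exact h1 g (by omega)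
      · rw [← h2 s' hs']
        funext k
        rw [Store.updateNat_nat_same, if_neg fun h => hs' h.1]
    · rintro τ - ⟨h1, h2⟩
      exact ⟨fun g => h1 g g.2, h2⟩
  · rintro τ h1 h2 ⟨h3, h4⟩
    refine hQ τ (fun c hc hc' => h1 c ((hw c).2 ⟨hc, hc'⟩)) ?_ ?_ fun s' hs' => ?_
    · funext c
      exact h2 c (by simp [hw'])
    · ext g
      rw [Store.mem_row, Store.mem_row, h3]
    · ext g
      rw [Store.mem_row, Store.mem_row, h4 s' hs']

/-- Partial progress of `trim`, after agents below `k` and, for agent `k`, goods below `j`. -/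
def TrimState (v : Fin n → Finset (Fin m) → ℝ) (ε : ℝ) (X : Fin n → Finset (Fin m))
    (S : Finset (Fin m)) (k j : ℕ) (Z : Finset (Fin m)) (c : ℕ) : Prop :=
  Z ⊆ S ∧ (∀ (i : Fin n), ∀ h ∈ Z, ((i : ℕ) < k ∨ ((i : ℕ) = k ∧ (h : ℕ) < j)) →
      (1 - ε) * v i (Z \ {h}) ≤ v i (X i)) ∧
    ((c = n ∧ Z = S) ∨ ∃ h : c < n, v ⟨c, h⟩ (X ⟨c, h⟩) < (1 - ε) * v ⟨c, h⟩ Z)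

theorem TrimState.step_of_not {ε : ℝ} {X : Fin n → Finset (Fin m)} {S Z : Finset (Fin m)}
    {k : Fin n} {j : Fin m} {c : ℕ} (h : TrimState v ε X S k j Z c)
    (hj : j ∈ Z → (1 - ε) * v k (Z \ {j}) ≤ v k (X k)) : TrimState v ε X S k (j + 1) Z c := by
  refine ⟨h.1, fun i x hx hix => ?_, h.2.2⟩
  by_cases hxj : i = k ∧ x = j
  · rw [hxj.1, hxj.2]
    exact hj (hxj.2 ▸ hx)
  · refine h.2.1 i x hx ?_
    rw [Fin.ext_iff, Fin.ext_iff] at hxj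
    omega

/-- By monotonicity a removal preserves every test already passed, so a single pass over agents and
goods suffices. The agent responsible for the latest removal prefers what is left by the required
factor, and she is the one recorded. -/
theorem TrimState.step_of_lt (hv : ∀ i, IsSubadditiveValuation (v i)) {ε : ℝ}
    {X : Fin n → Finset (Fin m)} {S Z : Finset (Fin m)}
    {k : Fin n} {j : Fin m} {c : ℕ} (h : TrimState v ε X S k j Z c)
    (hj : v k (X k) < (1 - ε) * v k (Z \ {j})) : TrimState v ε X S k (j + 1) (Z \ {j}) k := by
  -- The sign follows from `hj`, a strict inequality between a nonnegative value and a multiple of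
  -- another one.
  have hε : 0 ≤ 1 - ε := by
    by_contra hneg
    have h1 := (hv k).nonneg (X k)
    have h2 := (hv k).nonneg (Z \ {j})
    nlinarith
  refine ⟨Finset.sdiff_subset.trans h.1, fun i x hx hix => ?_, .inr ⟨k.2, hj⟩⟩
  rw [Finset.mem_sdiff, Finset.mem_singleton, Fin.ext_iff] at hx
  refine le_trans ?_ (h.2.1 i x hx.1 (by omega))
  exact mul_le_mul_of_nonneg_left ((hv i).mono _ _
    (Finset.sdiff_subset_sdiff Finset.sdiff_subset (Finset.Subset.refl _))) hε

theorem wp_trim (hv : ∀ i, IsSubadditiveValuation (v i)) {ε : ℝ} (hn0 : σ.nat 0 0 0 = n)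
    (hm0 : σ.nat 0 0 1 = m) (hε0 : σ.real 0 0 0 = ε) (hn : n ≤ N) (hm : m ≤ N) (r : ℕ)
    (hr : σ.nat 30 0 0 = r)
    (hQ : ∀ τ : Store, (∀ c, c ∉ [3, 20, 22, 24] → τ.nat c = σ.nat c) → τ.real = σ.real →
      (∀ r', r' ≠ r → τ.row m 3 r' = σ.row m 3 r') →
      TrimState v ε (fun i => σ.row m 1 i) (σ.row m 3 r) n 0 (τ.row m 3 r) (τ.nat 24 0 0) → Q τ) :
    wp v N trim Q σ := by
  refine wp_frame (Q := fun τ => (∀ r', r' ≠ r → τ.row m 3 r' = σ.row m 3 r') ∧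
    TrimState v ε (fun i => σ.row m 1 i) (σ.row m 3 r) n 0 (τ.row m 3 r) (τ.nat 24 0 0)) ?_ ?_
  · refine wp_seq (wp_setNat ?_)
    simp only [NExp.eval, hn0]
    refine wp_for n (fun k τ => (∀ r', r' ≠ r → τ.row m 3 r' = σ.row m 3 r') ∧
      TrimState v ε (fun i => σ.row m 1 i) (σ.row m 3 r) k 0 (τ.row m 3 r) (τ.nat 24 0 0))
      (by decide) (by decide) (by simp [NExp.eval, Store.updateNat_nat_ne, hn0]) hn ?_ ?_ ?_
    · refine ⟨fun _ _ => by simp, ?_⟩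
      simp only [Store.updateNat_nat_ne _ _ _ _ (show 24 ≠ 20 by decide), Store.updateNat_nat_self]
      exact ⟨by simp, fun i h _ hi => by omega, .inl ⟨rfl, by simp⟩⟩
    · rintro k τ hk hxk hfr hfr' ⟨h1, h2⟩
      have hτ0 : τ.nat 0 = σ.nat 0 := (hfr 0 (by decide) (by decide)).trans
        (Store.updateNat_nat_ne _ _ _ _ (by decide))
      have hτ1 : τ.nat 1 = σ.nat 1 := (hfr 1 (by decide) (by decide)).trans
        (Store.updateNat_nat_ne _ _ _ _ (by decide))
      have hτ30 : τ.nat 30 0 0 = r := by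
        rw [(hfr 30 (by decide) (by decide)).trans
          (Store.updateNat_nat_ne _ _ _ _ (by decide)), hr]
      have hτε : τ.real 0 0 0 = ε := by
        rw [hfr' 0 (by decide)]
        exact hε0
      refine wp_for m (fun j τ => (∀ r', r' ≠ r → τ.row m 3 r' = σ.row m 3 r') ∧
        TrimState v ε (fun i => σ.row m 1 i) (σ.row m 3 r) k j (τ.row m 3 r) (τ.nat 24 0 0))
        (by decide) (by decide) (by simp [NExp.eval, hτ0, hm0]) hm ?_ ?_ ?_
      · simpa [Store.row_updateNat_ne, Store.updateNat_nat_ne] using ⟨h1, h2⟩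
      · rintro j ρ hj hxj hgr hgr' ⟨h3, h4⟩
        have hρ1 : ρ.nat 1 = σ.nat 1 := (hgr 1 (by decide) (by decide)).trans hτ1
        have hρ30 : ρ.nat 30 0 0 = r := by rw [hgr 30 (by decide) (by decide), hτ30]
        have hρ20 : ρ.nat 20 0 0 = k := by rw [hgr 20 (by decide) (by decide), hxk]
        have hρε : ρ.real 0 0 0 = ε := by rw [hgr' 0 (by decide), hτε]
        refine wp_ite (fun hb => ?_) fun hb => ?_
        · simp only [BExp.Holds, NExp.eval, hρ30, hxj] at hb
          have hmem : (⟨j, hj⟩ : Fin m) ∈ ρ.row m 3 r := Store.mem_row.2 (by simpa using hb.ne')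
          -- The good is removed tentatively; it is put back unless the agent violates EFX towards
          -- the rest.
          refine wp_seq (wp_setNat ?_)
          simp only [NExp.eval, hρ30, hxj]
          have hrow : (ρ.updateNat 3 r j 0).row m 3 r = ρ.row m 3 r \ {⟨j, hj⟩} :=
            Store.row_updateNat_zero ρ 3 r ⟨j, hj⟩
          refine wp_ite (fun hb' => ?_) fun hb' => ?_
          · simp [hρ20, hρ30, hρε, hrow, query_of_lt v hk, Store.row_congr hρ1] at hb'
            refine wp_setNat ?_
            simp only [NExp.eval, Store.updateNat_nat_ne _ _ _ _ (show 20 ≠ 3 by decide), hρ20]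
            refine ⟨fun r' hr' => ?_, ?_⟩
            · simpa [Store.row_updateNat_row_ne _ _ _ _ _ hr'] using h3 r' hr'
            · simpa [hrow] using TrimState.step_of_lt hv (k := ⟨k, hk⟩) (j := ⟨j, hj⟩) h4 hb'
          · simp [hρ20, hρ30, hρε, hrow, query_of_lt v hk, Store.row_congr hρ1] at hb'
            refine wp_setNat ?_
            have hrow' : (ρ.updateNat 3 r j 1).row m 3 r = ρ.row m 3 r := by
              rw [Store.row_updateNat_pos _ 3 r ⟨j, hj⟩ one_ne_zero, Finset.insert_eq_self.2 hmem]
            simp only [NExp.eval, Store.updateNat_nat_ne _ _ _ _ (show 30 ≠ 3 by decide),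
              Store.updateNat_nat_ne _ _ _ _ (show 22 ≠ 3 by decide), hρ30, hxj,
              Store.updateNat_updateNat]
            refine ⟨fun r' hr' => ?_, ?_⟩
            · simpa [Store.row_updateNat_row_ne _ _ _ _ _ hr'] using h3 r' hr'
            · simpa [hrow'] using
                TrimState.step_of_not (k := ⟨k, hk⟩) (j := ⟨j, hj⟩) h4 fun _ => hb'
        · simp only [BExp.Holds, NExp.eval, hρ30, hxj, not_lt, Nat.le_zero] at hb
          refine wp_skip ?_
          have hmem : (⟨j, hj⟩ : Fin m) ∉ ρ.row m 3 r := fun h => Store.mem_row.1 h hb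
          simpa using And.intro h3
            (TrimState.step_of_not (k := ⟨k, hk⟩) (j := ⟨j, hj⟩) h4 fun h => absurd h hmem)
      · rintro ρ - ⟨h3, h4⟩
        have h5 : TrimState v ε (fun i => σ.row m 1 i) (σ.row m 3 r) (k + 1) 0 (ρ.row m 3 r)
            (ρ.nat 24 0 0) := ⟨h4.1, fun i x hx hix => h4.2.1 i x hx (by omega), h4.2.2⟩
        simpa using And.intro h3 h5
    · rintro τ - h
      exact h
  · rintro τ h1 h2 ⟨h3, h4⟩
    refine hQ τ (fun c hc => h1 c ?_) ?_ h3 h4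
    · revert hc
      simp [trim, forLoop, natWrites]
      tauto
    · funext c
      exact h2 c (by simp [trim, forLoop, realWrites])

end Specs

section Specs

variable {n m : ℕ} {v : Fin n → Finset (Fin m) → ℝ} {N : ℕ} {Q Q' : Store → Prop} {σ : Store}

/-- The frame rule for programs that write only to the natural number arrays in `L`. -/
theorem wp_frame_list {A : BProgram} (L : List ℕ) (h : wp v N A Q σ)
    (hL : ∀ c ∈ A.natWrites, c ∈ L) (hR : A.realWrites = [])
    (hQ : ∀ τ : Store, (∀ c, c ∉ L → τ.nat c = σ.nat c) → τ.real = σ.real → Q τ → Q' τ) :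
    wp v N A Q' σ :=
  wp_frame h fun τ h1 h2 h3 => hQ τ (fun c hc => h1 c fun h => hc (hL c h))
    (funext fun c => h2 c (by simp [hR])) h3

theorem wp_cleanBag (hn0 : σ.nat 0 0 0 = n) (hm0 : σ.nat 0 0 1 = m) (hn : n ≤ N) (hm : m ≤ N)
    (hQ : ∀ τ : Store, (∀ c, c ∉ [2, 20, 21] → τ.nat c = σ.nat c) → τ.real = σ.real →
      τ.row m 2 0 = σ.row m 2 0 ∩ unallocated (fun i : Fin n => σ.row m 1 i) → Q τ) :
    wp v N cleanBag Q σ := by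
  refine wp_frame_list (Q := fun τ =>
    τ.row m 2 0 = σ.row m 2 0 ∩ unallocated (fun i : Fin n => σ.row m 1 i)) [2, 20, 21] ?_
    (by decide) rfl hQ
  refine wp_for n (fun k τ => ∀ g : Fin m, g ∈ τ.row m 2 0 ↔
    g ∈ σ.row m 2 0 ∧ ∀ i : Fin n, (i : ℕ) < k → g ∉ σ.row m 1 i)
    (by decide) (by decide) (by simpa using hn0) hn ?_ ?_ ?_
  · simp
  · rintro k τ hk hxk hfr - h1
    have hτ0 : τ.nat 0 = σ.nat 0 := hfr 0 (by decide) (by decide)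
    have hτ1 : τ.nat 1 = σ.nat 1 := hfr 1 (by decide) (by decide)
    refine wp_for m (fun j τ => ∀ g : Fin m, g ∈ τ.row m 2 0 ↔
      g ∈ σ.row m 2 0 ∧ ∀ i : Fin n, ((i : ℕ) < k ∨ (i : ℕ) = k ∧ (g : ℕ) < j) → g ∉ σ.row m 1 i)
      (by decide) (by decide) (by simpa [hτ0] using hm0) hm ?_ ?_ ?_
    · simpa using h1
    · rintro j ρ hj hxj hgr - h2
      have hρ1 : ρ.nat 1 = σ.nat 1 := (hgr 1 (by decide) (by decide)).trans hτ1
      have hρ20 : ρ.nat 20 0 0 = k := by rw [hgr 20 (by decide) (by decide), hxk]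
      refine wp_ite (fun hb => ?_) fun hb => ?_
      · have hmem : (⟨j, hj⟩ : Fin m) ∈ σ.row m 1 k := Store.mem_row.2 (by
          simp [hρ20, hxj, hρ1] at hb
          exact hb.ne')
        refine wp_setNat ?_
        intro g
        simp only [NExp.eval, hxj, Store.row_updateNat_ne _ _ _ _ _ _ (show 2 ≠ 21 by decide)]
        rw [Store.row_updateNat_zero ρ 2 0 ⟨j, hj⟩, Finset.mem_sdiff, h2 g, Finset.mem_singleton,
          Fin.ext_iff]
        constructor
        · rintro ⟨⟨h3, h4⟩, h5⟩
          exact ⟨h3, fun i hi => h4 i (by simp only at h5; omega)⟩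
        · rintro ⟨h3, h4⟩
          refine ⟨⟨h3, fun i hi => h4 i (by omega)⟩, fun h5 => ?_⟩
          have h6 : g = ⟨j, hj⟩ := Fin.ext h5
          have h7 : (g : ℕ) = j := h5
          exact h4 ⟨k, hk⟩ (.inr ⟨rfl, by omega⟩) (h6 ▸ hmem)
      · have hmem : (⟨j, hj⟩ : Fin m) ∉ σ.row m 1 k := fun h => by
          simp [hρ20, hxj, hρ1] at hb
          exact Store.mem_row.1 h hb
        refine wp_skip ?_
        intro g
        rw [Store.row_updateNat_ne _ _ _ _ _ _ (show 2 ≠ 21 by decide), h2 g]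
        refine and_congr_right fun _ => forall_congr' fun i => ?_
        constructor
        · intro h3 h4
          by_cases h5 : (i : ℕ) = k ∧ (g : ℕ) = j
          · have h6 : g = ⟨j, hj⟩ := Fin.ext h5.2
            rw [h5.1, h6]
            exact hmem
          · exact h3 (by omega)
        · intro h3 h4
          exact h3 (by omega)
    · rintro ρ - h2 g
      rw [Store.row_updateNat_ne _ _ _ _ _ _ (show 2 ≠ 20 by decide), h2 g]
      refine and_congr_right fun _ => forall_congr' fun i => ?_
      have : ((i : ℕ) < k ∨ (i : ℕ) = k ∧ (g : ℕ) < m) ↔ (i : ℕ) < k + 1 := by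
        have := g.2
        omega
      rw [this]
  · rintro τ - h
    ext g
    rw [h g, Finset.mem_inter, mem_unallocated]
    simp

theorem wp_markUsed (hn0 : σ.nat 0 0 0 = n) (hm0 : σ.nat 0 0 1 = m) (hn : n ≤ N) (hm : m ≤ N)
    (hQ : ∀ τ : Store, (∀ c, c ∉ [4, 20, 21] → τ.nat c = σ.nat c) → τ.real = σ.real →
      (∀ g, g ∉ τ.row m 4 0 ↔
        g ∈ unallocated (fun i : Fin n => σ.row m 1 i) ∧ g ∉ σ.row m 2 0) → Q τ) :
    wp v N markUsed Q σ := by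
  refine wp_frame_list (Q := fun τ => ∀ g, g ∉ τ.row m 4 0 ↔
    g ∈ unallocated (fun i : Fin n => σ.row m 1 i) ∧ g ∉ σ.row m 2 0) [4, 20, 21] ?_
    (by decide) rfl hQ
  refine wp_seq (wp_copyRow hm0 hm (by decide) (by decide) (by decide) (by decide) ?_)
  rintro σ' hσ - hrow -
  simp only [NExp.eval] at hrow
  have hσ0 : σ'.nat 0 = σ.nat 0 := hσ 0 (by decide) (by decide)
  have hσ1 : σ'.nat 1 = σ.nat 1 := hσ 1 (by decide) (by decide)
  refine wp_for n (fun k τ => ∀ g : Fin m, g ∉ τ.row m 4 0 ↔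
    g ∉ σ.row m 2 0 ∧ ∀ i : Fin n, (i : ℕ) < k → g ∉ σ.row m 1 i)
    (by decide) (by decide) (by simpa [hσ0] using hn0) hn ?_ ?_ ?_
  · simp [hrow]
  · rintro k τ hk hxk hfr - h1
    have hτ0 : τ.nat 0 = σ.nat 0 := (hfr 0 (by decide) (by decide)).trans hσ0
    have hτ1 : τ.nat 1 = σ.nat 1 := (hfr 1 (by decide) (by decide)).trans hσ1
    refine wp_for m (fun j τ => ∀ g : Fin m, g ∉ τ.row m 4 0 ↔
      g ∉ σ.row m 2 0 ∧ ∀ i : Fin n, ((i : ℕ) < k ∨ (i : ℕ) = k ∧ (g : ℕ) < j) → g ∉ σ.row m 1 i)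
      (by decide) (by decide) (by simpa [hτ0] using hm0) hm ?_ ?_ ?_
    · simpa using h1
    · rintro j ρ hj hxj hgr - h2
      have hρ1 : ρ.nat 1 = σ.nat 1 := (hgr 1 (by decide) (by decide)).trans hτ1
      have hρ20 : ρ.nat 20 0 0 = k := by rw [hgr 20 (by decide) (by decide), hxk]
      refine wp_ite (fun hb => ?_) fun hb => ?_
      · have hmem : (⟨j, hj⟩ : Fin m) ∈ σ.row m 1 k := Store.mem_row.2 (by
          simp [hρ20, hxj, hρ1] at hb
          exact hb.ne')
        refine wp_setNat ?_
        intro g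
        simp only [NExp.eval, hxj, Store.row_updateNat_ne _ _ _ _ _ _ (show 4 ≠ 21 by decide)]
        rw [Store.row_updateNat_pos ρ 4 0 ⟨j, hj⟩ one_ne_zero, Finset.mem_insert, not_or, h2 g,
          Fin.ext_iff]
        constructor
        · rintro ⟨h5, h3, h4⟩
          exact ⟨h3, fun i hi => h4 i (by simp only at h5; omega)⟩
        · rintro ⟨h3, h4⟩
          refine ⟨fun h5 => ?_, h3, fun i hi => h4 i (by omega)⟩
          have h6 : g = ⟨j, hj⟩ := Fin.ext h5
          have h7 : (g : ℕ) = j := h5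
          exact h4 ⟨k, hk⟩ (.inr ⟨rfl, by omega⟩) (h6 ▸ hmem)
      · have hmem : (⟨j, hj⟩ : Fin m) ∉ σ.row m 1 k := fun h => by
          simp [hρ20, hxj, hρ1] at hb
          exact Store.mem_row.1 h hb
        refine wp_skip ?_
        intro g
        rw [Store.row_updateNat_ne _ _ _ _ _ _ (show 4 ≠ 21 by decide), h2 g]
        refine and_congr_right fun _ => forall_congr' fun i => ?_
        constructor
        · intro h3 h4
          by_cases h5 : (i : ℕ) = k ∧ (g : ℕ) = j
          · have h6 : g = ⟨j, hj⟩ := Fin.ext h5.2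
            rw [h5.1, h6]
            exact hmem
          · exact h3 (by omega)
        · intro h3 h4
          exact h3 (by omega)
    · rintro ρ - h2 g
      rw [Store.row_updateNat_ne _ _ _ _ _ _ (show 4 ≠ 20 by decide), h2 g]
      refine and_congr_right fun _ => forall_congr' fun i => ?_
      have : ((i : ℕ) < k ∨ (i : ℕ) = k ∧ (g : ℕ) < m) ↔ (i : ℕ) < k + 1 := by
        have := g.2
        omega
      rw [this]
  · rintro τ - h g
    rw [h g, mem_unallocated, and_comm]
    simp

theorem wp_listBag (hm0 : σ.nat 0 0 1 = m) (hm : m ≤ N)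
    (hQ : ∀ τ : Store, (∀ c, c ∉ [5, 21, 25] → τ.nat c = σ.nat c) → τ.real = σ.real →
      τ.nat 25 0 0 = (σ.row m 2 0).card →
      (∀ i < (σ.row m 2 0).card, ∃ g ∈ σ.row m 2 0, τ.nat 5 0 i = (g : ℕ)) →
      (∀ i < (σ.row m 2 0).card, ∀ j < (σ.row m 2 0).card, τ.nat 5 0 i = τ.nat 5 0 j → i = j) →
      Q τ) :
    wp v N listBag Q σ := by
  set B := σ.row m 2 0 with hB
  refine wp_frame_list (Q := fun τ => τ.nat 25 0 0 = B.card ∧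
      (∀ i < B.card, ∃ g ∈ B, τ.nat 5 0 i = (g : ℕ)) ∧
      (∀ i < B.card, ∀ j < B.card, τ.nat 5 0 i = τ.nat 5 0 j → i = j)) [5, 21, 25] ?_
    (by decide) rfl fun τ h1 h2 h3 => hQ τ h1 h2 h3.1 h3.2.1 h3.2.2
  refine wp_seq (wp_setNat ?_)
  simp only [NExp.eval]
  refine wp_for m (fun k τ => τ.nat 25 0 0 = (B.filter fun g : Fin m => (g : ℕ) < k).card ∧
      (∀ i < τ.nat 25 0 0, ∃ g ∈ B, τ.nat 5 0 i = (g : ℕ) ∧ (g : ℕ) < k) ∧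
      (∀ i < τ.nat 25 0 0, ∀ j < τ.nat 25 0 0, τ.nat 5 0 i = τ.nat 5 0 j → i = j))
    (by decide) (by decide) (by simpa using hm0) hm ?_ ?_ ?_
  · simp
  · rintro k τ hk hxk hfr - ⟨h1, h2, h3⟩
    have hτ2 : τ.nat 2 = σ.nat 2 := by
      rw [hfr 2 (by decide) (by decide)]
      simp
    have hstep : (B.filter fun g : Fin m => (g : ℕ) < k + 1) =
        if (⟨k, hk⟩ : Fin m) ∈ B then insert ⟨k, hk⟩ (B.filter fun g : Fin m => (g : ℕ) < k)
        else B.filter fun g : Fin m => (g : ℕ) < k := by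
      ext g
      have hk' : (g : ℕ) < k + 1 ↔ g = ⟨k, hk⟩ ∨ (g : ℕ) < k := by
        rw [Fin.ext_iff]
        simp only
        omega
      split_ifs with h
      · simp only [Finset.mem_filter, Finset.mem_insert, hk']
        constructor
        · tauto
        · rintro (rfl | h5)
          · exact ⟨h, .inl rfl⟩
          · exact ⟨h5.1, .inr h5.2⟩
      · simp only [Finset.mem_filter, hk']
        constructor
        · rintro ⟨h5, rfl | h6⟩
          · exact absurd h5 h
          · exact ⟨h5, h6⟩
        · tauto
    refine wp_ite (fun hb => ?_) fun hb => ?_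
    · have hmem : (⟨k, hk⟩ : Fin m) ∈ B := Store.mem_row.2 (by
        simp [hxk, hτ2] at hb
        exact hb.ne')
      refine wp_seq (wp_setNat (wp_setNat ?_))
      have hxk' : (NExp.var 21).eval τ = k := hxk
      simp only [hxk']
      simp only [NExp.eval, ne_eq, Nat.reduceEqDiff, not_false_eq_true,
        Store.updateNat_nat_ne, Store.updateNat_nat_self]
      rw [if_pos hmem] at hstep
      have hcard : (B.filter fun g : Fin m => (g : ℕ) < k + 1).card = τ.nat 25 0 0 + 1 := by
        rw [hstep, Finset.card_insert_of_notMem (by simp), h1]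
      set q := τ.nat 25 0 0 with hq
      refine ⟨hcard.symm, fun i hi => ?_, fun i hi j hj => ?_⟩
      · by_cases hiq : i = q
        · exact ⟨⟨k, hk⟩, hmem, by simp [hiq], by simp⟩
        · rw [Store.updateNat_nat_same, if_neg (by simp [hiq])]
          obtain ⟨g, h4, h5, h6⟩ := h2 i (by omega)
          exact ⟨g, h4, h5, by omega⟩
      · have hval : ∀ i, i ≠ q → (τ.updateNat 5 0 q k).nat 5 0 i = τ.nat 5 0 i := by
          intro i hi
          rw [Store.updateNat_nat_same, if_neg (by simp [hi])]
        by_cases hiq : i = q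
        · by_cases hjq : j = q
          · intro _
            omega
          · rw [hiq, Store.updateNat_nat_self, hval j hjq]
            intro h4
            obtain ⟨g, -, h5, h6⟩ := h2 j (by omega)
            omega
        · rw [hval i hiq]
          by_cases hjq : j = q
          · rw [hjq, Store.updateNat_nat_self]
            intro h4
            obtain ⟨g, -, h5, h6⟩ := h2 i (by omega)
            omega
          · rw [hval j hjq]
            exact h3 i (by omega) j (by omega)
    · have hmem : (⟨k, hk⟩ : Fin m) ∉ B := fun h => by
        simp [hxk, hτ2] at hb
        exact Store.mem_row.1 h hb
      rw [if_neg hmem] at hstep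
      refine wp_skip ?_
      simp only [ne_eq, Nat.reduceEqDiff, not_false_eq_true,
        Store.updateNat_nat_ne, hstep]
      refine ⟨h1, fun i hi => ?_, h3⟩
      obtain ⟨g, h4, h5, h6⟩ := h2 i hi
      exact ⟨g, h4, h5, by omega⟩
  · rintro τ - ⟨h1, h2, h3⟩
    have : (B.filter fun g : Fin m => (g : ℕ) < m) = B := Finset.filter_true_of_mem fun g _ => g.2
    rw [this] at h1
    rw [h1] at h2 h3
    refine ⟨h1, fun i hi => ?_, h3⟩
    obtain ⟨g, h4, h5, -⟩ := h2 i hi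
    exact ⟨g, h4, h5⟩

/-- After padding, every agent is offered some good of the bag. Repetitions occur only for fewer
than `n` goods, where distinct offers are not needed. -/
theorem wp_padList (hn0 : σ.nat 0 0 0 = n) (hn : n ≤ N) (hpos : 0 < σ.nat 25 0 0)
    (hQ : ∀ τ : Store, (∀ c, c ∉ [5, 20] → τ.nat c = σ.nat c) → τ.real = σ.real →
      (∀ i < n, τ.nat 5 0 i = if i < σ.nat 25 0 0 then σ.nat 5 0 i else σ.nat 5 0 0) → Q τ) :
    wp v N padList Q σ := by
  refine wp_frame_list (Q := fun τ => ∀ i < n, τ.nat 5 0 i =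
    if i < σ.nat 25 0 0 then σ.nat 5 0 i else σ.nat 5 0 0) [5, 20] ?_ (by decide) rfl hQ
  refine wp_for n (fun k τ => ∀ i, τ.nat 5 0 i =
    if i < σ.nat 25 0 0 ∨ k ≤ i then σ.nat 5 0 i else σ.nat 5 0 0)
    (by decide) (by decide) (by simpa using hn0) hn ?_ ?_ ?_
  · simp
  · rintro k τ hk hxk hfr - h1
    have hτ25 : τ.nat 25 = σ.nat 25 := hfr 25 (by decide) (by decide)
    refine wp_ite (fun hb => wp_skip fun i => ?_) fun hb => wp_setNat fun i => ?_
    · simp [hxk, hτ25] at hb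
      rw [Store.updateNat_nat_ne _ _ _ _ (by decide), h1 i]
      congr 1
      simp only [eq_iff_iff]
      omega
    · simp [hxk, hτ25] at hb
      simp only [NExp.eval, hxk, Store.updateNat_nat_ne _ _ _ _ (show 5 ≠ 20 by decide)]
      rw [Store.updateNat_nat_same]
      by_cases hik : i = k
      · rw [if_pos ⟨rfl, hik⟩, h1 0, if_pos (.inl hpos), if_neg (by omega)]
      · rw [if_neg fun h => hik h.2, h1 i]
        congr 1
        simp only [eq_iff_iff]
        omega
  · rintro τ - h i hi
    rw [h i]
    congr 1
    simp only [eq_iff_iff]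
    omega

end Specs

/-! ### Successors in the improvement graph and rotation along a cycle -/

namespace BProgram

/-- Variable `23` becomes the first agent who prefers the set in row `r` of array `a` to her own
bundle. -/
def findEnvier (a : ℕ) (r : NExp) : BProgram :=
  find 23 .agents (.realLT (.value (.var 23) 1 (.var 23)) (.value (.var 23) a r))

/-- The successor of agent `var 30` in array `6`, and the bundle that is passed to the successor in
array `3`. -/
def successor : BProgram :=
  .seq (findEnvier 1 (.var 30)) (.seq (copyRow 1 (.var 30) 3 (.var 30))
    (.ite (.natLT (.var 23) .agents) (.setNat 6 (.lit 0) (.var 30) (.var 23))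
      (.seq (.setNat 3 (.var 30) (.get 5 (.lit 0) (.var 30)) (.lit 1))
        (.ite (.natLT (.var 25) .agents) (.setNat 6 (.lit 0) (.var 30) .agents)
          (.seq trim (.setNat 6 (.lit 0) (.var 30) (.var 24)))))))

/-- Passes the bundles in array `3` along a cycle of the successor map. -/
def rotate : BProgram :=
  .seq (assign 27 (.lit 0)) (.seq
    (forLoop 29 .agents (assign 27 (.get 6 (.lit 0) (.var 27))))
    (.seq (forLoop 29 .agents (.seq (copyRow 3 (.var 27) 1 (.get 6 (.lit 0) (.var 27)))
      (assign 27 (.get 6 (.lit 0) (.var 27))))) cleanBag))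

end BProgram

section Specs

variable {n m : ℕ} {v : Fin n → Finset (Fin m) → ℝ} {N : ℕ} {Q Q' : Store → Prop} {σ : Store}

theorem wp_findEnvier {a : ℕ} {r : NExp} (hn0 : σ.nat 0 0 0 = n) (hn : n ≤ N) (ha : a ≠ 23)
    (hr : ∀ c ∈ r.arrays, c ≠ 23)
    (hQ₁ : ∀ k : Fin n, v k (σ.output n m k) < v k (σ.row m a (r.eval σ)) →
      Q (σ.updateNat 23 0 0 k))
    (hQ₂ : Unenvied v (σ.output n m) (σ.row m a (r.eval σ)) → Q (σ.updateNat 23 0 0 n)) :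
    wp v N (findEnvier a r) Q σ := by
  have hrk : ∀ k, r.eval (σ.updateNat 23 0 0 k) = r.eval σ := fun k =>
    NExp.eval_congr fun c hc => Store.updateNat_nat_ne _ _ _ _ (hr c hc)
  refine wp_find n (fun k => query v k (σ.row m 1 k) < query v k (σ.row m a (r.eval σ)))
    (by decide) (by simpa using hn0) hn (fun k => ?_) fun k hk h1 h2 => ?_
  · simp [hrk, Store.row_updateNat_ne _ _ _ _ _ _ ha]
  · rcases hk.lt_or_eq with hk' | rfl
    · have := h2 hk'
      rw [query_of_lt v hk', query_of_lt v hk'] at this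
      exact hQ₁ ⟨k, hk'⟩ this
    · refine hQ₂ fun i => ?_
      have := h1 i i.2
      rw [query_val, query_val] at this
      exact not_lt.1 this

/-- The properties of the successor `F` of agent `i`, and of the set `S` passed to `F`, where `g` is
the good available to `i` among `q` unallocated goods; `F = n` if there is no successor. -/
def IsSuccessor (v : Fin n → Finset (Fin m) → ℝ) (ε : ℝ) (X : Fin n → Finset (Fin m)) (q : ℕ)
    (i : Fin n) (g : Fin m) (F : ℕ) (S : Finset (Fin m)) : Prop :=
  (∃ h : F < n, S = X i ∧ v ⟨F, h⟩ (X ⟨F, h⟩) < v ⟨F, h⟩ (X i)) ∨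
  (Unenvied v X (X i) ∧ ((q < n ∧ F = n) ∨
    (n ≤ q ∧ S ⊆ insert g (X i) ∧ EFXBundle v (1 - ε) X S ∧
      ((F = n ∧ S = insert g (X i)) ∨
        ∃ h : F < n, v ⟨F, h⟩ (X ⟨F, h⟩) < (1 - ε) * v ⟨F, h⟩ S))))

theorem TrimState.efx {ε : ℝ} {X : Fin n → Finset (Fin m)} {S Z : Finset (Fin m)} {c : ℕ}
    (h : TrimState v ε X S n 0 Z c) : EFXBundle v (1 - ε) X Z :=
  fun i x hx => h.2.1 i x hx (.inl i.2)

/-- Absence of a successor means that agent `i` may keep the good herself: nobody envies her, and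
either trimming `insert g (X i)` removed nothing or the bag is too small for the EFX test to be
made. -/
theorem wp_successor (hv : ∀ i, IsSubadditiveValuation (v i)) {ε : ℝ} (hn0 : σ.nat 0 0 0 = n)
    (hm0 : σ.nat 0 0 1 = m) (hε0 : σ.real 0 0 0 = ε) (hn : n ≤ N) (hm : m ≤ N) (i : Fin n)
    (hi : σ.nat 30 0 0 = i) (g : Fin m) (hg : σ.nat 5 0 i = g)
    (hQ : ∀ τ : Store, (∀ c, c ∉ [3, 6, 20, 21, 22, 23, 24] → τ.nat c = σ.nat c) →
      τ.real = σ.real → (∀ j, j ≠ (i : ℕ) → τ.row m 3 j = σ.row m 3 j) →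
      (∀ j, j ≠ (i : ℕ) → τ.nat 6 0 j = σ.nat 6 0 j) →
      IsSuccessor v ε (σ.output n m) (σ.nat 25 0 0) i g (τ.nat 6 0 i) (τ.row m 3 i) → Q τ) :
    wp v N successor Q σ := by
  refine wp_frame_list (Q := fun τ => (∀ j, j ≠ (i : ℕ) → τ.row m 3 j = σ.row m 3 j) ∧
      (∀ j, j ≠ (i : ℕ) → τ.nat 6 0 j = σ.nat 6 0 j) ∧
      IsSuccessor v ε (σ.output n m) (σ.nat 25 0 0) i g (τ.nat 6 0 i) (τ.row m 3 i))
    [3, 6, 20, 21, 22, 23, 24] ?_ (by decide) rfl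
    fun τ h1 h2 h3 => hQ τ h1 h2 h3.1 h3.2.1 h3.2.2
  refine wp_seq (wp_findEnvier hn0 hn (by decide) (by decide) (fun k hk => ?_) fun hk => ?_)
  · refine wp_seq (wp_copyRow (by simpa using hm0) hm (by decide) (by decide) (by decide)
      (by decide) ?_)
    rintro τ h1 - h2 h3
    have e30 : τ.nat 30 0 0 = i := by rw [h1 30 (by decide) (by decide)]; simpa using hi
    have e23 : τ.nat 23 0 0 = k := by rw [h1 23 (by decide) (by decide)]; simp
    have e0 : τ.nat 0 0 0 = n := by rw [h1 0 (by decide) (by decide)]; simpa using hn0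
    have e6 : τ.nat 6 = σ.nat 6 := by rw [h1 6 (by decide) (by decide)]; simp
    simp [hi] at h2 h3 hk
    refine wp_ite (fun _ => wp_setNat ?_) fun hb => absurd k.2 (by simp [e23, e0] at hb)
    simp only [NExp.eval, e30, e23]
    refine ⟨fun j hj => ?_, fun j hj => ?_, .inl ⟨by simp, ?_⟩⟩
    · simpa using h3 j hj
    · rw [Store.updateNat_nat_same, if_neg (by simp [hj]), e6]
    · simp only [Store.row_updateNat_ne _ _ _ _ _ _ (show 3 ≠ 6 by decide), h2,
        Store.updateNat_nat_self, Fin.eta]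
      exact ⟨rfl, hk⟩
  · refine wp_seq (wp_copyRow (by simpa using hm0) hm (by decide) (by decide) (by decide)
      (by decide) ?_)
    rintro τ h1 hreal h2 h3
    have e30 : τ.nat 30 0 0 = i := by rw [h1 30 (by decide) (by decide)]; simpa using hi
    have e23 : τ.nat 23 0 0 = n := by rw [h1 23 (by decide) (by decide)]; simp
    have e0 : τ.nat 0 = σ.nat 0 := by rw [h1 0 (by decide) (by decide)]; simp
    have e6 : τ.nat 6 = σ.nat 6 := by rw [h1 6 (by decide) (by decide)]; simp
    have e5 : τ.nat 5 0 i = g := by rw [h1 5 (by decide) (by decide)]; simpa using hg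
    have e1 : τ.nat 1 = σ.nat 1 := by rw [h1 1 (by decide) (by decide)]; simp
    have e25 : τ.nat 25 0 0 = σ.nat 25 0 0 := by rw [h1 25 (by decide) (by decide)]; simp
    simp [hi] at h2 h3 hk
    refine wp_ite (fun hb => absurd hb (by simp [e23, e0, hn0])) fun _ => wp_seq (wp_setNat ?_)
    simp only [NExp.eval, e30, e5]
    set ρ := τ.updateNat 3 i g 1 with hρ
    have hρrow : ρ.row m 3 i = insert g (σ.row m 1 i) := by
      rw [hρ, Store.row_updateNat_pos τ 3 i g one_ne_zero, h2]
    have hρrow' : ∀ j, j ≠ (i : ℕ) → ρ.row m 3 j = σ.row m 3 j := fun j hj => by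
      rw [hρ, Store.row_updateNat_row_ne _ _ _ _ _ hj, h3 j hj]
    have hρne : ∀ c, c ≠ 3 → ρ.nat c = τ.nat c := fun c hc => Store.updateNat_nat_ne _ _ _ _ hc
    have hρ25 : ρ.nat 25 0 0 = σ.nat 25 0 0 := by rw [hρne 25 (by decide), e25]
    have hρ30 : ρ.nat 30 0 0 = i := by rw [hρne 30 (by decide), e30]
    have hρ0 : ρ.nat 0 = σ.nat 0 := by rw [hρne 0 (by decide), e0]
    have hρ1 : ρ.nat 1 = σ.nat 1 := by rw [hρne 1 (by decide), e1]
    have hρ6 : ρ.nat 6 = σ.nat 6 := by rw [hρne 6 (by decide), e6]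
    refine wp_ite (fun hb => wp_setNat ?_) fun hb => wp_seq (wp_trim hv (ε := ε) ?_ ?_ ?_ hn hm i hρ30 ?_)
    · simp [hρ25, hρ0, hn0] at hb
      simp only [NExp.eval, hρ30, hρ0, hn0]
      refine ⟨fun j hj => ?_, fun j hj => ?_, .inr ⟨hk, .inl ⟨hb, by simp⟩⟩⟩
      · simpa using hρrow' j hj
      · rw [Store.updateNat_nat_same, if_neg (by simp [hj]), hρ6]
    · rw [hρ0, hn0]
    · rw [hρ0, hm0]
    · rw [hρ, Store.updateNat_real, hreal]
      simpa using hε0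
    · rintro τ' h4 - h5 h6
      simp [hρ25, hρ0, hn0] at hb
      have f30 : τ'.nat 30 0 0 = i := by rw [h4 30 (by decide), hρ30]
      have f6 : τ'.nat 6 = σ.nat 6 := by rw [h4 6 (by decide), hρ6]
      have hX : (fun i : Fin n => ρ.row m 1 i) = σ.output n m := by
        funext i
        exact Store.row_congr hρ1 _ _
      rw [hX, hρrow] at h6
      refine wp_setNat ?_
      simp only [NExp.eval, f30]
      refine ⟨fun j hj => ?_, fun j hj => ?_, .inr ⟨hk, .inr ⟨hb, ?_⟩⟩⟩
      · simpa [hρrow' j hj] using h5 j hj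
      · rw [Store.updateNat_nat_same, if_neg (by simp [hj]), f6]
      · simp only [Store.updateNat_nat_self, Store.row_updateNat_ne _ _ _ _ _ _ (show 3 ≠ 6 by decide)]
        exact ⟨h6.1, h6.efx, h6.2.2⟩

theorem wp_successors (hv : ∀ i, IsSubadditiveValuation (v i)) {ε : ℝ} (hn0 : σ.nat 0 0 0 = n)
    (hm0 : σ.nat 0 0 1 = m) (hε0 : σ.real 0 0 0 = ε) (hn : n ≤ N) (hm : m ≤ N) (G : Fin n → Fin m)
    (hG : ∀ i : Fin n, σ.nat 5 0 i = G i)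
    (hQ : ∀ τ : Store, (∀ c, c ∉ [3, 6, 20, 21, 22, 23, 24, 30] → τ.nat c = σ.nat c) →
      τ.real = σ.real →
      (∀ i : Fin n, IsSuccessor v ε (σ.output n m) (σ.nat 25 0 0) i (G i) (τ.nat 6 0 i)
        (τ.row m 3 i)) → Q τ) :
    wp v N (forLoop 30 .agents successor) Q σ := by
  refine wp_frame_list (Q := fun τ =>
      ∀ i : Fin n, IsSuccessor v ε (σ.output n m) (σ.nat 25 0 0) i (G i) (τ.nat 6 0 i)
        (τ.row m 3 i)) [3, 6, 20, 21, 22, 23, 24, 30] ?_ (by decide) rfl hQ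
  refine wp_for n (fun k τ => ∀ i : Fin n, (i : ℕ) < k →
    IsSuccessor v ε (σ.output n m) (σ.nat 25 0 0) i (G i) (τ.nat 6 0 i) (τ.row m 3 i))
    (by decide) (by decide) (by simpa using hn0) hn ?_ ?_ ?_
  · intro i hi
    omega
  · rintro k τ hk hxk hfr hfr' h1
    have e0 : τ.nat 0 = σ.nat 0 := hfr 0 (by decide) (by decide)
    have e1 : τ.nat 1 = σ.nat 1 := hfr 1 (by decide) (by decide)
    have e5 : τ.nat 5 = σ.nat 5 := hfr 5 (by decide) (by decide)
    have e25 : τ.nat 25 = σ.nat 25 := hfr 25 (by decide) (by decide)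
    have hX : τ.output n m = σ.output n m := funext fun i => Store.row_congr e1 _ _
    refine wp_successor hv (ε := ε) (by rw [e0, hn0]) (by rw [e0, hm0])
      (by rw [hfr' 0 (by decide), hε0]) hn hm ⟨k, hk⟩ hxk (G ⟨k, hk⟩) (by rw [e5, hG]) ?_
    rintro ρ - - h2 h3 h4 i hi
    rw [hX, e25] at h4
    simp only [Store.row_updateNat_ne _ _ _ _ _ _ (show 3 ≠ 30 by decide),
      Store.updateNat_nat_ne _ _ _ _ (show 6 ≠ 30 by decide)]
    rcases Nat.lt_succ_iff_lt_or_eq.1 hi with h5 | h5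
    · rw [h2 i h5.ne, h3 i h5.ne]
      exact h1 i h5
    · have : i = ⟨k, hk⟩ := Fin.ext h5
      rw [this]
      exact h4
  · rintro τ - h i
    exact h i i.2

/-- Iterating a self-map of `Fin n` for `n` steps leads to a periodic point. -/
theorem exists_period (F : Fin n → Fin n) (x : Fin n) :
    ∃ q, 0 < q ∧ q ≤ n ∧ F^[q] (F^[n] x) = F^[n] x := by
  obtain ⟨a, ha, b, hb, hab, heq⟩ := Finset.exists_ne_map_eq_of_card_lt_of_maps_to
    (s := Finset.range (n + 1)) (t := (Finset.univ : Finset (Fin n))) (by simp)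
    (f := fun t => F^[t] x) (fun _ _ => by simp)
  simp only [Finset.mem_range] at ha hb
  have key : ∀ a b, a < b → b ≤ n → F^[a] x = F^[b] x →
      ∃ q, 0 < q ∧ q ≤ n ∧ F^[q] (F^[n] x) = F^[n] x := by
    intro a b hlt hb h
    refine ⟨b - a, by omega, by omega, ?_⟩
    have h1 : F^[n] x = F^[n - a] (F^[a] x) := by
      rw [← Function.iterate_add_apply]
      congr 1
      omega
    rw [h1, ← Function.iterate_add_apply, h, ← Function.iterate_add_apply,
      ← Function.iterate_add_apply]
    conv_rhs => rw [show n - a + b = (b - a) + (n - a) + a by omega, Function.iterate_add_apply, h]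
    rw [← Function.iterate_add_apply]
  rcases lt_or_gt_of_ne hab with h | h
  · exact key a b h (by omega) heq
  · exact key b a h (by omega) heq.symm

/-- After `n` steps from agent `0` the iteration is on a cycle, and `n` further steps go round it at
least once. Repeated visits are harmless, since bundles are copied from array `3`, which stays
unchanged. -/
theorem wp_rotate (hn0 : σ.nat 0 0 0 = n) (hm0 : σ.nat 0 0 1 = m) (hpos : 0 < n) (hn : n ≤ N)
    (hm : m ≤ N) (F : Fin n → Fin n) (hF : ∀ i : Fin n, σ.nat 6 0 i = F i)
    (hQ : ∀ τ : Store, (∀ c, c ∉ [1, 2, 20, 21, 27, 29] → τ.nat c = σ.nat c) →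
      τ.real = σ.real →
      τ.row m 2 0 = σ.row m 2 0 ∩ unallocated (τ.output n m) →
      (∃ C : Finset (Fin n), C.Nonempty ∧ (∀ e ∈ C, ∃ d ∈ C, F d = e) ∧
        (∀ e ∉ C, τ.output n m e = σ.output n m e) ∧
        ∀ d ∈ C, τ.output n m (F d) = σ.row m 3 d) → Q τ) :
    wp v N rotate Q σ := by
  refine wp_frame_list (Q := fun τ => τ.row m 2 0 = σ.row m 2 0 ∩ unallocated (τ.output n m) ∧
      ∃ C : Finset (Fin n), C.Nonempty ∧ (∀ e ∈ C, ∃ d ∈ C, F d = e) ∧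
        (∀ e ∉ C, τ.output n m e = σ.output n m e) ∧
        ∀ d ∈ C, τ.output n m (F d) = σ.row m 3 d) [1, 2, 20, 21, 27, 29] ?_ (by decide) rfl
    fun τ h1 h2 h3 => hQ τ h1 h2 h3.1 h3.2
  set x : Fin n := ⟨0, hpos⟩
  obtain ⟨q, hq0, hqn, hq⟩ := exists_period F x
  obtain ⟨p, hp⟩ : ∃ p, p = F^[n] x := ⟨_, rfl⟩
  rw [← hp] at hq
  have hper : ∀ t, F^[q + t] p = F^[t] p := fun t => by
    rw [add_comm, Function.iterate_add_apply, hq]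
  have hmod : ∀ t, ∃ s < n, F^[s] p = F^[t] p := by
    intro t
    refine ⟨t % q, (Nat.mod_lt _ hq0).trans_le hqn, ?_⟩
    exact (Function.IsPeriodicPt.iterate_mod_apply (f := F) (x := p) hq t)
  -- On the cycle `F^[q - 1]` inverts `F`. Hence no bundle on the cycle is overwritten by a
  -- different one.
  have hinj : ∀ s t, F (F^[s] p) = F (F^[t] p) → F^[s] p = F^[t] p := by
    intro s t h
    have : ∀ s, F^[s] p = F^[q - 1] (F (F^[s] p)) := by
      intro s
      rw [← Function.iterate_succ_apply, ← Function.iterate_add_apply]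
      rw [show (q - 1).succ + s = q + s by omega, hper]
    rw [this s, this t, h]
  refine wp_seq (wp_setNat (wp_seq ?_))
  simp only [NExp.eval]
  refine wp_frame_list (Q := fun τ => τ.nat 27 0 0 = p) [27, 29] ?_ (by decide) rfl ?_
  · refine wp_for n (fun k τ => τ.nat 27 0 0 = F^[k] x) (by decide) (by decide)
      (by simpa using hn0) hn ?_ ?_ ?_
    · simp [x]
    · rintro k τ hk hxk hfr - h1
      have e6 : τ.nat 6 = σ.nat 6 := by rw [hfr 6 (by decide) (by decide)]; simp
      refine wp_setNat ?_
      simp only [NExp.eval, h1, e6, hF]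
      simp [Function.iterate_succ_apply']
    · rintro τ - h
      rw [h, hp]
  · rintro σ' hσ - h27
    have hσ' : ∀ c, c ∉ [27, 29] → σ'.nat c = σ.nat c := fun c hc => by
      rw [hσ c hc, Store.updateNat_nat_ne _ _ _ _ fun h => hc (by simp [h])]
    refine wp_seq ?_
    refine wp_frame_list (Q := fun τ => (∀ s < n, τ.row m 1 (F (F^[s] p)) = σ.row m 3 (F^[s] p)) ∧
      ∀ e : Fin n, (∀ s < n, F (F^[s] p) ≠ e) → τ.row m 1 e = σ.row m 1 e) [1, 21, 27, 29] ?_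
      (by decide) rfl ?_
    · refine wp_for n (fun k τ => τ.nat 27 0 0 = F^[k] p ∧
        (∀ s < k, τ.row m 1 (F (F^[s] p)) = σ.row m 3 (F^[s] p)) ∧
        ∀ e : Fin n, (∀ s < k, F (F^[s] p) ≠ e) → τ.row m 1 e = σ.row m 1 e) (by decide)
        (by decide) (by simp [hσ', hn0]) hn ?_ ?_ ?_
      · refine ⟨by simpa using h27, by omega, fun e _ => ?_⟩
        simp [Store.row_congr (hσ' 1 (by decide))]
      · rintro k τ hk hxk hfr - ⟨h1, h2, h3⟩
        have e6 : τ.nat 6 = σ.nat 6 := by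
          rw [hfr 6 (by decide) (by decide), hσ' 6 (by decide)]
        have e0 : τ.nat 0 = σ.nat 0 := by
          rw [hfr 0 (by decide) (by decide), hσ' 0 (by decide)]
        have e3 : τ.nat 3 = σ.nat 3 := by
          rw [hfr 3 (by decide) (by decide), hσ' 3 (by decide)]
        refine wp_seq (wp_copyRow (by rw [e0, hm0]) hm (by decide) (by decide) (by decide)
          (by decide) ?_)
        rintro ρ hρ - h4 h5
        simp only [NExp.eval, h1, e6, hF, Store.row_congr e3] at h4 h5
        have g27 : ρ.nat 27 0 0 = F^[k] p := by rw [hρ 27 (by decide) (by decide), h1]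
        have g6 : ρ.nat 6 = σ.nat 6 := by rw [hρ 6 (by decide) (by decide), e6]
        refine wp_setNat ?_
        simp only [NExp.eval, g27, g6, hF]
        refine ⟨by simp [Function.iterate_succ_apply'], fun s hs => ?_, fun e he => ?_⟩
        · simp only [Store.row_updateNat_ne _ _ _ _ _ _ (show 1 ≠ 29 by decide),
            Store.row_updateNat_ne _ _ _ _ _ _ (show 1 ≠ 27 by decide)]
          by_cases hsk : F (F^[s] p) = F (F^[k] p)
          · rw [hinj _ _ hsk, h4]
          · rw [h5 _ fun h => hsk (Fin.ext h)]
            refine h2 s ?_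
            rcases Nat.lt_succ_iff_lt_or_eq.1 hs with h | h
            · exact h
            · exact absurd (by rw [h]) hsk
        · simp only [Store.row_updateNat_ne _ _ _ _ _ _ (show 1 ≠ 29 by decide),
            Store.row_updateNat_ne _ _ _ _ _ _ (show 1 ≠ 27 by decide)]
          rw [h5 _ fun h => he k (by omega) (Fin.ext h.symm)]
          exact h3 e fun s hs => he s (by omega)
      · rintro τ - h
        exact h.2
    · rintro τ hτ - ⟨h1, h2⟩
      have hτ' : ∀ c, c ∉ [1, 21, 27, 29] → τ.nat c = σ.nat c := fun c hc => by
        rw [hτ c hc, hσ' c fun h => hc (by simp at h ⊢; tauto)]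
      refine wp_cleanBag (by rw [hτ' 0 (by decide), hn0]) (by rw [hτ' 0 (by decide), hm0]) hn hm ?_
      rintro ρ hρ - h3
      have hX : ρ.output n m = τ.output n m :=
        funext fun i => Store.row_congr (hρ 1 (by decide)) _ _
      refine ⟨?_, (Finset.range n).image fun s => F^[s] p, ?_, ?_, ?_, ?_⟩
      · rw [h3, hX, Store.row_congr (hτ' 2 (by decide))]
        rfl
      · exact ⟨p, Finset.mem_image.2 ⟨0, by simpa using hpos, rfl⟩⟩
      · intro e he
        obtain ⟨s, -, rfl⟩ := Finset.mem_image.1 he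
        obtain ⟨t, ht, h4⟩ := hmod (q + s - 1)
        refine ⟨F^[t] p, Finset.mem_image.2 ⟨t, by simpa using ht, rfl⟩, ?_⟩
        rw [h4, ← Function.iterate_succ_apply' F, show (q + s - 1).succ = q + s by omega, hper]
      · intro e he
        rw [hX]
        refine h2 e fun s hs h4 => he ?_
        obtain ⟨t, ht, h5⟩ := hmod (s + 1)
        refine Finset.mem_image.2 ⟨t, by simpa using ht, ?_⟩
        rw [h5, Function.iterate_succ_apply', h4]
      · intro d hd
        obtain ⟨s, hs, rfl⟩ := Finset.mem_image.1 hd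
        rw [hX]
        exact h1 s (by simpa using hs)

end Specs

/-! ### The main loop: choice of a move and termination -/

namespace BProgram

/-- Agent `var 23` swaps her bundle with the bag. -/
def swapBag : BProgram :=
  .seq (copyRow 2 (.lit 0) 3 .agents) (.seq (copyRow 1 (.var 23) 2 (.lit 0))
    (copyRow 3 .agents 1 (.var 23)))

/-- Moves good `var 21` into the bag, or passes a part of the bag with this good to an agent. -/
def growBag : BProgram :=
  .seq (assign 28 (.var 21)) (.seq (assign 30 .agents) (.seq (copyRow 2 (.lit 0) 3 .agents)
    (.seq (.setNat 3 .agents (.var 28) (.lit 1)) (.seq trim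
      (.ite (.natLT (.var 24) .agents) (.seq (copyRow 3 .agents 1 (.var 24)) cleanBag)
        (.setNat 2 (.lit 0) (.var 28) (.lit 1)))))))

/-- Gives a good in the bag to an agent whom nobody envies, or rotates bundles. -/
def distribute : BProgram :=
  .seq padList (.seq (forLoop 30 .agents successor)
    (.seq (find 20 .agents (.not (.natLT (.get 6 (.lit 0) (.var 20)) .agents)))
      (.ite (.natLT (.var 20) .agents)
        (.seq (.setNat 1 (.var 20) (.get 5 (.lit 0) (.var 20)) (.lit 1))
          (.setNat 2 (.lit 0) (.get 5 (.lit 0) (.var 20)) (.lit 0)))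
        rotate)))

/-- One move of the algorithm; variable `26` becomes `1` if there is nothing left to do. -/
def mainStep (c : Bool) : BProgram :=
  .seq (findEnvier 2 (.lit 0)) (.ite (.natLT (.var 23) .agents) swapBag
    (.seq markUsed (.seq (find 21 .goods (.not (.natLT (.lit 0) (.get 4 (.lit 0) (.var 21)))))
      (.ite (.natLT (.var 21) .goods) growBag
        (.seq listBag (.ite
          (if c then .natLT (.lit 0) (.var 25) else .not (.natLT (.var 25) .agents))
          distribute (assign 26 (.lit 1))))))))

/-- The moves of the algorithm. -/
def mainLoop (c : Bool) : BProgram := .loop 10 (.natLT (.var 26) (.lit 1)) (mainStep c)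

end BProgram

section Specs

variable {n m : ℕ} {v : Fin n → Finset (Fin m) → ℝ} {N : ℕ} {Q Q' : Store → Prop} {σ : Store}
  {ε : ℝ} {c : Bool} {Y : Fin n → Finset (Fin m)}

/-- The memory `τ` results from a move in the memory `σ`. -/
def IsMove (v : Fin n → Finset (Fin m) → ℝ) (ε : ℝ) (c : Bool) (Y : Fin n → Finset (Fin m))
    (σ τ : Store) : Prop :=
  FairState v ε c Y (τ.output n m) (τ.row m 2 0) ∧
    potential v ε (τ.output n m) (τ.row m 2 0) < potential v ε (σ.output n m) (σ.row m 2 0)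

theorem Store.output_eq_update {σ τ : Store} {k : Fin n} {S : Finset (Fin m)}
    (h : τ.row m 1 k = S) (h' : ∀ j, j ≠ (k : ℕ) → τ.row m 1 j = σ.row m 1 j) :
    τ.output n m = Function.update (σ.output n m) k S := by
  funext i
  by_cases hi : i = k
  · rw [hi, Function.update_self]
    exact h
  · rw [Function.update_of_ne hi]
    exact h' i fun h => hi (Fin.ext h)

theorem Store.output_congr {σ τ : Store} (h : τ.nat 1 = σ.nat 1) :
    τ.output n m = σ.output n m :=
  funext fun _ => Store.row_congr h _ _

theorem wp_swapBag (hn0 : σ.nat 0 0 0 = n) (hm0 : σ.nat 0 0 1 = m) (hm : m ≤ N)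
    (h : FairState v ε c Y (σ.output n m) (σ.row m 2 0)) (k : Fin n) (hk : σ.nat 23 0 0 = k)
    (hlt : v k (σ.output n m k) < v k (σ.row m 2 0)) :
    wp v N swapBag (IsMove v ε c Y σ) σ := by
  -- Row `n` of array `3` belongs to no agent and serves as temporary storage.
  refine wp_seq (wp_copyRow hm0 hm (by decide) (by decide) (by decide) (by decide) ?_)
  rintro τ h1 - h2 -
  simp only [NExp.eval, hn0] at h2
  have e0 : τ.nat 0 = σ.nat 0 := h1 0 (by decide) (by decide)
  have e1 : τ.nat 1 = σ.nat 1 := h1 1 (by decide) (by decide)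
  have e23 : τ.nat 23 = σ.nat 23 := h1 23 (by decide) (by decide)
  refine wp_seq (wp_copyRow (by rw [e0, hm0]) hm (by decide) (by decide) (by decide)
    (by decide) ?_)
  rintro ρ h3 - h4 -
  simp only [NExp.eval, e23, hk, Store.row_congr e1] at h4
  have f0 : ρ.nat 0 = σ.nat 0 := (h3 0 (by decide) (by decide)).trans e0
  have f1 : ρ.nat 1 = σ.nat 1 := (h3 1 (by decide) (by decide)).trans e1
  have f3 : ρ.nat 3 = τ.nat 3 := h3 3 (by decide) (by decide)
  have f23 : ρ.nat 23 = σ.nat 23 := (h3 23 (by decide) (by decide)).trans e23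
  refine wp_copyRow (by rw [f0, hm0]) hm (by decide) (by decide) (by decide) (by decide) ?_
  rintro κ h5 - h6 h7
  simp only [NExp.eval, f23, hk, f0, hn0, Store.row_congr f3, h2] at h6 h7
  have g2 : κ.row m 2 0 = σ.output n m k := (Store.row_congr (h5 2 (by decide) (by decide)) _ _).trans h4
  have hX : κ.output n m = Function.update (σ.output n m) k (σ.row m 2 0) :=
    Store.output_eq_update h6 fun j hj => (h7 j hj).trans (Store.row_congr f1 _ _)
  rw [IsMove, hX, g2]
  exact h.swap hlt

theorem wp_growBag (hv : ∀ i, IsSubadditiveValuation (v i)) (hε : 0 < ε) (hn0 : σ.nat 0 0 0 = n)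
    (hm0 : σ.nat 0 0 1 = m) (hε0 : σ.real 0 0 0 = ε) (hn : n ≤ N) (hm : m ≤ N)
    (h : FairState v ε c Y (σ.output n m) (σ.row m 2 0))
    (hB : Unenvied v (σ.output n m) (σ.row m 2 0)) (g : Fin m) (hg : σ.nat 21 0 0 = g)
    (hgU : g ∈ unallocated (σ.output n m)) (hgB : g ∉ σ.row m 2 0) :
    wp v N growBag (IsMove v ε c Y σ) σ := by
  refine wp_seq (wp_setNat (wp_seq (wp_setNat (wp_seq ?_))))
  simp only [NExp.eval, hg, ne_eq, not_false_eq_true, Store.updateNat_nat_ne,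
    OfNat.zero_ne_ofNat, hn0]
  refine wp_copyRow (by simpa using hm0) hm (by decide) (by decide) (by decide) (by decide) ?_
  rintro τ h1 hreal h2 -
  simp [hn0] at h2
  have e0 : τ.nat 0 = σ.nat 0 := by rw [h1 0 (by decide) (by decide)]; simp
  have e1 : τ.nat 1 = σ.nat 1 := by rw [h1 1 (by decide) (by decide)]; simp
  have e2 : τ.nat 2 = σ.nat 2 := by rw [h1 2 (by decide) (by decide)]; simp
  have e28 : τ.nat 28 0 0 = g := by rw [h1 28 (by decide) (by decide)]; simp
  have e30 : τ.nat 30 0 0 = n := by rw [h1 30 (by decide) (by decide)]; simp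
  refine wp_seq (wp_setNat (wp_seq ?_))
  simp only [NExp.eval, e0, hn0, e28]
  refine wp_trim hv (ε := ε) (by simp [e0, hn0]) (by simp [e0, hm0]) (by simpa [hreal] using hε0)
    hn hm n (by simpa using e30) ?_
  rintro ρ h3 - - h4
  have hrow : (τ.updateNat 3 n g 1).row m 3 n = insert g (σ.row m 2 0) := by
    rw [Store.row_updateNat_pos τ 3 n g one_ne_zero, h2]
  have hX : (fun i : Fin n => (τ.updateNat 3 n g 1).row m 1 i) = σ.output n m := by
    refine (funext fun i => ?_ : (fun i : Fin n => (τ.updateNat 3 n g 1).row m 1 i) = _)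
    rw [Store.row_updateNat_ne _ _ _ _ _ _ (by decide)]
    exact Store.row_congr e1 _ _
  rw [hrow, hX] at h4
  have hρ : ∀ c, c ∉ [3, 20, 22, 24] → ρ.nat c = τ.nat c := fun c hc => by
    rw [h3 c hc, Store.updateNat_nat_ne _ _ _ _ fun h => hc (by simp [h])]
  have f0 : ρ.nat 0 = σ.nat 0 := (hρ 0 (by decide)).trans e0
  have f1 : ρ.nat 1 = σ.nat 1 := (hρ 1 (by decide)).trans e1
  have f2 : ρ.nat 2 = σ.nat 2 := (hρ 2 (by decide)).trans e2
  have f28 : ρ.nat 28 0 0 = g := by rw [hρ 28 (by decide), e28]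
  refine wp_ite (fun hb => wp_seq ?_) fun hb => wp_setNat ?_
  · simp [f0, hn0] at hb
    refine wp_copyRow (by rw [f0, hm0]) hm (by decide) (by decide) (by decide) (by decide) ?_
    rintro κ h5 - h6 h7
    simp only [NExp.eval, f0, hn0] at h6 h7
    refine wp_cleanBag (by rw [h5 0 (by decide) (by decide), f0, hn0])
      (by rw [h5 0 (by decide) (by decide), f0, hm0]) hn hm ?_
    rintro κ' h8 - h9
    have hX' : κ'.output n m =
        Function.update (σ.output n m) ⟨ρ.nat 24 0 0, hb⟩ (ρ.row m 3 n) := by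
      rw [Store.output_congr (h8 1 (by decide))]
      exact Store.output_eq_update h6 fun j hj => (h7 j hj).trans (Store.row_congr f1 _ _)
    have h9' : κ'.row m 2 0 = σ.row m 2 0 ∩ unallocated (κ'.output n m) := by
      rw [h9, Store.output_congr (h8 1 (by decide)),
        Store.row_congr ((h5 2 (by decide) (by decide)).trans f2)]
      rfl
    rw [IsMove, h9', hX']
    rcases h4.2.2 with ⟨h10, -⟩ | ⟨h10, h11⟩
    · omega
    · exact h.take_bag hv hε hB hgU hgB h4.1 h4.efx h11
  · simp [f0, hn0] at hb
    simp only [NExp.eval, f28]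
    rw [IsMove, Store.output_congr (Store.updateNat_nat_ne _ _ _ _ (by decide)),
      Store.output_congr f1, Store.row_updateNat_pos ρ 2 0 g one_ne_zero, Store.row_congr f2]
    rcases h4.2.2 with ⟨-, h10⟩ | ⟨h10, -⟩
    · exact h.grow_bag hv hB hgU hgB (h10 ▸ h4.efx)
    · omega

/-- An agent without a successor receives the good offered to her. If all agents have one, the
successors form a self-map of the agents, and a cycle of it consists of improvements. -/
theorem wp_distribute (hv : ∀ i, IsSubadditiveValuation (v i)) (hε : 0 < ε) (hpos : 0 < n)
    (hn0 : σ.nat 0 0 0 = n)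
    (hm0 : σ.nat 0 0 1 = m) (hε0 : σ.real 0 0 0 = ε) (hn : n ≤ N) (hm : m ≤ N)
    (h : FairState v ε c Y (σ.output n m) (σ.row m 2 0))
    (hB : Unenvied v (σ.output n m) (σ.row m 2 0))
    (hR : unallocated (σ.output n m) ⊆ σ.row m 2 0)
    (hcard : σ.nat 25 0 0 = (σ.row m 2 0).card)
    (hG : ∀ i < (σ.row m 2 0).card, ∃ g ∈ σ.row m 2 0, σ.nat 5 0 i = (g : ℕ))
    (hG' : ∀ i < (σ.row m 2 0).card, ∀ j < (σ.row m 2 0).card,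
      σ.nat 5 0 i = σ.nat 5 0 j → i = j)
    (hc : if c then 0 < (σ.row m 2 0).card else n ≤ (σ.row m 2 0).card) :
    wp v N distribute (IsMove v ε c Y σ) σ := by
  set B := σ.row m 2 0 with hBdef
  have hBpos : 0 < B.card := by
    split_ifs at hc
    · exact hc
    · omega
  refine wp_seq (wp_padList hn0 hn (by rw [hcard]; exact hBpos) ?_)
  rintro τ h1 hτr h2
  have e0 : τ.nat 0 = σ.nat 0 := h1 0 (by decide)
  have e1 : τ.nat 1 = σ.nat 1 := h1 1 (by decide)
  have e2 : τ.nat 2 = σ.nat 2 := h1 2 (by decide)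
  have e25 : τ.nat 25 = σ.nat 25 := h1 25 (by decide)
  have hex : ∀ i : Fin n, ∃ g ∈ B, τ.nat 5 0 i = (g : ℕ) := by
    intro i
    rw [h2 i i.2, hcard]
    split_ifs with h3
    · exact hG i h3
    · exact hG 0 hBpos
  choose G hGB hGeq using hex
  -- With at least `n` goods in the bag the entries for the agents come from the original list,
  -- which has no repetitions.
  have hinj : n ≤ B.card → G.Injective := by
    intro hnB i j hij
    have h3 := hGeq i
    have h4 := hGeq j
    rw [h2 i i.2, hcard, if_pos (by omega)] at h3
    rw [h2 j j.2, hcard, if_pos (by omega)] at h4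
    exact Fin.ext (hG' i (by omega) j (by omega) (by rw [h3, h4, hij]))
  refine wp_seq (wp_successors hv (ε := ε) (by rw [e0, hn0]) (by rw [e0, hm0])
    (by rw [hτr, hε0]) hn hm G hGeq ?_)
  rintro ρ h3 hρr h4
  rw [Store.output_congr e1, e25, hcard] at h4
  have f0 : ρ.nat 0 = σ.nat 0 := (h3 0 (by decide)).trans e0
  have f1 : ρ.nat 1 = σ.nat 1 := (h3 1 (by decide)).trans e1
  have f2 : ρ.nat 2 = σ.nat 2 := (h3 2 (by decide)).trans e2
  have f5 : ρ.nat 5 = τ.nat 5 := h3 5 (by decide)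
  refine wp_seq (wp_find n (fun k => ¬ ρ.nat 6 0 k < n) (by decide) (by simp [f0, hn0]) hn
    (fun k => by simp [f0, hn0]) fun k hk h5 h6 => ?_)
  refine wp_ite (fun hb => ?_) fun hb => ?_
  · simp [f0, hn0] at hb
    have h7 := h6 hb
    set i : Fin n := ⟨k, hb⟩ with hi
    have h8 := h4 i
    refine wp_seq (wp_setNat (wp_setNat ?_))
    simp only [NExp.eval, Store.updateNat_nat_self, Store.updateNat_nat_ne _ _ _ _ (show 5 ≠ 20 by decide),
      Store.updateNat_nat_ne _ _ _ _ (show 5 ≠ 1 by decide),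
      Store.updateNat_nat_ne _ _ _ _ (show 20 ≠ 1 by decide), f5,
      show τ.nat 5 0 k = G i from hGeq i]
    have hX : ((((ρ.updateNat 20 0 0 k).updateNat 1 k (G i) 1).updateNat 2 0 (G i) 0).output n m) =
        Function.update (σ.output n m) i (insert (G i) (σ.output n m i)) := by
      refine Store.output_eq_update ?_ fun j hj => ?_
      · rw [Store.row_updateNat_ne _ _ _ _ _ _ (by decide), hi,
          Store.row_updateNat_pos _ 1 k (G i) one_ne_zero,
          Store.row_updateNat_ne _ _ _ _ _ _ (by decide), Store.row_congr f1]
        rfl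
      · rw [Store.row_updateNat_ne _ _ _ _ _ _ (by decide), Store.row_updateNat_row_ne _ _ _ _ _ hj,
          Store.row_updateNat_ne _ _ _ _ _ _ (by decide), Store.row_congr f1]
    rw [IsMove, hX, Store.row_updateNat_zero _ 2 0 (G i), Store.row_updateNat_ne _ _ _ _ _ _ (by decide),
      Store.row_updateNat_ne _ _ _ _ _ _ (by decide), Store.row_congr f2]
    rcases h8 with ⟨h9, -⟩ | ⟨h9, ⟨h10, -⟩ | ⟨h10, -, h11, ⟨-, h12⟩ | ⟨h12, -⟩⟩⟩
    · exact absurd h9 h7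
    · refine h.add_good hv hε hB hR (hGB i) h9 (.inr ⟨?_, h10⟩)
      -- Without the completeness requirement this move is made only with at least `n` goods in the
      -- bag, so a small bag occurs only for `c = true`.
      by_contra hcf
      rw [if_neg hcf] at hc
      omega
    · exact h.add_good hv hε hB hR (hGB i) h9 (.inl ⟨h10, h12 ▸ h11⟩)
    · exact absurd h12 h7
  · simp [f0, hn0] at hb
    have hkn : k = n := by omega
    have h7 : ∀ i : Fin n, ρ.nat 6 0 i < n := fun i => not_not.1 (h5 i (by omega))
    refine wp_rotate (by simp [f0, hn0]) (by simp [f0, hm0]) hpos hn hm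
      (fun i => ⟨ρ.nat 6 0 i, h7 i⟩) (fun i => by simp) ?_
    rintro κ - - h8 ⟨C, hC, hCs, hX', hX''⟩
    rw [IsMove, h8, Store.row_updateNat_ne _ _ _ _ _ _ (by decide), Store.row_congr f2]
    refine h.rotate hv hε hB hR hC G hinj (fun d hd => ?_) hCs (fun e he => ?_) hX''
    · rw [Store.row_updateNat_ne _ _ _ _ _ _ (by decide)]
      rcases h4 d with ⟨_, h9, h10⟩ | ⟨h9, ⟨-, h10⟩ | ⟨h10, h11, h12, ⟨h13, -⟩ | ⟨_, h13⟩⟩⟩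
      · exact .inl ⟨h9, h10⟩
      · exact absurd (h7 d) (by omega)
      · exact absurd (h7 d) (by omega)
      · exact .inr ⟨h10, h11, hGB d, h9, h12, h13⟩
    · rw [hX' e he]
      exact congrFun (Store.output_congr ((Store.updateNat_nat_ne _ _ _ _ (by decide)).trans f1)) e

/-- The allocation in the memory is final. -/
def IsFinal (v : Fin n → Finset (Fin m) → ℝ) (ε : ℝ) (c : Bool) (Y : Fin n → Finset (Fin m))
    (σ : Store) : Prop :=
  IsAlphaCEFX v (if c then 1 / 2 - ε else 1 - ε) c (σ.output n m) ∧
    ∀ i, v i (Y i) ≤ v i (σ.output n m i)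

theorem wp_mainStep (hv : ∀ i, IsSubadditiveValuation (v i)) (hε : 0 < ε) (hpos : 0 < n)
    (hn0 : σ.nat 0 0 0 = n)
    (hm0 : σ.nat 0 0 1 = m) (hε0 : σ.real 0 0 0 = ε) (hn : n ≤ N) (hm : m ≤ N)
    (h : FairState v ε c Y (σ.output n m) (σ.row m 2 0)) (hd : σ.nat 26 0 0 = 0) :
    wp v N (mainStep c) (fun τ => (τ.nat 0 = σ.nat 0 ∧ τ.real = σ.real) ∧
      ((τ.nat 26 0 0 = 0 ∧ IsMove v ε c Y σ τ) ∨ (τ.nat 26 0 0 = 1 ∧ IsFinal v ε c Y τ))) σ := by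
  refine wp_frame (Q := fun τ =>
      ((τ.nat 26 0 0 = 0 ∧ IsMove v ε c Y σ τ) ∨ (τ.nat 26 0 0 = 1 ∧ IsFinal v ε c Y τ))) ?_ ?_
  swap
  · intro τ h1 h2 h3
    exact ⟨⟨h1 0 (by cases c <;> decide), funext fun a => h2 a (by cases c <;> simp [show (mainStep _).realWrites = [] from rfl])⟩, h3⟩
  -- The preparatory computations change neither the bundles nor the bag, so a move from the
  -- intermediate memory is also a move from `σ`.
  have hmove : ∀ {A : BProgram} {τ : Store}, 26 ∉ A.natWrites → τ.nat 26 0 0 = 0 →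
      τ.output n m = σ.output n m → τ.row m 2 0 = σ.row m 2 0 →
      wp v N A (IsMove v ε c Y τ) τ → wp v N A (fun τ =>
        ((τ.nat 26 0 0 = 0 ∧ IsMove v ε c Y σ τ) ∨ (τ.nat 26 0 0 = 1 ∧ IsFinal v ε c Y τ))) τ := by
    intro A τ h1 h2 h3 h4 h5
    refine wp_frame h5 fun ρ h6 _ h7 => .inl ⟨by rw [h6 26 h1, h2], ?_⟩
    unfold IsMove at h7 ⊢
    rwa [h3, h4] at h7
  refine wp_seq (wp_findEnvier hn0 hn (by decide) (by decide) (fun k hk => ?_) fun hk => ?_)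
  · have hX : (σ.updateNat 23 0 0 k).output n m = σ.output n m :=
      Store.output_congr (Store.updateNat_nat_ne _ _ _ _ (by decide))
    have hB : (σ.updateNat 23 0 0 k).row m 2 0 = σ.row m 2 0 :=
      Store.row_updateNat_ne _ _ _ _ _ _ (by decide)
    refine wp_ite (fun _ => hmove (by decide) (by simpa using hd) hX hB ?_)
      fun hb => absurd k.2 (by simp [hn0] at hb)
    refine wp_swapBag (by simpa using hn0) (by simpa using hm0) hm (by rwa [hX, hB]) k (by simp) ?_
    rw [hX, hB]
    exact hk
  · simp only [NExp.eval] at hk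
    refine wp_ite (fun hb => absurd hb (by simp [hn0])) fun _ => wp_seq ?_
    refine wp_markUsed (by simpa using hn0) (by simpa using hm0) hn hm ?_
    rintro τ h1 hτr h2
    have hτ : ∀ c, c ∉ [4, 20, 21, 23] → τ.nat c = σ.nat c := fun c hc => by
      rw [h1 c fun h => hc (by simp at h ⊢; tauto),
        Store.updateNat_nat_ne _ _ _ _ fun h => hc (by simp [h])]
    have h2' : ∀ g, g ∉ τ.row m 4 0 ↔ g ∈ unallocated (σ.output n m) ∧ g ∉ σ.row m 2 0 := by
      intro g
      rw [h2 g]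
      simp
      exact fun _ => Iff.rfl
    refine wp_seq (wp_find m (fun k => τ.nat 4 0 k = 0) (by decide) (by simp [hτ, hm0]) hm
      (fun k => by simp) fun k hk' h3 h4 => ?_)
    have hX : (τ.updateNat 21 0 0 k).output n m = σ.output n m :=
      Store.output_congr ((Store.updateNat_nat_ne _ _ _ _ (by decide)).trans (hτ 1 (by decide)))
    have hB : (τ.updateNat 21 0 0 k).row m 2 0 = σ.row m 2 0 :=
      Store.row_congr ((Store.updateNat_nat_ne _ _ _ _ (by decide)).trans (hτ 2 (by decide))) _ _
    refine wp_ite (fun hb => hmove (by decide) (by simp [hτ, hd]) hX hB ?_) fun hb => ?_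
    · simp [hτ, hm0] at hb
      have h5 : (⟨k, hb⟩ : Fin m) ∉ τ.row m 4 0 := fun h => Store.mem_row.1 h (h4 hb)
      obtain ⟨h6, h7⟩ := (h2' _).1 h5
      exact wp_growBag hv hε (by simp [hτ, hn0]) (by simp [hτ, hm0]) (by simpa [hτr] using hε0) hn hm
        (by rwa [hX, hB]) (by rwa [hX, hB]) ⟨k, hb⟩ (by simp) (by rwa [hX]) (by rwa [hB])
    · simp [hτ, hm0] at hb
      have hR : unallocated (σ.output n m) ⊆ σ.row m 2 0 := by
        intro g hg
        by_contra hgB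
        have h5 := (h2' g).2 ⟨hg, hgB⟩
        exact h3 g (by have := g.2; omega) (by simpa [Store.mem_row] using h5)
      refine wp_seq (wp_listBag (by simp [hτ, hm0]) hm ?_)
      rw [hB]
      rintro ρ h5 hρr h6 h7 h8
      have hρ : ∀ c, c ∉ [4, 5, 20, 21, 23, 25] → ρ.nat c = σ.nat c := fun c hc => by
        rw [h5 c fun h => hc (by simp at h ⊢; tauto),
          Store.updateNat_nat_ne _ _ _ _ fun h => hc (by simp [h]),
          hτ c fun h => hc (by simp at h ⊢; tauto)]
      have hX' : ρ.output n m = σ.output n m := Store.output_congr (hρ 1 (by decide))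
      have hB' : ρ.row m 2 0 = σ.row m 2 0 := Store.row_congr (hρ 2 (by decide)) _ _
      have hcond : (if c then BExp.natLT (.lit 0) (.var 25)
          else .not (.natLT (.var 25) .agents)).Holds v ρ ↔
          if c then 0 < (σ.row m 2 0).card else n ≤ (σ.row m 2 0).card := by
        cases c
        · simp [h6, hρ, hn0]
        · simp [h6]
      refine wp_ite (fun hb' => hmove (by decide) (by simp [hρ, hd]) hX' hB' ?_) fun hb' => ?_
      · rw [hcond] at hb'
        refine wp_distribute hv hε hpos (by simp [hρ, hn0]) (by simp [hρ, hm0])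
          (by rw [hρr, Store.updateNat_real, hτr]; exact hε0) hn hm ?_ ?_ ?_ ?_ ?_ ?_ ?_ <;>
          simp only [hX', hB'] <;> assumption
      · rw [hcond] at hb'
        refine wp_setNat (.inr ⟨by simp, ?_⟩)
        have hX'' : (ρ.updateNat 26 0 0 1).output n m = σ.output n m :=
          Store.output_congr ((Store.updateNat_nat_ne _ _ _ _ (by decide)).trans (hρ 1 (by decide)))
        simp only [NExp.eval]
        rw [IsFinal, hX'']
        refine ⟨h.isAlphaCEFX hv hk hR ?_ fun hc => ?_, h.dominates⟩
        · cases c <;> simp at hb'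
          · exact hb'
          · rw [hb']
            simpa using hpos
        · subst hc
          simpa using hb'

/-- The levels contribute at most `N ^ 5` and the weight of a level at most `N ^ 4`. Strictness
leaves room for the additional `1` in the variant of the main loop. -/
theorem potential_lt_pow {X : Fin n → Finset (Fin m)} {B : Finset (Fin m)}
    (hN : n + m + ⌈1 / ε⌉₊ + 5 ≤ N) : potential v ε X B < N ^ 10 := by
  refine (potential_le v ε X B).trans_lt ?_
  have h1 : levelBound m ε + 1 ≤ N * N := by
    have : m * ⌈1 / ε⌉₊ ≤ (N - 1) * (N - 1) := Nat.mul_le_mul (by omega) (by omega)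
    have h2 : (N - 1) * (N - 1) + 1 ≤ N * N := by
      obtain ⟨k, rfl⟩ : ∃ k, N = k + 1 := ⟨N - 1, by omega⟩
      simp only [Nat.add_sub_cancel]
      nlinarith
    unfold levelBound
    omega
  have h3 : n * (m * (levelBound m ε + 1)) + 1 ≤ N ^ 5 := by
    have h4 : n * (m * (levelBound m ε + 1)) ≤ N * (N * (N * N)) := by
      gcongr <;> omega
    have h5 : 1 ≤ N ^ 4 := Nat.one_le_pow _ _ (by omega)
    have h6 : 2 * N ^ 4 ≤ N * N ^ 4 := Nat.mul_le_mul_right _ (by omega)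
    calc _ ≤ N * (N * (N * N)) + 1 := by omega
      _ = N ^ 4 + 1 := by ring
      _ ≤ N * N ^ 4 := by omega
      _ = N ^ 5 := by ring
  have h4 : 2 * m + 2 ≤ N * N := by nlinarith
  have h5 : n * (n + 1) + 1 ≤ N * N := by nlinarith
  calc _ ≤ N ^ 5 * ((N * N) * (N * N)) := by gcongr
    _ = N ^ 9 := by ring
    _ < N ^ 10 := Nat.pow_lt_pow_right (by omega) (by omega)

theorem wp_mainLoop (hv : ∀ i, IsSubadditiveValuation (v i)) (hε : 0 < ε) (hpos : 0 < n)
    (hn0 : σ.nat 0 0 0 = n) (hm0 : σ.nat 0 0 1 = m) (hε0 : σ.real 0 0 0 = ε)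
    (hN : n + m + ⌈1 / ε⌉₊ + 5 ≤ N)
    (h : FairState v ε c Y (σ.output n m) (σ.row m 2 0)) (hd : σ.nat 26 0 0 = 0) :
    wp v N (mainLoop c) (IsFinal v ε c Y) σ := by
  refine wp_loop (fun τ => (τ.nat 0 = σ.nat 0 ∧ τ.real = σ.real) ∧
      ((τ.nat 26 0 0 = 0 ∧ FairState v ε c Y (τ.output n m) (τ.row m 2 0)) ∨
        (τ.nat 26 0 0 = 1 ∧ IsFinal v ε c Y τ)))
    -- The added `1` makes the variant fall also in the last step, which only sets the flag.
    (fun τ => if τ.nat 26 0 0 = 0 then potential v ε (τ.output n m) (τ.row m 2 0) + 1 else 0)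
    ⟨⟨rfl, rfl⟩, .inl ⟨hd, h⟩⟩ ?_ ?_ ?_
  · have := potential_lt_pow (v := v) (X := σ.output n m) (B := σ.row m 2 0) hN
    simp only [hd, if_true]
    omega
  · rintro τ ⟨⟨h1, h2⟩, h3⟩ hb
    simp at hb
    rcases h3 with ⟨h3, h4⟩ | ⟨h3, -⟩
    · refine wp_mono (wp_mainStep hv hε hpos (by rw [h1, hn0]) (by rw [h1, hm0]) (by rw [h2, hε0])
        (by omega) (by omega) h4 h3) ?_
      rintro ρ ⟨⟨h5, h6⟩, ⟨h7, h8, h9⟩ | ⟨h7, h8⟩⟩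
      · exact ⟨⟨⟨h5.trans h1, h6.trans h2⟩, .inl ⟨h7, h8⟩⟩, by simp [h3, h7, h9]⟩
      · exact ⟨⟨⟨h5.trans h1, h6.trans h2⟩, .inr ⟨h7, h8⟩⟩, by simp [h3, h7]⟩
    · omega
  · rintro τ ⟨-, ⟨h3, -⟩ | ⟨-, h3⟩⟩ hb
    · simp [h3] at hb
    · exact h3

end Specs

/-! The primal-dual method for assignment problems: rows are agents, columns below `M` are goods. -/

section Assignment

/-- Dual feasible `u`, `w` and a complementary matching `ma` of the rows below `i₀`. -/
structure IsDualMatching (n M : ℕ) (c : ℕ → ℕ → ℝ) (i₀ : ℕ) (u w : ℕ → ℝ) (ma : ℕ → ℕ) :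
    Prop where
  feasible : ∀ i < n, ∀ g < M, u i + w g ≤ c i g
  nonpos : ∀ g < M, w g ≤ 0
  lt : ∀ i < i₀, ma i < M
  tight : ∀ i < i₀, u i + w (ma i) = c i (ma i)
  inj : ∀ i < i₀, ∀ j < i₀, ma i = ma j → i = j
  matched : ∀ g < M, w g ≠ 0 → ∃ i < i₀, ma i = g

/-- The columns with labels `s g ≠ 0` form a tree of tight edges with root `i₀`, where `par g` is
the row from which column `g` has been reached. -/
structure IsAlternatingTree (M : ℕ) (c : ℕ → ℕ → ℝ) (i₀ : ℕ) (u w : ℕ → ℝ) (ma par s : ℕ → ℕ)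
    (q : ℕ) : Prop where
  label_le : ∀ g < M, s g ≠ 0 → s g ≤ q
  par_le : ∀ g < M, s g ≠ 0 → par g ≤ i₀
  tight : ∀ g < M, s g ≠ 0 → u (par g) + w g = c (par g) g
  parent : ∀ g < M, s g ≠ 0 → par g < i₀ → s (ma (par g)) ≠ 0 ∧ s (ma (par g)) < s g

variable {n M : ℕ} {c : ℕ → ℕ → ℝ} {i₀ : ℕ} {u w u' w' : ℕ → ℝ} {ma par s : ℕ → ℕ} {q : ℕ}

/-- Weak duality with complementary slackness. Unmatched columns have dual value zero, so the dual
values of the matched columns add up to those of all columns; as none is positive, this total is at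
most the sum over the columns of `μ`. Tightness on one side and feasibility on the other do the
rest. -/
theorem IsDualMatching.sum_le (h : IsDualMatching n M c n u w ma) {μ : Fin n → ℕ}
    (hμ : μ.Injective) (hμM : ∀ i, μ i < M) :
    ∑ i : Fin n, c i (ma i) ≤ ∑ i : Fin n, c i (μ i) := by
  have hma : Function.Injective fun i : Fin n => ma i := fun i j hij =>
    Fin.ext (h.inj i i.2 j j.2 hij)
  have h1 : ∑ i : Fin n, w (ma i) = ∑ g ∈ Finset.range M, w g := by
    rw [← Finset.sum_image (s := Finset.univ) (g := fun i : Fin n => ma i) (f := w)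
      fun i _ j _ hij => hma hij]
    refine Finset.sum_subset (fun g hg => ?_) fun g hg hg' => ?_
    · obtain ⟨i, -, rfl⟩ := Finset.mem_image.1 hg
      exact Finset.mem_range.2 (h.lt i i.2)
    · by_contra hw
      obtain ⟨i, hi, rfl⟩ := h.matched g (Finset.mem_range.1 hg) hw
      exact hg' (Finset.mem_image.2 ⟨⟨i, hi⟩, Finset.mem_univ _, rfl⟩)
  have h2 : ∑ g ∈ Finset.range M, w g ≤ ∑ i : Fin n, w (μ i) := by
    rw [← Finset.sum_image (s := Finset.univ) (g := μ) (f := w) fun i _ j _ hij => hμ hij]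
    rw [← neg_le_neg_iff, ← Finset.sum_neg_distrib, ← Finset.sum_neg_distrib]
    refine Finset.sum_le_sum_of_subset_of_nonneg (fun g hg => ?_) fun g hg _ => ?_
    · obtain ⟨i, -, rfl⟩ := Finset.mem_image.1 hg
      exact Finset.mem_range.2 (hμM i)
    · have := h.nonpos g (Finset.mem_range.1 hg)
      linarith
  calc ∑ i : Fin n, c i (ma i) = ∑ i : Fin n, u i + ∑ i : Fin n, w (ma i) := by
        rw [← Finset.sum_add_distrib]
        exact Finset.sum_congr rfl fun i _ => (h.tight i i.2).symm
    _ ≤ ∑ i : Fin n, u i + ∑ i : Fin n, w (μ i) := by rw [h1]; linarith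
    _ ≤ ∑ i : Fin n, c i (μ i) := by
        rw [← Finset.sum_add_distrib]
        exact Finset.sum_le_sum fun i _ => h.feasible i i.2 _ (hμM i)

/-- The rows reached by the tree. -/
def Reached (i₀ : ℕ) (ma s : ℕ → ℕ) (i : ℕ) : Prop := i ≤ i₀ ∧ ¬ (i < i₀ ∧ s (ma i) = 0)

/-- The change of the dual variables by the slack `δ` of a reached row and an unlabelled column. -/
theorem IsDualMatching.update (h : IsDualMatching n M c i₀ u w ma) {δ : ℝ} (hδ : 0 ≤ δ)
    (hmin : ∀ i g, Reached i₀ ma s i → g < M → s g = 0 → δ ≤ c i g - u i - w g)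
    (hT : ∀ g < M, s g ≠ 0 → ∃ i < i₀, ma i = g)
    (hu1 : ∀ i, Reached i₀ ma s i → u' i = u i + δ) (hu2 : ∀ i, ¬ Reached i₀ ma s i → u' i = u i)
    (hw1 : ∀ g < M, s g ≠ 0 → w' g = w g - δ) (hw2 : ∀ g < M, s g = 0 → w' g = w g) :
    IsDualMatching n M c i₀ u' w' ma := by
  refine ⟨fun i hi g hg => ?_, fun g hg => ?_, h.lt, fun i hi => ?_, h.inj, fun g hg hg' => ?_⟩
  · have hf := h.feasible i hi g hg
    by_cases h1 : Reached i₀ ma s i <;> by_cases h2 : s g = 0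
    · have := hmin i g h1 hg h2
      rw [hu1 i h1, hw2 g hg h2]
      linarith
    · rw [hu1 i h1, hw1 g hg h2]
      linarith
    · rw [hu2 i h1, hw2 g hg h2]
      linarith
    · rw [hu2 i h1, hw1 g hg h2]
      linarith
  · have := h.nonpos g hg
    by_cases h2 : s g = 0
    · rwa [hw2 g hg h2]
    · rw [hw1 g hg h2]
      linarith
  · have ht := h.tight i hi
    by_cases h2 : s (ma i) = 0
    · rw [hu2 i fun h1 => h1.2 ⟨hi, h2⟩, hw2 _ (h.lt i hi) h2, ht]
    · rw [hu1 i ⟨hi.le, fun h1 => h2 h1.2⟩, hw1 _ (h.lt i hi) h2]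
      linarith
  -- Only labelled columns change their dual value, and all of them are matched, so complementary
  -- slackness persists.
  · by_cases h2 : s g = 0
    · rw [hw2 g hg h2] at hg'
      exact h.matched g hg hg'
    · exact hT g hg h2

theorem IsAlternatingTree.reached (h : IsAlternatingTree M c i₀ u w ma par s q) {g : ℕ} (hg : g < M)
    (hs : s g ≠ 0) : Reached i₀ ma s (par g) :=
  ⟨h.par_le g hg hs, fun h1 => (h.parent g hg hs h1.1).1 h1.2⟩

/-- The tree grows by a column `g₀` reached from row `i₁`. -/
theorem IsAlternatingTree.grow (h : IsAlternatingTree M c i₀ u w ma par s q) {δ : ℝ} {i₁ g₀ : ℕ}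
    (hlt : ∀ i < i₀, ma i < M)
    (hi₁ : Reached i₀ ma s i₁) (hg₀ : g₀ < M) (hsg : s g₀ = 0) (hδ : δ = c i₁ g₀ - u i₁ - w g₀)
    (hu1 : ∀ i, Reached i₀ ma s i → u' i = u i + δ)
    (hw1 : ∀ g < M, s g ≠ 0 → w' g = w g - δ) (hw2 : ∀ g < M, s g = 0 → w' g = w g) :
    IsAlternatingTree M c i₀ u' w' ma (Function.update par g₀ i₁) (Function.update s g₀ (q + 1))
      (q + 1) := by
  have hq : ∀ g < M, s g ≠ 0 → g ≠ g₀ := fun g _ hs h1 => hs (h1 ▸ hsg)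
  have key : ∀ g < M, Function.update s g₀ (q + 1) g ≠ 0 → g = g₀ ∨ (g ≠ g₀ ∧ s g ≠ 0) := by
    intro g _ hs
    by_cases h1 : g = g₀
    · exact .inl h1
    · rw [Function.update_of_ne h1] at hs
      exact .inr ⟨h1, hs⟩
  refine ⟨fun g hg hs => ?_, fun g hg hs => ?_, fun g hg hs => ?_, fun g hg hs => ?_⟩
  · rcases key g hg hs with rfl | ⟨h1, h2⟩
    · simp
    · rw [Function.update_of_ne h1]
      exact (h.label_le g hg h2).trans (by omega)
  · rcases key g hg hs with rfl | ⟨h1, h2⟩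
    · simpa using hi₁.1
    · rw [Function.update_of_ne h1]
      exact h.par_le g hg h2
  · rcases key g hg hs with rfl | ⟨h1, h2⟩
    · rw [Function.update_self, hu1 _ hi₁, hw2 g hg hsg, hδ]
      ring
    · rw [Function.update_of_ne h1, hu1 _ (h.reached hg h2), hw1 g hg h2]
      linarith [h.tight g hg h2]
  · have hne : ∀ i < i₀, s (ma i) ≠ 0 → Function.update s g₀ (q + 1) (ma i) = s (ma i) :=
      fun i hi hs => Function.update_of_ne (hq _ (hlt i hi) hs) _ _
    rcases key g hg hs with rfl | ⟨h1, h2⟩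
    · simp only [Function.update_self]
      intro hi
      have h3 : s (ma i₁) ≠ 0 := fun h3 => hi₁.2 ⟨hi, h3⟩
      rw [hne i₁ hi h3]
      exact ⟨h3, Nat.lt_succ_of_le (h.label_le _ (hlt _ hi) h3)⟩
    · rw [Function.update_of_ne h1, Function.update_of_ne h1]
      intro hi
      have h3 := h.parent g hg h2 hi
      rwa [hne _ hi h3.1]

/-- If every labelled column is matched to one of fewer than `M` rows, some column is not
labelled. -/
theorem exists_unlabelled (hi : i₀ < M) (hT : ∀ g < M, s g ≠ 0 → ∃ i < i₀, ma i = g) :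
    ∃ g < M, s g = 0 := by
  by_contra hcon
  push Not at hcon
  have hsub : Finset.range M ⊆ (Finset.range i₀).image ma := by
    intro g hg
    obtain ⟨i, h1, h2⟩ := hT g (Finset.mem_range.1 hg) (hcon g (Finset.mem_range.1 hg))
    exact Finset.mem_image.2 ⟨i, Finset.mem_range.2 h1, h2⟩
  have h1 := (Finset.card_le_card hsub).trans Finset.card_image_le
  simp only [Finset.card_range] at h1
  omega

/-- The state of the augmentation: column `g` is the end of the remaining path to the root, and
not matched. -/
structure IsAugmenting (n M : ℕ) (c : ℕ → ℕ → ℝ) (i₀ : ℕ) (u w : ℕ → ℝ) (ma par s : ℕ → ℕ)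
    (g : ℕ) : Prop where
  feasible : ∀ i < n, ∀ g < M, u i + w g ≤ c i g
  nonpos : ∀ g < M, w g ≤ 0
  lt : ∀ i < i₀, ma i < M
  tight : ∀ i < i₀, u i + w (ma i) = c i (ma i)
  inj : ∀ i < i₀, ∀ j < i₀, ma i = ma j → i = j
  matched : ∀ h < M, w h ≠ 0 → h = g ∨ ∃ i < i₀, ma i = h
  free : ∀ i < i₀, ma i ≠ g
  end_lt : g < M
  label : s g ≠ 0
  par_le : ∀ h < M, s h ≠ 0 → par h ≤ i₀
  par_tight : ∀ h < M, s h ≠ 0 → u (par h) + w h = c (par h) h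
  parent : ∀ h < M, s h ≠ 0 → s h ≤ s g → par h < i₀ → s (ma (par h)) ≠ 0 ∧ s (ma (par h)) < s h

theorem IsDualMatching.augmenting (h : IsDualMatching n M c i₀ u w ma)
    (h' : IsAlternatingTree M c i₀ u w ma par s q) {g : ℕ} (hg : g < M) (hs : s g ≠ 0)
    (hfree : ∀ i < i₀, ma i ≠ g) : IsAugmenting n M c i₀ u w ma par s g :=
  ⟨h.feasible, h.nonpos, h.lt, h.tight, h.inj, fun x hx hw => .inr (h.matched x hx hw), hfree, hg,
    hs, h'.par_le, h'.tight, fun x hx hs _ => h'.parent x hx hs⟩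

/-- Row `par g` exchanges its column for the tight column `g`, and its old column becomes the free
end. The parent property survives for labels up to that of the new end: such a column cannot have
parent `par g`, because its label would have to exceed that of the new end. -/
theorem IsAugmenting.step {g : ℕ} (h : IsAugmenting n M c i₀ u w ma par s g) (hp : par g < i₀) :
    IsAugmenting n M c i₀ u w (Function.update ma (par g) g) par s (ma (par g)) ∧
      s (ma (par g)) < s g := by
  have hpar := h.parent g h.end_lt h.label le_rfl hp
  refine ⟨⟨h.feasible, h.nonpos, fun i hi => ?_, fun i hi => ?_, fun i hi j hj hij => ?_,
    fun x hx hw => ?_, fun i hi => ?_, h.lt _ hp, hpar.1, h.par_le, h.par_tight,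
    fun x hx hs hle hpx => ?_⟩, hpar.2⟩
  · by_cases h1 : i = par g
    · rw [h1, Function.update_self]
      exact h.end_lt
    · rw [Function.update_of_ne h1]
      exact h.lt i hi
  · by_cases h1 : i = par g
    · rw [h1, Function.update_self]
      exact h.par_tight g h.end_lt h.label
    · rw [Function.update_of_ne h1]
      exact h.tight i hi
  · by_cases h1 : i = par g <;> by_cases h2 : j = par g
    · rw [h1, h2]
    · rw [h1, Function.update_self, Function.update_of_ne h2] at hij
      exact absurd hij.symm (h.free j hj)
    · rw [h2, Function.update_self, Function.update_of_ne h1] at hij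
      exact absurd hij (h.free i hi)
    · rw [Function.update_of_ne h1, Function.update_of_ne h2] at hij
      exact h.inj i hi j hj hij
  · rcases h.matched x hx hw with rfl | ⟨i, hi, h2⟩
    · exact .inr ⟨par x, hp, by simp⟩
    · by_cases h1 : i = par g
      · exact .inl (by rw [← h2, h1])
      · exact .inr ⟨i, hi, by rw [Function.update_of_ne h1, h2]⟩
  · by_cases h1 : i = par g
    · rw [h1, Function.update_self]
      exact (h.free _ hp).symm
    · rw [Function.update_of_ne h1]
      exact fun h2 => h1 (h.inj i hi _ hp h2)
  · have h2 := h.parent x hx hs (hle.trans hpar.2.le) hpx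
    have h1 : par x ≠ par g := by
      intro h1
      rw [h1] at h2
      omega
    rwa [Function.update_of_ne h1]

/-- The path has arrived at its root `i₀`, the one row that had no column to give up. -/
theorem IsAugmenting.finish {g : ℕ} (h : IsAugmenting n M c i₀ u w ma par s g)
    (hp : ¬ par g < i₀) :
    IsDualMatching n M c (i₀ + 1) u w (Function.update ma (par g) g) := by
  have hp' : par g = i₀ := le_antisymm (h.par_le g h.end_lt h.label) (not_lt.1 hp)
  rw [hp']
  have hne : ∀ i < i₀, Function.update ma i₀ g i = ma i := fun i hi =>
    Function.update_of_ne hi.ne _ _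
  refine ⟨h.feasible, h.nonpos, fun i hi => ?_, fun i hi => ?_, fun i hi j hj hij => ?_,
    fun x hx hw => ?_⟩
  · rcases Nat.lt_succ_iff_lt_or_eq.1 hi with h1 | rfl
    · rw [hne i h1]
      exact h.lt i h1
    · rw [Function.update_self]
      exact h.end_lt
  · rcases Nat.lt_succ_iff_lt_or_eq.1 hi with h1 | rfl
    · rw [hne i h1]
      exact h.tight i h1
    · rw [Function.update_self]
      have := h.par_tight g h.end_lt h.label
      rwa [hp'] at this
  · rcases Nat.lt_succ_iff_lt_or_eq.1 hi with h1 | rfl <;>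
      rcases Nat.lt_succ_iff_lt_or_eq.1 hj with h2 | rfl
    · rw [hne i h1, hne j h2] at hij
      exact h.inj i h1 j h2 hij
    · rw [hne i h1, Function.update_self] at hij
      exact absurd hij (h.free i h1)
    · rw [hne j h2, Function.update_self] at hij
      exact absurd hij.symm (h.free j h2)
    · rfl
  · rcases h.matched x hx hw with rfl | ⟨i, hi, h2⟩
    · exact ⟨i₀, by omega, by simp⟩
    · exact ⟨i, by omega, by rw [hne i hi, h2]⟩

end Assignment

/-! ### The primal-dual method as a program -/

/-- The number of columns of the assignment problem. -/
abbrev NExp.columns : NExp := .add .agents .goods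

/-- The slack of row `i` and column `g`. -/
def RExp.slack (i g : NExp) : RExp :=
  .sub (.sub (.get 1 i g) (.get 2 (.lit 0) i)) (.get 3 (.lit 0) g)

/-- Row `var 20` is reached by the tree. -/
def BExp.reached : BExp :=
  .not (.and (.natLT (.var 20) (.var 31))
    (.not (.natLT (.lit 0) (.get 10 (.lit 0) (.get 9 (.lit 0) (.var 20))))))

namespace BProgram

/-- Finds a reached row, variable `33`, and an unlabelled column, variable `34`, of least slack. -/
def minEdge : BProgram :=
  .seq (assign 33 .agents) (forLoop 20 (.add (.var 31) (.lit 1)) (.ite .reached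
    (forLoop 21 .columns (.ite (.and (.not (.natLT (.lit 0) (.get 10 (.lit 0) (.var 21))))
        (.not (.and (.natLT (.var 33) .agents)
          (.not (.realLT (.slack (.var 20) (.var 21)) (.slack (.var 33) (.var 34)))))))
      (.seq (assign 33 (.var 20)) (assign 34 (.var 21))) .skip)) .skip))

/-- Updates the dual variables. -/
def dualUpdate : BProgram :=
  .seq (.setReal 6 (.lit 0) (.lit 0) (.slack (.var 33) (.var 34)))
    (.seq (forLoop 20 (.add (.var 31) (.lit 1)) (.ite .reached
        (.setReal 2 (.lit 0) (.var 20)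
          (.add (.get 2 (.lit 0) (.var 20)) (.get 6 (.lit 0) (.lit 0)))) .skip))
      (forLoop 21 .columns (.ite (.natLT (.lit 0) (.get 10 (.lit 0) (.var 21)))
        (.setReal 3 (.lit 0) (.var 21)
          (.sub (.get 3 (.lit 0) (.var 21)) (.get 6 (.lit 0) (.lit 0)))) .skip)))

/-- Labels column `var 34`; variable `32` becomes `1` if it is not matched. -/
def growTree : BProgram :=
  .seq (assign 35 (.add (.var 35) (.lit 1))) (.seq (.setNat 11 (.lit 0) (.var 34) (.var 33))
    (.seq (.setNat 10 (.lit 0) (.var 34) (.var 35))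
      (.seq (find 23 (.var 31)
        (.and (.not (.natLT (.get 9 (.lit 0) (.var 23)) (.var 34)))
          (.not (.natLT (.var 34) (.get 9 (.lit 0) (.var 23))))))
        (.ite (.natLT (.var 23) (.var 31)) .skip (assign 32 (.lit 1))))))

/-- One step along the augmenting path. -/
def augmentStep : BProgram :=
  .seq (assign 33 (.get 11 (.lit 0) (.var 34))) (.seq (assign 36 (.get 9 (.lit 0) (.var 33)))
    (.seq (.setNat 9 (.lit 0) (.var 33) (.var 34))
      (.ite (.natLT (.var 33) (.var 31)) (assign 34 (.var 36)) (assign 32 (.lit 2)))))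

/-- Matches row `var 31`. -/
def matchRow : BProgram :=
  .seq (forLoop 21 .columns (.setNat 10 (.lit 0) (.var 21) (.lit 0)))
    (.seq (assign 35 (.lit 0)) (.seq (assign 32 (.lit 0))
      (.seq (.loop 1 (.natLT (.var 32) (.lit 1)) (.seq minEdge (.seq dualUpdate growTree)))
        (.loop 1 (.natLT (.var 32) (.lit 2)) augmentStep))))

/-- Computes a matching of the rows of minimum cost in array `9`. -/
def assignment : BProgram := forLoop 31 .agents matchRow

end BProgram

section Specs

variable {n m : ℕ} {v : Fin n → Finset (Fin m) → ℝ} {N : ℕ} {Q Q' : Store → Prop} {σ : Store}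
  {i₀ : ℕ}

theorem Store.nat_updateNat_row (σ : Store) (a r k x : ℕ) :
    (σ.updateNat a r k x).nat a r = Function.update (σ.nat a r) k x := by
  funext j
  rw [Store.updateNat_nat_same, Function.update_apply]
  simp

@[simp] theorem RExp.eval_slack (i g : NExp) : (RExp.slack i g).eval v σ =
    σ.real 1 (i.eval σ) (g.eval σ) - σ.real 2 0 (i.eval σ) - σ.real 3 0 (g.eval σ) := rfl

theorem BExp.holds_reached : BExp.reached.Holds v σ ↔
    ¬ (σ.nat 20 0 0 < σ.nat 31 0 0 ∧ σ.nat 10 0 (σ.nat 9 0 (σ.nat 20 0 0)) = 0) := by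
  simp [BExp.reached]

/-- The frame rule with given lists of arrays. -/
theorem wp_frame_lists {A : BProgram} (L L' : List ℕ) (h : wp v N A Q σ)
    (hL : ∀ c ∈ A.natWrites, c ∈ L) (hR : ∀ c ∈ A.realWrites, c ∈ L')
    (hQ : ∀ τ : Store, (∀ c, c ∉ L → τ.nat c = σ.nat c) → (∀ c, c ∉ L' → τ.real c = σ.real c) →
      Q τ → Q' τ) : wp v N A Q' σ :=
  wp_frame h fun τ h1 h2 h3 => hQ τ (fun c hc => h1 c fun h => hc (hL c h))
    (fun c hc => h2 c fun h => hc (hR c h)) h3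

theorem wp_minEdge (hn0 : σ.nat 0 0 0 = n) (hm0 : σ.nat 0 0 1 = m) (hi₀ : σ.nat 31 0 0 = i₀)
    (hi₀n : i₀ < n) (hN : n + m ≤ N)
    (hex : ∃ i g, Reached i₀ (σ.nat 9 0) (σ.nat 10 0) i ∧ g < n + m ∧ σ.nat 10 0 g = 0)
    (hQ : ∀ τ : Store, (∀ c, c ∉ [20, 21, 33, 34] → τ.nat c = σ.nat c) → τ.real = σ.real →
      Reached i₀ (σ.nat 9 0) (σ.nat 10 0) (τ.nat 33 0 0) → τ.nat 34 0 0 < n + m →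
      σ.nat 10 0 (τ.nat 34 0 0) = 0 →
      (∀ i g, Reached i₀ (σ.nat 9 0) (σ.nat 10 0) i → g < n + m → σ.nat 10 0 g = 0 →
        σ.real 1 (τ.nat 33 0 0) (τ.nat 34 0 0) - σ.real 2 0 (τ.nat 33 0 0) -
            σ.real 3 0 (τ.nat 34 0 0) ≤
          σ.real 1 i g - σ.real 2 0 i - σ.real 3 0 g) → Q τ) :
    wp v N minEdge Q σ := by
  set S := Reached i₀ (σ.nat 9 0) (σ.nat 10 0) with hS
  set sl : ℕ → ℕ → ℝ := fun i g => σ.real 1 i g - σ.real 2 0 i - σ.real 3 0 g with hsl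
  -- The value `bi = n` stands for the absence of a candidate; this is why `bi < n` is part of what
  -- a scanned edge guarantees.
  let P : ℕ → ℕ → ℕ → ℕ → Prop := fun k j bi bg =>
    (∀ i g, (i < k ∨ (i = k ∧ g < j)) → S i → g < n + m → σ.nat 10 0 g = 0 →
      bi < n ∧ sl bi bg ≤ sl i g) ∧ (bi < n → S bi ∧ bg < n + m ∧ σ.nat 10 0 bg = 0)
  have hP : ∀ {k j bi bg}, P k j bi bg → (S k → j < n + m → σ.nat 10 0 j = 0 →
      bi < n ∧ sl bi bg ≤ sl k j) → P k (j + 1) bi bg := by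
    intro k j bi bg h1 h2
    refine ⟨fun i g hig hi hg hsg => ?_, h1.2⟩
    by_cases h3 : i = k ∧ g = j
    · obtain ⟨rfl, rfl⟩ := h3
      exact h2 hi hg hsg
    · exact h1.1 i g (by omega) hi hg hsg
  refine wp_frame_list (Q := fun τ => P (i₀ + 1) 0 (τ.nat 33 0 0) (τ.nat 34 0 0)) [20, 21, 33, 34]
    ?_ (by decide) rfl ?_
  swap
  · rintro τ h1 h2 ⟨h3, h4⟩
    obtain ⟨i, g, hi, hg, hsg⟩ := hex
    obtain ⟨h5, h6, h7⟩ := h4 (h3 i g (.inl (by have := hi.1; omega)) hi hg hsg).1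
    exact hQ τ h1 h2 h5 h6 h7 fun i g hi hg hsg =>
      (h3 i g (.inl (by have := hi.1; omega)) hi hg hsg).2
  refine wp_seq (wp_setNat ?_)
  refine wp_for (i₀ + 1) (fun k τ => P k 0 (τ.nat 33 0 0) (τ.nat 34 0 0)) (by decide) (by decide)
    (by simp [hi₀]) (by omega) ?_ ?_ ?_
  · refine ⟨fun i g h => by omega, ?_⟩
    simp [hn0]
  · rintro k τ hk hxk hfr hfr' h1
    have hτ : ∀ c, c ∉ [20, 21, 33, 34] → τ.nat c = σ.nat c := fun c hc => by
      rw [hfr c (fun h => hc (by revert h; simp [natWrites, forLoop]; tauto))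
        (fun h => hc (by simp [h])), Store.updateNat_nat_ne _ _ _ _ fun h => hc (by simp [h])]
    refine wp_ite (fun hb => ?_) fun hb => wp_skip ?_
    · rw [BExp.holds_reached] at hb
      simp only [hxk, hτ 31 (by decide), hτ 10 (by decide), hτ 9 (by decide), hi₀] at hb
      have hSk : S k := ⟨by omega, hb⟩
      refine wp_for (n + m) (fun j τ => P k j (τ.nat 33 0 0) (τ.nat 34 0 0)) (by decide)
        (by decide) (by simp [hτ, hn0, hm0]) hN ?_ ?_ ?_
      · simpa using h1
      · rintro j ρ hj hxj hgr hgr' h2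
        have hρ : ∀ c, c ∉ [20, 21, 33, 34] → ρ.nat c = σ.nat c := fun c hc => by
          rw [hgr c (fun h => hc (by revert h; simp [natWrites]; tauto))
            (fun h => hc (by simp [h])), hτ c hc]
        have hρ20 : ρ.nat 20 0 0 = k := by rw [hgr 20 (by decide) (by decide), hxk]
        have hreal : ρ.real = σ.real := by
          funext c
          rw [hgr' c (by simp [realWrites]), hfr' c (by simp [realWrites, forLoop])]
          rfl
        refine wp_ite (fun hb' => wp_seq (wp_setNat (wp_setNat ?_))) fun hb' => wp_skip ?_
        · simp [hρ, hρ20, hxj, hreal, hn0] at hb'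
          simp only [NExp.eval, hρ20]
          simp only [Store.updateNat_nat_ne _ _ _ _ (show 21 ≠ 33 by decide), hxj,
            Store.updateNat_nat_ne _ _ _ _ (show 34 ≠ 21 by decide),
            Store.updateNat_nat_ne _ _ _ _ (show 33 ≠ 21 by decide),
            Store.updateNat_nat_ne _ _ _ _ (show 33 ≠ 34 by decide), Store.updateNat_nat_self]
          have h3 : P k j k j := by
            refine ⟨fun i g hig hi hg hsg => ?_, fun _ => ⟨hSk, hj, hb'.1⟩⟩
            obtain ⟨h4, h5⟩ := h2.1 i g hig hi hg hsg
            have h6 := hb'.2 h4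
            exact ⟨by omega, by simp only [hsl] at h5 ⊢; linarith⟩
          exact hP h3 fun _ _ _ => ⟨by omega, le_rfl⟩
        · simp [hρ, hρ20, hxj, hreal, hn0] at hb'
          simp only [Store.updateNat_nat_ne _ _ _ _ (show 34 ≠ 21 by decide),
            Store.updateNat_nat_ne _ _ _ _ (show 33 ≠ 21 by decide)]
          refine hP h2 fun _ _ h3 => ?_
          have h6 := hb' h3
          exact ⟨h6.1, by simp only [hsl]; linarith [h6.2]⟩
      · rintro ρ - h2
        simp only [Store.updateNat_nat_ne _ _ _ _ (show 34 ≠ 20 by decide),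
            Store.updateNat_nat_ne _ _ _ _ (show 33 ≠ 20 by decide)]
        exact ⟨fun i g hig hi hg hsg => h2.1 i g (by omega) hi hg hsg, h2.2⟩
    · rw [BExp.holds_reached, not_not] at hb
      simp only [hxk, hτ 31 (by decide), hτ 10 (by decide), hτ 9 (by decide), hi₀] at hb
      simp only [Store.updateNat_nat_ne _ _ _ _ (show 34 ≠ 20 by decide),
            Store.updateNat_nat_ne _ _ _ _ (show 33 ≠ 20 by decide)]
      refine ⟨fun i g hig hi hg hsg => h1.1 i g ?_ hi hg hsg, h1.2⟩
      have : i ≠ k := fun h => hi.2 (h ▸ hb)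
      omega
  · rintro τ - h
    exact h

theorem wp_dualUpdate (hn0 : σ.nat 0 0 0 = n) (hm0 : σ.nat 0 0 1 = m) (hi₀ : σ.nat 31 0 0 = i₀)
    (hi₀n : i₀ < n) (hN : n + m ≤ N) {δ : ℝ}
    (hδ : δ = σ.real 1 (σ.nat 33 0 0) (σ.nat 34 0 0) - σ.real 2 0 (σ.nat 33 0 0) -
            σ.real 3 0 (σ.nat 34 0 0))
    (hQ : ∀ τ : Store, (∀ c, c ∉ [20, 21] → τ.nat c = σ.nat c) →
      (∀ c, c ∉ [2, 3, 6] → τ.real c = σ.real c) →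
      (∀ i, Reached i₀ (σ.nat 9 0) (σ.nat 10 0) i → τ.real 2 0 i = σ.real 2 0 i + δ) →
      (∀ i, ¬ Reached i₀ (σ.nat 9 0) (σ.nat 10 0) i → τ.real 2 0 i = σ.real 2 0 i) →
      (∀ g < n + m, σ.nat 10 0 g ≠ 0 → τ.real 3 0 g = σ.real 3 0 g - δ) →
      (∀ g < n + m, σ.nat 10 0 g = 0 → τ.real 3 0 g = σ.real 3 0 g) → Q τ) :
    wp v N dualUpdate Q σ := by
  refine wp_frame_lists (Q := fun τ =>
      (∀ i, Reached i₀ (σ.nat 9 0) (σ.nat 10 0) i → τ.real 2 0 i = σ.real 2 0 i + δ) ∧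
      (∀ i, ¬ Reached i₀ (σ.nat 9 0) (σ.nat 10 0) i → τ.real 2 0 i = σ.real 2 0 i) ∧
      (∀ g < n + m, σ.nat 10 0 g ≠ 0 → τ.real 3 0 g = σ.real 3 0 g - δ) ∧
      (∀ g < n + m, σ.nat 10 0 g = 0 → τ.real 3 0 g = σ.real 3 0 g)) [20, 21] [2, 3, 6]
      ?_ (by decide) (by decide) fun τ h1 h2 h3 => hQ τ h1 h2 h3.1 h3.2.1 h3.2.2.1 h3.2.2.2
  -- The slack is stored beforehand, since it changes while the dual variables are being updated.
  refine wp_seq (wp_setReal (wp_seq ?_))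
  simp only [RExp.eval_slack, NExp.eval, ← hδ]
  refine wp_frame_lists (Q := fun τ =>
      (∀ i, Reached i₀ (σ.nat 9 0) (σ.nat 10 0) i → τ.real 2 0 i = σ.real 2 0 i + δ) ∧
      (∀ i, ¬ Reached i₀ (σ.nat 9 0) (σ.nat 10 0) i → τ.real 2 0 i = σ.real 2 0 i)) [20] [2]
      ?_ (by decide) (by decide) ?_
  · refine wp_for (i₀ + 1) (fun k τ =>
      (∀ i, (Reached i₀ (σ.nat 9 0) (σ.nat 10 0) i ∧ i < k) → τ.real 2 0 i = σ.real 2 0 i + δ) ∧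
      (∀ i, ¬ (Reached i₀ (σ.nat 9 0) (σ.nat 10 0) i ∧ i < k) → τ.real 2 0 i = σ.real 2 0 i))
      (by decide) (by decide) (by simp [hi₀]) (by omega) ?_ ?_ ?_
    · simp
    · rintro k τ hk hxk hfr hfr' ⟨h1, h2⟩
      have hτ : ∀ c, c ≠ 20 → τ.nat c = σ.nat c := fun c hc => by
        rw [hfr c (by simp [natWrites]) hc]
        rfl
      have h6 : τ.real 6 0 0 = δ := by
        rw [hfr' 6 (by decide)]
        simp
      refine wp_ite (fun hb => wp_setReal ?_) fun hb => wp_skip ?_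
      · rw [BExp.holds_reached] at hb
        simp only [hxk, hτ 31 (by decide), hτ 10 (by decide), hτ 9 (by decide), hi₀] at hb
        have hSk : Reached i₀ (σ.nat 9 0) (σ.nat 10 0) k := ⟨by omega, hb⟩
        simp only [NExp.eval, RExp.eval_add, RExp.eval_get, hxk, h6, Store.updateNat_real,
          Store.updateReal_real_same, true_and]
        refine ⟨fun i hi => ?_, fun i hi => ?_⟩
        · split_ifs with h3
          · rw [h3, h2 k (by omega)]
          · exact h1 i ⟨hi.1, by omega⟩
        · rw [if_neg fun h3 => hi (by rw [h3]; exact ⟨hSk, by omega⟩)]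
          exact h2 i fun h3 => hi ⟨h3.1, by omega⟩
      · rw [BExp.holds_reached, not_not] at hb
        simp only [hxk, hτ 31 (by decide), hτ 10 (by decide), hτ 9 (by decide), hi₀] at hb
        simp only [Store.updateNat_real]
        refine ⟨fun i hi => h1 i ⟨hi.1, ?_⟩, fun i hi => h2 i fun h3 => hi ⟨h3.1, by omega⟩⟩
        have : i ≠ k := fun h => hi.1.2 (h ▸ hb)
        omega
    · rintro τ - ⟨h1, h2⟩
      exact ⟨fun i hi => h1 i ⟨hi, Nat.lt_succ_of_le hi.1⟩, fun i hi => h2 i fun h => hi h.1⟩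
  · rintro σ' hσ hσr ⟨h1, h2⟩
    have hσn : ∀ c, c ≠ 20 → σ'.nat c = σ.nat c := fun c hc => by
      rw [hσ c (by simpa using hc)]
      rfl
    have hσ3 : σ'.real 3 = σ.real 3 := by
      rw [hσr 3 (by decide)]
      simp
    refine wp_for (n + m) (fun k τ => τ.real 2 = σ'.real 2 ∧
      (∀ g, (σ.nat 10 0 g ≠ 0 ∧ g < k) → τ.real 3 0 g = σ.real 3 0 g - δ) ∧
      (∀ g, ¬ (σ.nat 10 0 g ≠ 0 ∧ g < k) → τ.real 3 0 g = σ.real 3 0 g))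
      (by decide) (by decide) (by simp [hσn, hn0, hm0]) hN ?_ ?_ ?_
    · refine ⟨rfl, by simp, fun g _ => ?_⟩
      simp [hσ3]
    · rintro k τ hk hxk hfr hfr' ⟨h0, h3, h4⟩
      have hτ : ∀ c, c ≠ 20 → c ≠ 21 → τ.nat c = σ.nat c := fun c hc hc' => by
        rw [hfr c (by simp [natWrites]) hc', hσn c hc]
      have h6 : τ.real 6 0 0 = δ := by
        rw [hfr' 6 (by decide), hσr 6 (by decide)]
        simp
      refine wp_ite (fun hb => wp_setReal ?_) fun hb => wp_skip ?_
      · simp [hτ, hxk] at hb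
        simp only [NExp.eval, RExp.eval_sub, RExp.eval_get, hxk, h6, Store.updateNat_real,
          Store.updateReal_real_same, true_and]
        refine ⟨?_, fun i hi => ?_, fun i hi => ?_⟩
        · rw [Store.updateReal_real_ne _ _ _ _ (by decide), h0]
        · split_ifs with h5
          · rw [h5, h4 k (by omega)]
          · exact h3 i ⟨hi.1, by omega⟩
        · rw [if_neg fun h5 => hi (by rw [h5]; exact ⟨hb.ne', by omega⟩)]
          exact h4 i fun h5 => hi ⟨h5.1, by omega⟩
      · simp [hτ, hxk] at hb
        simp only [Store.updateNat_real]
        refine ⟨h0, fun i hi => h3 i ⟨hi.1, ?_⟩, fun i hi => h4 i fun h5 => hi ⟨h5.1, by omega⟩⟩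
        have : i ≠ k := fun h => hi.1 (h ▸ hb)
        omega
    · rintro τ - ⟨h0, h3, h4⟩
      rw [h0]
      exact ⟨h1, h2, fun g hg hs => h3 g ⟨hs, hg⟩, fun g hg hs => h4 g fun h => h.1 hs⟩

theorem wp_growTree (hi₀ : σ.nat 31 0 0 = i₀) (hi₀N : i₀ ≤ N)
    (hQ : ∀ τ : Store, (∀ c, c ∉ [10, 11, 23, 32, 35] → τ.nat c = σ.nat c) → τ.real = σ.real →
      τ.nat 35 0 0 = σ.nat 35 0 0 + 1 →
      τ.nat 11 0 = Function.update (σ.nat 11 0) (σ.nat 34 0 0) (σ.nat 33 0 0) →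
      τ.nat 10 0 = Function.update (σ.nat 10 0) (σ.nat 34 0 0) (σ.nat 35 0 0 + 1) →
      ((∃ i < i₀, σ.nat 9 0 i = σ.nat 34 0 0) ∧ τ.nat 32 0 0 = σ.nat 32 0 0 ∨
        (∀ i < i₀, σ.nat 9 0 i ≠ σ.nat 34 0 0) ∧ τ.nat 32 0 0 = 1) → Q τ) :
    wp v N growTree Q σ := by
  refine wp_frame_list (Q := fun τ => τ.nat 35 0 0 = σ.nat 35 0 0 + 1 ∧
      τ.nat 11 0 = Function.update (σ.nat 11 0) (σ.nat 34 0 0) (σ.nat 33 0 0) ∧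
      τ.nat 10 0 = Function.update (σ.nat 10 0) (σ.nat 34 0 0) (σ.nat 35 0 0 + 1) ∧
      ((∃ i < i₀, σ.nat 9 0 i = σ.nat 34 0 0) ∧ τ.nat 32 0 0 = σ.nat 32 0 0 ∨
        (∀ i < i₀, σ.nat 9 0 i ≠ σ.nat 34 0 0) ∧ τ.nat 32 0 0 = 1)) [10, 11, 23, 32, 35]
    ?_ (by decide) rfl fun τ h1 h2 h3 => hQ τ h1 h2 h3.1 h3.2.1 h3.2.2.1 h3.2.2.2
  refine wp_seq (wp_setNat (wp_seq (wp_setNat (wp_seq (wp_setNat (wp_seq ?_))))))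
  simp only [NExp.eval, Store.updateNat_nat_self, ne_eq, Nat.reduceEqDiff, not_false_eq_true,
    Store.updateNat_nat_ne]
  refine wp_find i₀ (fun i => σ.nat 9 0 i = σ.nat 34 0 0) (by decide) (by simp [hi₀]) hi₀N
    (fun k => ?_) fun k hk h1 h2 => ?_
  · simp
    omega
  · refine wp_ite (fun hb => wp_skip ?_) fun hb => wp_setNat ?_
    · simp [hi₀] at hb
      simp [Store.nat_updateNat_row]
      exact .inl ⟨k, hb, h2 hb⟩
    · simp [hi₀] at hb
      simp [Store.nat_updateNat_row]
      exact .inr fun i hi => h1 i (by omega)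

end Specs

section Specs

variable {n m : ℕ} {v : Fin n → Finset (Fin m) → ℝ} {N : ℕ} {Q Q' : Store → Prop} {σ : Store}
  {i₀ : ℕ} {c : ℕ → ℕ → ℝ}

/-- The memory `τ` holds a matching of the first `i₀` rows with dual variables. -/
def Store.HasDualMatching (τ : Store) (n M : ℕ) (c : ℕ → ℕ → ℝ) (i₀ : ℕ) : Prop :=
  IsDualMatching n M c i₀ (τ.real 2 0) (τ.real 3 0) (τ.nat 9 0)

/-- The memory `τ` holds an alternating tree; every label is the number of columns labelled
before. -/
structure Store.HasTree (τ : Store) (n M : ℕ) (c : ℕ → ℕ → ℝ) (i₀ : ℕ) : Prop where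
  matching : τ.HasDualMatching n M c i₀
  tree : IsAlternatingTree M c i₀ (τ.real 2 0) (τ.real 3 0) (τ.nat 9 0) (τ.nat 11 0) (τ.nat 10 0)
    (τ.nat 35 0 0)
  count : τ.nat 35 0 0 + ((Finset.range M).filter fun g => τ.nat 10 0 g = 0).card = M
  search : τ.nat 32 0 0 = 0 ∧ (∀ g < M, τ.nat 10 0 g ≠ 0 → ∃ i < i₀, τ.nat 9 0 i = g) ∨
    τ.nat 32 0 0 = 1 ∧ τ.nat 34 0 0 < M ∧ τ.nat 10 0 (τ.nat 34 0 0) ≠ 0 ∧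
      ∀ i < i₀, τ.nat 9 0 i ≠ τ.nat 34 0 0

theorem card_filter_update_lt {M g k : ℕ} {s : ℕ → ℕ} (hg : g < M) (hs : s g = 0) :
    ((Finset.range M).filter fun h => Function.update s g (k + 1) h = 0).card + 1 =
      ((Finset.range M).filter fun h => s h = 0).card := by
  rw [← Finset.card_erase_add_one (s := (Finset.range M).filter fun h => s h = 0) (a := g)
    (by simp [hg, hs])]
  congr 2
  ext h
  by_cases h1 : h = g
  · simp [h1]
  · simp [h1]

theorem wp_growStep (hn0 : σ.nat 0 0 0 = n) (hm0 : σ.nat 0 0 1 = m) (hi₀ : σ.nat 31 0 0 = i₀)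
    (hi₀n : i₀ < n) (hN : n + m ≤ N) (hc : σ.real 1 = c) (h : σ.HasTree n (n + m) c i₀)
    (hgo : σ.nat 32 0 0 = 0)
    (hQ : ∀ τ : Store, τ.nat 0 = σ.nat 0 → τ.nat 31 = σ.nat 31 → τ.real 1 = σ.real 1 →
      τ.HasTree n (n + m) c i₀ → τ.nat 35 0 0 = σ.nat 35 0 0 + 1 → Q τ) :
    wp v N (.seq minEdge (.seq dualUpdate growTree)) Q σ := by
  have hT : ∀ g < n + m, σ.nat 10 0 g ≠ 0 → ∃ i < i₀, σ.nat 9 0 i = g := by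
    rcases h.search with h1 | h1
    · exact h1.2
    · omega
  -- The dummy columns ensure that there are more columns than the `i₀` rows matched so far.
  -- Together with the root row, which is always reached, an unlabelled column gives an edge to
  -- choose.
  obtain ⟨g₀, hg₀, hsg₀⟩ := exists_unlabelled (M := n + m) (by omega) hT
  refine wp_seq (wp_minEdge hn0 hm0 hi₀ hi₀n hN
    ⟨i₀, g₀, ⟨le_rfl, fun h1 => lt_irrefl _ h1.1⟩, hg₀, hsg₀⟩ ?_)
  intro τ₁ f1 r1 hS hg hsg hmin
  set δ := σ.real 1 (τ₁.nat 33 0 0) (τ₁.nat 34 0 0) - σ.real 2 0 (τ₁.nat 33 0 0) -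
            σ.real 3 0 (τ₁.nat 34 0 0) with hδ
  refine wp_seq (wp_dualUpdate (δ := δ) (by rw [f1 0 (by decide), hn0])
    (by rw [f1 0 (by decide), hm0]) (by rw [f1 31 (by decide), hi₀]) hi₀n hN (by rw [r1]) ?_)
  intro τ₂ f2 r2 hu1 hu2 hw1 hw2
  rw [f1 9 (by decide), f1 10 (by decide), r1] at hu1 hu2
  rw [f1 10 (by decide), r1] at hw1 hw2
  refine wp_growTree (i₀ := i₀) (by rw [f2 31 (by decide), f1 31 (by decide), hi₀]) (by omega) ?_
  intro τ₃ f3 r3 h35 h11 h10 h32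
  rw [f2 33 (by decide), f2 34 (by decide), f2 11 (by decide), f1 11 (by decide)] at h11
  rw [f2 34 (by decide), f2 35 (by decide), f1 35 (by decide), f2 10 (by decide),
    f1 10 (by decide)] at h10
  rw [f2 35 (by decide), f1 35 (by decide)] at h35
  rw [f2 32 (by decide), f1 32 (by decide), f2 9 (by decide), f1 9 (by decide),
    f2 34 (by decide)] at h32
  have h9 : τ₃.nat 9 = σ.nat 9 := by rw [f3 9 (by decide), f2 9 (by decide), f1 9 (by decide)]
  have h34 : τ₃.nat 34 = τ₁.nat 34 := by rw [f3 34 (by decide), f2 34 (by decide)]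
  have hδ0 : 0 ≤ δ := by
    have := h.matching.feasible (τ₁.nat 33 0 0) (by have := hS.1; omega) _ hg
    rw [hδ, hc]
    linarith
  refine hQ τ₃ (by rw [f3 0 (by decide), f2 0 (by decide), f1 0 (by decide)])
    (by rw [f3 31 (by decide), f2 31 (by decide), f1 31 (by decide)])
    (by rw [r3, r2 1 (by decide), r1]) ⟨?_, ?_, ?_, ?_⟩ h35
  · rw [Store.HasDualMatching, h9, r3]
    refine h.matching.update hδ0 (fun i g h1 h2 h3 => ?_) hT hu1 hu2 hw1 hw2
    rw [← hc]
    exact hmin i g h1 h2 h3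
  · rw [h9, r3, h11, h10, h35]
    exact h.tree.grow h.matching.lt hS hg hsg (by rw [hδ, hc]) hu1 hw1 hw2
  · rw [h35, h10, add_assoc, add_comm 1, card_filter_update_lt hg hsg]
    exact h.count
  · rw [h9, h34, h10]
    rcases h32 with ⟨⟨i, hi, h4⟩, h5⟩ | ⟨h4, h5⟩
    · refine .inl ⟨h5.trans hgo, fun g hg' hs => ?_⟩
      by_cases h6 : g = τ₁.nat 34 0 0
      · exact ⟨i, hi, by rw [h6, h4]⟩
      · rw [Function.update_of_ne h6] at hs
        exact hT g hg' hs
    · exact .inr ⟨h5, hg, by simp, h4⟩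

/-- The state of the augmentation. -/
def Store.IsAugmentState (τ : Store) (n M : ℕ) (c : ℕ → ℕ → ℝ) (i₀ : ℕ) : Prop :=
  τ.nat 32 0 0 = 1 ∧ IsAugmenting n M c i₀ (τ.real 2 0) (τ.real 3 0) (τ.nat 9 0) (τ.nat 11 0)
    (τ.nat 10 0) (τ.nat 34 0 0) ∨
  τ.nat 32 0 0 = 2 ∧ τ.HasDualMatching n M c (i₀ + 1)

theorem wp_augmentStep {M : ℕ} (hi₀ : σ.nat 31 0 0 = i₀)
    (h : IsAugmenting n M c i₀ (σ.real 2 0) (σ.real 3 0) (σ.nat 9 0) (σ.nat 11 0) (σ.nat 10 0)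
      (σ.nat 34 0 0)) (hgo : σ.nat 32 0 0 = 1)
    (hQ : ∀ τ : Store, τ.nat 31 = σ.nat 31 → τ.nat 10 = σ.nat 10 → τ.IsAugmentState n M c i₀ →
      (τ.nat 32 0 0 = 1 → τ.nat 10 0 (τ.nat 34 0 0) < σ.nat 10 0 (σ.nat 34 0 0)) → Q τ) :
    wp v N augmentStep Q σ := by
  refine wp_frame_list (Q := fun τ => τ.IsAugmentState n M c i₀ ∧
      (τ.nat 32 0 0 = 1 → τ.nat 10 0 (τ.nat 34 0 0) < σ.nat 10 0 (σ.nat 34 0 0)))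
    [9, 32, 33, 34, 36] ?_ (by decide) rfl fun τ h1 _ h3 =>
      hQ τ (h1 31 (by decide)) (h1 10 (by decide)) h3.1 h3.2
  refine wp_seq (wp_setNat (wp_seq (wp_setNat (wp_seq (wp_setNat (wp_ite ?_ ?_))))))
  · intro hb
    simp [hi₀] at hb
    obtain ⟨h1, h2⟩ := h.step hb
    refine wp_setNat ⟨.inl ?_, ?_⟩
    · simpa [Store.nat_updateNat_row, hgo] using h1
    · simpa [hgo] using h2
  · intro hb
    simp [hi₀] at hb
    have h1 := h.finish (by omega)
    refine wp_setNat ⟨.inr ?_, ?_⟩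
    · simpa [Store.HasDualMatching, Store.nat_updateNat_row] using h1
    · simp

/-- The search labels a new column in each round, so it takes at most `n + m` rounds. The
augmentation descends through strictly decreasing labels, which are bounded by the number of rounds.
-/
theorem wp_matchRow (hn0 : σ.nat 0 0 0 = n) (hm0 : σ.nat 0 0 1 = m) (hi₀ : σ.nat 31 0 0 = i₀)
    (hi₀n : i₀ < n) (hN : n + m ≤ N) (h : σ.HasDualMatching n (n + m) (σ.real 1) i₀) :
    wp v N matchRow (fun τ => τ.HasDualMatching n (n + m) (σ.real 1) (i₀ + 1)) σ := by
  refine wp_seq ?_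
  refine wp_frame_list (Q := fun τ => ∀ g < n + m, τ.nat 10 0 g = 0) [10, 21] ?_ (by decide) rfl ?_
  · refine wp_for (n + m) (fun k τ => ∀ g < k, τ.nat 10 0 g = 0)
      (by decide) (by decide) (by simp [hn0, hm0]) hN ?_ ?_ ?_
    · simp
    · rintro k τ hk hxk - - h1
      refine wp_setNat fun g hg => ?_
      by_cases h2 : g = k
      · simp [hxk, h2]
      · simp [hxk, Store.nat_updateNat_row, h2]
        exact h1 g (by omega)
    · rintro τ - h1
      exact h1
  rintro τ₁ f1 r1 h10
  refine wp_seq (wp_setNat (wp_seq (wp_setNat (wp_seq ?_))))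
  refine wp_loop (fun τ => (τ.nat 0 = σ.nat 0 ∧ τ.nat 31 = σ.nat 31 ∧ τ.real 1 = σ.real 1) ∧
    τ.HasTree n (n + m) (σ.real 1) i₀) (fun τ => n + m - τ.nat 35 0 0) ⟨⟨?_, ?_, ?_⟩, ?_, ?_, ?_, ?_⟩
    ?_ ?_ ?_
  · simp [f1]
  · simp [f1]
  · simp [r1]
  · simpa [Store.HasDualMatching, f1, r1] using h
  · constructor <;> intro g hg hs <;> exact absurd (by simpa using h10 g hg) hs
  · rw [Finset.filter_true_of_mem]
    · simp
    · intro g hg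
      simpa using h10 g (Finset.mem_range.1 hg)
  · refine .inl ⟨by simp, fun g hg hs => ?_⟩
    exact absurd (by simpa using h10 g hg) hs
  · simp
    omega
  · rintro τ ⟨⟨h1, h2, h3⟩, h4⟩ hb
    refine wp_growStep (by rw [h1, hn0]) (by rw [h1, hm0]) (by rw [h2, hi₀]) hi₀n hN h3 h4
      (by simpa using hb) ?_
    intro ρ h5 h6 h7 h8 h9
    refine ⟨⟨⟨h5.trans h1, h6.trans h2, h7.trans h3⟩, h8⟩, ?_⟩
    have := h8.count
    omega
  · rintro τ ⟨⟨h1, h2, h3⟩, h4⟩ hb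
    have h5 : τ.nat 32 0 0 = 1 ∧ τ.nat 34 0 0 < n + m ∧ τ.nat 10 0 (τ.nat 34 0 0) ≠ 0 ∧
        ∀ i < i₀, τ.nat 9 0 i ≠ τ.nat 34 0 0 := by
      rcases h4.search with h5 | h5
      · simp [h5.1] at hb
      · exact h5
    have h6 := h4.matching.augmenting h4.tree h5.2.1 h5.2.2.1 h5.2.2.2
    refine wp_loop (fun ρ => ρ.nat 31 = σ.nat 31 ∧ ρ.IsAugmentState n (n + m) (σ.real 1) i₀)
      (fun ρ => if ρ.nat 32 0 0 = 1 then ρ.nat 10 0 (ρ.nat 34 0 0) else 0)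
      ⟨h2, .inl ⟨h5.1, h6⟩⟩ ?_ ?_ ?_
    · have := h4.tree.label_le _ h5.2.1 h5.2.2.1
      have := h4.count
      simp only [h5.1, if_true, pow_one]
      omega
    · rintro ρ ⟨h7, ⟨h8, h9⟩ | ⟨h8, h9⟩⟩ hb
      · refine wp_augmentStep (by rw [h7, hi₀]) h9 h8 fun ρ' h10 h11 h12 h13 => ⟨⟨?_, h12⟩, ?_⟩
        · exact h10.trans h7
        · simp only [h8, if_true]
          split_ifs with h14
          · exact h13 h14
          · have := h9.label
            omega
      · simp [h8] at hb
    · rintro ρ ⟨-, ⟨h8, h9⟩ | ⟨h8, h9⟩⟩ hb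
      · simp [h8] at hb
      · exact h9

theorem wp_assignment (hn0 : σ.nat 0 0 0 = n) (hm0 : σ.nat 0 0 1 = m) (hN : n + m ≤ N)
    (h : σ.HasDualMatching n (n + m) (σ.real 1) 0)
    (hQ : ∀ τ : Store, (∀ c, c ∉ [9, 10, 11, 20, 21, 23, 31, 32, 33, 34, 35, 36] →
      τ.nat c = σ.nat c) → (∀ c, c ∉ [2, 3, 6] → τ.real c = σ.real c) →
      τ.HasDualMatching n (n + m) (σ.real 1) n → Q τ) :
    wp v N assignment Q σ := by
  refine wp_frame_lists [9, 10, 11, 20, 21, 23, 31, 32, 33, 34, 35, 36] [2, 3, 6] ?_ (by decide)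
    (by decide) hQ
  refine wp_for n (fun k τ => τ.HasDualMatching n (n + m) (σ.real 1) k) (by decide) (by decide)
    (by simp [hn0]) (by omega) ?_ ?_ ?_
  · simpa [Store.HasDualMatching] using h
  · rintro k τ hk hxk hfr hfr' h1
    have h0 : τ.nat 0 = σ.nat 0 := hfr 0 (by decide) (by decide)
    have hc : τ.real 1 = σ.real 1 := hfr' 1 (by decide)
    rw [← hc] at h1 ⊢
    refine wp_mono (wp_matchRow (by rw [h0, hn0]) (by rw [h0, hm0]) hxk hk hN h1) fun ρ h2 => ?_
    simpa [Store.HasDualMatching] using h2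
  · rintro τ - h1
    exact h1

end Specs

/-! ### Edge weights, costs and penalties -/

/-- The weight of the edge between agent `i` and good number `g`. -/
def RExp.weight (i g : NExp) : RExp := .add (.value i 7 g) (.div (.value i 8 i) (.ofNat .agents))

namespace BProgram

/-- The rows of array `7` become the sets with one good. -/
def singleSets : BProgram := forLoop 21 .goods (.setNat 7 (.var 21) (.var 21) (.lit 1))

/-- Variable `25` becomes the number of goods that agent `var 20` likes at least as much as good
`var 21`. -/
def countBetter : BProgram :=
  .seq (assign 25 (.lit 0)) (forLoop 22 .goods
    (.ite (.realLT (.value (.var 20) 7 (.var 22)) (.value (.var 20) 7 (.var 21))) .skip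
      (assign 25 (.add (.var 25) (.lit 1)))))

/-- The rows of array `8` become the sets of low goods. -/
def lowSets : BProgram :=
  forLoop 20 .agents (forLoop 21 .goods (.seq countBetter
    (.ite (.natLT .agents (.var 25)) (.setNat 8 (.var 20) (.var 21) (.lit 1)) .skip)))

/-- The exponent is stored in the real array `4`. -/
def setExponent : BProgram :=
  .ite (.natLT (.lit 0) (.get 0 (.lit 0) (.lit 2)))
    (.setReal 4 (.lit 0) (.lit 0) (.sub (.ofNat (.lit 0)) (.mul (.ofNat .agents) (.ofNat .agents))))
    (.setReal 4 (.lit 0) (.lit 0) (.get 0 (.lit 0) (.lit 1)))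

/-- Sets one entry of the cost matrix. -/
def setCost : BProgram :=
  .ite (.realLT (.ofNat (.lit 0)) (.get 4 (.lit 0) (.lit 0)))
    (.setReal 1 (.var 20) (.var 21)
      (.sub (.ofNat (.lit 0)) (.pow (.weight (.var 20) (.var 21)) (.get 4 (.lit 0) (.lit 0)))))
    (.ite (.realLT (.ofNat (.lit 0)) (.weight (.var 20) (.var 21)))
      (.ite (.realLT (.get 4 (.lit 0) (.lit 0)) (.ofNat (.lit 0)))
        (.setReal 1 (.var 20) (.var 21)
          (.pow (.weight (.var 20) (.var 21)) (.get 4 (.lit 0) (.lit 0))))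
        (.setReal 1 (.var 20) (.var 21)
          (.sub (.ofNat (.lit 0)) (.log (.weight (.var 20) (.var 21))))))
      (.setReal 1 (.var 20) (.var 21) (.ofNat (.lit 0))))

/-- Sets the cost matrix and a bound for the costs in the real array `5`. -/
def setCosts : BProgram :=
  forLoop 20 .agents (forLoop 21 .columns (.seq setCost
    (.setReal 5 (.lit 0) (.lit 0) (.add (.get 5 (.lit 0) (.lit 0))
      (.add (.mul (.get 1 (.var 20) (.var 21)) (.get 1 (.var 20) (.var 21)))
        (.ofNat (.lit 1)))))))

/-- Sets the costs of the edges to be avoided, and the dual variables of the rows. -/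
def setPenalties : BProgram :=
  forLoop 20 .agents (.seq
    (.setReal 2 (.lit 0) (.var 20)
      (.sub (.ofNat (.lit 0)) (.add (.get 5 (.lit 0) (.lit 0)) (.get 5 (.lit 0) (.lit 0)))))
    (forLoop 21 .columns
      (.ite (.and (.not (.realLT (.ofNat (.lit 0)) (.get 4 (.lit 0) (.lit 0))))
          (.not (.realLT (.ofNat (.lit 0)) (.weight (.var 20) (.var 21)))))
        (.setReal 1 (.var 20) (.var 21)
          (.add (.get 5 (.lit 0) (.lit 0)) (.get 5 (.lit 0) (.lit 0)))) .skip)))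

/-- Sets up the assignment problem. -/
def weights : BProgram :=
  .seq singleSets (.seq lowSets (.seq setExponent (.seq setCosts setPenalties)))

end BProgram

section Specs

variable {n m : ℕ} {v : Fin n → Finset (Fin m) → ℝ} {N : ℕ} {Q Q' : Store → Prop} {σ : Store}

theorem wp_singleSets (hm0 : σ.nat 0 0 1 = m) (hN : m ≤ N) (h7 : ∀ r k, σ.nat 7 r k = 0)
    (hQ : ∀ τ : Store, (∀ c, c ∉ [7, 21] → τ.nat c = σ.nat c) → τ.real = σ.real →
      (∀ g, τ.row m 7 g = goodSet m g) → Q τ) : wp v N singleSets Q σ := by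
  refine wp_frame_list (Q := fun τ => ∀ g, τ.row m 7 g = goodSet m g) [7, 21] ?_ (by decide) rfl hQ
  refine wp_for m (fun k τ => ∀ r j, τ.nat 7 r j = if r = j ∧ j < k then 1 else 0) (by decide)
    (by decide) (by simp [hm0]) hN ?_ ?_ ?_
  · simpa using h7
  · rintro k τ hk hxk - - h1
    refine wp_setNat fun r j => ?_
    simp only [NExp.eval, hxk, ne_eq, Nat.reduceEqDiff, not_false_eq_true, Store.updateNat_nat_ne,
      Store.updateNat_nat_same, h1]
    split_ifs <;> omega
  · rintro τ - h1 g
    ext x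
    have := x.2
    rw [Store.mem_row, h1, mem_goodSet]
    split_ifs <;> omega

theorem wp_countBetter (hm0 : σ.nat 0 0 1 = m) (hN : m ≤ N) {i : Fin n} (hi : σ.nat 20 0 0 = i)
    {g : Fin m} (hg : σ.nat 21 0 0 = g) (h7 : ∀ g, σ.row m 7 g = goodSet m g)
    (hQ : ∀ τ : Store, (∀ c, c ∉ [22, 25] → τ.nat c = σ.nat c) → τ.real = σ.real →
      τ.nat 25 0 0 = (Finset.univ.filter fun g' => v i {g} ≤ v i {g'}).card → Q τ) :
    wp v N countBetter Q σ := by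
  refine wp_frame_list (Q := fun τ =>
    τ.nat 25 0 0 = (Finset.univ.filter fun g' => v i {g} ≤ v i {g'}).card) [22, 25] ?_ (by decide)
    rfl hQ
  refine wp_seq (wp_setNat ?_)
  refine wp_for m (fun k τ => τ.nat 25 0 0 =
    (Finset.univ.filter fun g' : Fin m => (g' : ℕ) < k ∧ v i {g} ≤ v i {g'}).card) (by decide)
    (by decide) (by simp [hm0]) hN ?_ ?_ ?_
  · simp
  · rintro k τ hk hxk hfr - h1
    have hτ : ∀ c, c ≠ 22 → c ≠ 25 → τ.nat c = σ.nat c := fun c h2 h3 => by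
      rw [hfr c (by simpa [natWrites] using h3) h2, Store.updateNat_nat_ne _ _ _ _ h3]
    have h2 : (RExp.value (.var 20) 7 (.var 22)).eval v τ = v i {⟨k, hk⟩} := by
      rw [RExp.eval_value]
      simp only [NExp.eval, hxk, hτ 20 (by decide) (by decide), hi, query_val,
        Store.row_congr (hτ 7 (by decide) (by decide)), h7]
      rw [← goodSet_val]
    have h3 : (RExp.value (.var 20) 7 (.var 21)).eval v τ = v i {g} := by
      rw [RExp.eval_value]
      simp only [NExp.eval, hτ 20 (by decide) (by decide), hτ 21 (by decide) (by decide), hi, hg,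
        query_val, Store.row_congr (hτ 7 (by decide) (by decide)), h7]
      rw [← goodSet_val]
    refine wp_ite (fun hb => wp_skip ?_) fun hb => wp_setNat ?_
    · rw [BExp.Holds, h2, h3] at hb
      rw [Store.updateNat_nat_ne _ _ _ _ (by decide), h1]
      congr 1
      ext x
      simp only [Finset.mem_filter, Finset.mem_univ, true_and, and_congr_left_iff]
      intro h4
      have : (x : ℕ) ≠ k := fun h5 => by
        rw [show x = ⟨k, hk⟩ from Fin.ext h5] at h4
        linarith
      omega
    · rw [BExp.Holds, h2, h3, not_lt] at hb
      simp only [NExp.eval, Store.updateNat_nat_self, ne_eq, Nat.reduceEqDiff, not_false_eq_true,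
        Store.updateNat_nat_ne]
      rw [h1, ← Finset.card_erase_add_one (a := (⟨k, hk⟩ : Fin m))
        (s := Finset.univ.filter fun g' : Fin m => (g' : ℕ) < k + 1 ∧ v i {g} ≤ v i {g'})
        (by simpa using hb)]
      congr 2
      ext x
      simp only [Finset.mem_filter, Finset.mem_univ, true_and, Finset.mem_erase, ne_eq, Fin.ext_iff]
      constructor
      · rintro ⟨h4, h5⟩
        exact ⟨by omega, by omega, h5⟩
      · rintro ⟨h4, h5, h6⟩
        exact ⟨by omega, h6⟩
  · rintro τ - h1
    rw [h1]
    congr 1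
    ext x
    simp

theorem wp_lowSets (hn0 : σ.nat 0 0 0 = n) (hm0 : σ.nat 0 0 1 = m) (hN : n + m ≤ N)
    (h7 : ∀ g, σ.row m 7 g = goodSet m g) (h8 : ∀ r k, σ.nat 8 r k = 0)
    (hQ : ∀ τ : Store, (∀ c, c ∉ [8, 20, 21, 22, 25] → τ.nat c = σ.nat c) → τ.real = σ.real →
      (∀ i : Fin n, τ.row m 8 i = lowGoods (v i) n) → Q τ) : wp v N lowSets Q σ := by
  refine wp_frame_list (Q := fun τ => ∀ i : Fin n, τ.row m 8 i = lowGoods (v i) n)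
    [8, 20, 21, 22, 25] ?_ (by decide) rfl hQ
  refine wp_for n (fun k τ => ∀ (i : Fin n) (g : Fin m), (g ∈ τ.row m 8 i ↔
    (i : ℕ) < k ∧ g ∈ lowGoods (v i) n)) (by decide) (by decide) (by simp [hn0]) (by omega) ?_ ?_ ?_
  · intro i g
    simp [Store.mem_row, h8]
  · rintro k τ hk hxk hfr - h1
    have hτ : ∀ c, c ∉ [8, 20, 21, 22, 25] → τ.nat c = σ.nat c := fun c hc =>
      hfr c (fun h => hc (by revert h; simp [natWrites, forLoop, countBetter]; tauto))
        fun h => hc (by simp [h])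
    refine wp_for m (fun j τ => ∀ (i : Fin n) (g : Fin m), (g ∈ τ.row m 8 i ↔
      ((i : ℕ) < k ∨ ((i : ℕ) = k ∧ (g : ℕ) < j)) ∧ g ∈ lowGoods (v i) n)) (by decide)
      (by decide) (by simp [hτ, hm0]) (by omega) ?_ ?_ ?_
    · intro i g
      simp [h1]
    · rintro j ρ hj hxj hgr - h2
      have hρ : ∀ c, c ∉ [8, 20, 21, 22, 25] → ρ.nat c = σ.nat c := fun c hc => by
        rw [hgr c (fun h => hc (by revert h; simp [natWrites, forLoop, countBetter]; tauto))
          (fun h => hc (by simp [h])), hτ c hc]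
      have hρ20 : ρ.nat 20 0 0 = k := by rw [hgr 20 (by decide) (by decide), hxk]
      refine wp_seq (wp_countBetter (i := ⟨k, hk⟩) (g := ⟨j, hj⟩) (by rw [hρ 0 (by decide), hm0])
        (by omega) hρ20 hxj (fun g => by rw [Store.row_congr (hρ 7 (by decide)), h7]) ?_)
      intro ρ' f1 r1 h3
      have hlow : (⟨j, hj⟩ : Fin m) ∈ lowGoods (v ⟨k, hk⟩) n ↔ n < ρ'.nat 25 0 0 := by
        rw [h3]
        simp [lowGoods]
      have h8' : ∀ i, ρ'.row m 8 i = ρ.row m 8 i := Store.row_congr (f1 8 (by decide)) m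
      refine wp_ite (fun hb => wp_setNat fun i g => ?_) fun hb => wp_skip fun i g => ?_
      · simp only [BExp.Holds, NExp.eval, f1 0 (by decide), hρ 0 (by decide), hn0] at hb
        have h4 := hlow.2 hb
        simp only [NExp.eval, f1 20 (by decide), f1 21 (by decide), hρ20, hxj]
        rw [Store.row_updateNat_ne _ _ _ _ _ _ (by decide)]
        by_cases hi : (i : ℕ) = k
        · obtain rfl : i = ⟨k, hk⟩ := Fin.ext hi
          rw [Store.row_updateNat_pos ρ' 8 k ⟨j, hj⟩ one_ne_zero, h8', Finset.mem_insert,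
            h2 ⟨k, hk⟩]
          by_cases hg : g = ⟨j, hj⟩
          · simp [hg, h4]
          · have : (g : ℕ) ≠ j := fun h => hg (Fin.ext h)
            simp only [hg, false_or, true_and]
            have h5 : (g : ℕ) < j + 1 ↔ (g : ℕ) < j := by omega
            rw [h5]
        · rw [Store.row_updateNat_row_ne _ _ _ _ _ hi, h8', h2]
          simp [hi]
      · simp only [BExp.Holds, NExp.eval, f1 0 (by decide), hρ 0 (by decide), hn0] at hb
        have h4 := fun h => hb (hlow.1 h)
        rw [Store.row_updateNat_ne _ _ _ _ _ _ (by decide), h8', h2]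
        by_cases hi : i = ⟨k, hk⟩
        · by_cases hg : g = ⟨j, hj⟩
          · subst hi hg
            exact iff_of_false (fun h => h4 h.2) fun h => h4 h.2
          · have : (g : ℕ) ≠ j := fun h => hg (Fin.ext h)
            have h5 : (g : ℕ) < j + 1 ↔ (g : ℕ) < j := by omega
            rw [h5]
        · have : (i : ℕ) ≠ k := fun h => hi (Fin.ext h)
          simp [this]
    · rintro ρ - h2 i g
      have := g.2
      rw [Store.row_updateNat_ne _ _ _ _ _ _ (by decide), h2]
      have h5 : ((i : ℕ) < k ∨ (i : ℕ) = k ∧ (g : ℕ) < m) ↔ (i : ℕ) < k + 1 := by omega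
      rw [h5]
  · rintro τ - h1 i
    ext g
    simp [h1]

/-- The arrays `7` and `8` hold the sets needed to compute the weights. -/
structure Store.HasSets (τ : Store) (v : Fin n → Finset (Fin m) → ℝ) : Prop where
  agents : τ.nat 0 0 0 = n
  goods : τ.nat 0 0 1 = m
  single : ∀ g, τ.row m 7 g = goodSet m g
  low : ∀ i : Fin n, τ.row m 8 i = lowGoods (v i) n

theorem Store.HasSets.congr {σ τ : Store} (h : σ.HasSets v) (h0 : τ.nat 0 = σ.nat 0)
    (h7 : τ.nat 7 = σ.nat 7) (h8 : τ.nat 8 = σ.nat 8) : τ.HasSets v :=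
  ⟨by rw [h0, h.agents], by rw [h0, h.goods], fun g => by rw [Store.row_congr h7, h.single],
    fun g => by rw [Store.row_congr h8, h.low]⟩

theorem Store.HasSets.eval_weight (h : σ.HasSets v) {i g : NExp} {i' : Fin n} (hi : i.eval σ = i') :
    (RExp.weight i g).eval v σ = edgeWeight v i' (g.eval σ) := by
  simp [RExp.weight, hi, h.single, h.low, h.agents, edgeWeight]

theorem wp_setExponent {p : WithBot ℝ} (hn0 : σ.nat 0 0 0 = n)
    (hp : p = ⊥ ∧ σ.nat 0 0 2 = 1 ∨ σ.nat 0 0 2 = 0 ∧ p = (σ.real 0 0 1 : ℝ))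
    (hQ : ∀ τ : Store, τ.nat = σ.nat → (∀ c, c ∉ [4] → τ.real c = σ.real c) →
      τ.real 4 0 0 = effectiveExponent n p → Q τ) : wp v N setExponent Q σ := by
  refine wp_frame_lists (Q := fun τ => τ.real 4 0 0 = effectiveExponent n p) [] [4] ?_ (by decide)
    (by decide) fun τ h1 h2 => hQ τ (funext fun c => h1 c (by simp)) h2
  refine wp_ite (fun hb => wp_setReal ?_) fun hb => wp_setReal ?_
  · simp only [BExp.Holds, NExp.eval] at hb
    rcases hp with ⟨rfl, -⟩ | ⟨h1, -⟩
    · simp [effectiveExponent, hn0]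
    · omega
  · simp only [BExp.Holds, NExp.eval] at hb
    rcases hp with ⟨-, h1⟩ | ⟨-, rfl⟩
    · omega
    · simp [effectiveExponent]

theorem wp_setCost (hv : ∀ i, IsSubadditiveValuation (v i)) (h : σ.HasSets v) {i : Fin n} {g : ℕ}
    (hi : σ.nat 20 0 0 = i) (hg : σ.nat 21 0 0 = g) {q : ℝ} (hq : σ.real 4 0 0 = q)
    (hQ : Q (σ.updateReal 1 i g (meanCost q (edgeWeight v i g)))) : wp v N setCost Q σ := by
  have hw : (RExp.weight (.var 20) (.var 21)).eval v σ = edgeWeight v i g := by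
    rw [h.eval_weight (i' := i) (by simpa using hi)]
    simp [hg]
  have h0 := edgeWeight_nonneg hv i g
  refine wp_ite (fun hb => wp_setReal ?_) fun hb =>
    wp_ite (fun hb' => wp_ite (fun hb'' => wp_setReal ?_) fun hb'' => wp_setReal ?_)
      fun hb' => wp_setReal ?_
  · simp only [BExp.Holds, RExp.eval_ofNat, RExp.eval_get, NExp.eval, hq, Nat.cast_zero] at hb
    simp only [RExp.eval_sub, RExp.eval_pow, RExp.eval_ofNat, RExp.eval_get, NExp.eval, hw, hq, hi,
      hg]
    convert hQ using 2
    rw [meanCost, if_pos hb]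
    split_ifs with h1
    · simp
    -- The machine returns `0` for a power with base zero, in agreement with `0 ^ q = 0` for `q >
    -- 0`.
    · rw [le_antisymm (not_lt.1 h1) h0, Real.zero_rpow hb.ne']
      simp
  · simp only [BExp.Holds, RExp.eval_ofNat, RExp.eval_get, NExp.eval, hq, hw, Nat.cast_zero]
      at hb hb' hb''
    simp only [RExp.eval_pow, RExp.eval_get, NExp.eval, hw, hq, hi, hg]
    convert hQ using 2
    rw [meanCost, if_neg hb, if_pos hb', if_pos hb', if_pos hb'']
  · simp only [BExp.Holds, RExp.eval_ofNat, RExp.eval_get, NExp.eval, hq, hw, Nat.cast_zero]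
      at hb hb' hb''
    simp only [RExp.eval_sub, RExp.eval_log, RExp.eval_ofNat, NExp.eval, hw, hi, hg]
    convert hQ using 2
    rw [meanCost, if_neg hb, if_pos hb', if_pos hb', if_neg hb'']
    simp
  · simp only [BExp.Holds, RExp.eval_ofNat, RExp.eval_get, NExp.eval, hq, hw, Nat.cast_zero]
      at hb hb'
    simp only [RExp.eval_ofNat, NExp.eval, hi, hg]
    convert hQ using 2
    rw [meanCost, if_neg hb, if_neg hb']
    simp

/-- The cost of the edge between agent number `i` and good number `g`. -/
noncomputable def edgeCost (v : Fin n → Finset (Fin m) → ℝ) (q : ℝ) (i g : ℕ) : ℝ :=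
  if h : i < n then meanCost q (edgeWeight v ⟨i, h⟩ g) else 0

@[simp] theorem edgeCost_val (v : Fin n → Finset (Fin m) → ℝ) (q : ℝ) (i : Fin n) (g : ℕ) :
    edgeCost v q i g = meanCost q (edgeWeight v i g) := dif_pos i.2

/-- A bound for the absolute values of the costs of all matchings. -/
noncomputable def costBound (v : Fin n → Finset (Fin m) → ℝ) (q : ℝ) : ℝ :=
  ∑ i ∈ Finset.range n, ∑ g ∈ Finset.range (n + m),
    (edgeCost v q i g * edgeCost v q i g + 1)

theorem wp_setCosts (hv : ∀ i, IsSubadditiveValuation (v i)) (h : σ.HasSets v) (hN : n + m ≤ N)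
    {q : ℝ} (hq : σ.real 4 0 0 = q) (h5 : σ.real 5 0 0 = 0)
    (hQ : ∀ τ : Store, (∀ c, c ∉ [20, 21] → τ.nat c = σ.nat c) →
      (∀ c, c ∉ [1, 5] → τ.real c = σ.real c) →
      (∀ i < n, ∀ g < n + m, τ.real 1 i g = edgeCost v q i g) →
      τ.real 5 0 0 = costBound v q → Q τ) : wp v N setCosts Q σ := by
  refine wp_frame_lists (Q := fun τ => (∀ i < n, ∀ g < n + m, τ.real 1 i g = edgeCost v q i g) ∧
      τ.real 5 0 0 = costBound v q) [20, 21] [1, 5] ?_ (by decide) (by decide)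
    fun τ h1 h2 h3 => hQ τ h1 h2 h3.1 h3.2
  refine wp_for n (fun k τ => (∀ i < k, ∀ g < n + m, τ.real 1 i g = edgeCost v q i g) ∧
      τ.real 5 0 0 = ∑ i ∈ Finset.range k, ∑ g ∈ Finset.range (n + m),
        (edgeCost v q i g * edgeCost v q i g + 1)) (by decide) (by decide) (by simp [h.agents])
    (by omega) ?_ ?_ ?_
  · simpa using h5
  · rintro k τ hk hxk hfr hfr' ⟨h1, h2⟩
    have hτ : ∀ c, c ∉ [20, 21] → τ.nat c = σ.nat c := fun c hc =>
      hfr c (fun h => hc (by revert h; simp [natWrites, forLoop, setCost]; tauto))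
        fun h => hc (by simp [h])
    have hτ4 : τ.real 4 0 0 = q := by rw [hfr' 4 (by decide), hq]
    refine wp_for (n + m) (fun j τ => (∀ i < k, ∀ g < n + m, τ.real 1 i g = edgeCost v q i g) ∧
      (∀ g < j, τ.real 1 k g = edgeCost v q k g) ∧
      τ.real 5 0 0 = ∑ i ∈ Finset.range k, ∑ g ∈ Finset.range (n + m),
        (edgeCost v q i g * edgeCost v q i g + 1) + ∑ g ∈ Finset.range j,
        (edgeCost v q k g * edgeCost v q k g + 1)) (by decide) (by decide)
      (by simp [hτ, h.agents, h.goods]) hN ?_ ?_ ?_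
    · simpa using And.intro h1 h2
    · rintro j ρ hj hxj hgr hgr' ⟨h3, h4, h5⟩
      have hρ : ∀ c, c ∉ [20, 21] → ρ.nat c = σ.nat c := fun c hc => by
        rw [hgr c (by simp [natWrites, setCost]) (fun h => hc (by simp [h])), hτ c hc]
      have hρ20 : ρ.nat 20 0 0 = k := by rw [hgr 20 (by decide) (by decide), hxk]
      have hρ4 : ρ.real 4 0 0 = q := by rw [hgr' 4 (by decide), hτ4]
      refine wp_seq (wp_setCost hv (h.congr (hρ 0 (by decide)) (hρ 7 (by decide))
        (hρ 8 (by decide))) (i := ⟨k, hk⟩) hρ20 hxj hρ4 (wp_setReal ?_))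
      rw [← edgeCost_val]
      refine ⟨fun i hi g hg => ?_, fun g hg => ?_, ?_⟩
      · simpa [Store.updateReal_real_same, hi.ne] using h3 i hi g hg
      · by_cases h6 : g = j
        · simp [h6]
        · simpa [Store.updateReal_real_same, h6] using h4 g (by omega)
      · simp [hρ20, hxj, h5, Finset.sum_range_succ, add_assoc]
    · rintro ρ - ⟨h3, h4, h5⟩
      refine ⟨fun i hi g hg => ?_, ?_⟩
      · rcases Nat.lt_succ_iff_lt_or_eq.1 hi with h6 | rfl
        · exact h3 i h6 g hg
        · exact h4 g hg
      · rw [Finset.sum_range_succ]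
        exact h5
  · rintro τ - h1
    exact h1

/-- The edges to be avoided. -/
def IsAvoided (v : Fin n → Finset (Fin m) → ℝ) (q : ℝ) (i g : ℕ) : Prop :=
  ∃ h : i < n, ¬ 0 < q ∧ ¬ 0 < edgeWeight v ⟨i, h⟩ g

open Classical in
/-- The cost matrix of the assignment problem. -/
noncomputable def penaltyCost (v : Fin n → Finset (Fin m) → ℝ) (q : ℝ) (i g : ℕ) : ℝ :=
  if IsAvoided v q i g then costBound v q + costBound v q else edgeCost v q i g

theorem wp_setPenalties (h : σ.HasSets v) (hN : n + m ≤ N)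
    {q : ℝ} (hq : σ.real 4 0 0 = q) (h5 : σ.real 5 0 0 = costBound v q)
    (h1 : ∀ i < n, ∀ g < n + m, σ.real 1 i g = edgeCost v q i g)
    (hQ : ∀ τ : Store, (∀ c, c ∉ [20, 21] → τ.nat c = σ.nat c) →
      (∀ c, c ∉ [1, 2] → τ.real c = σ.real c) →
      (∀ i < n, ∀ g < n + m, τ.real 1 i g = penaltyCost v q i g) →
      (∀ i < n, τ.real 2 0 i = -(costBound v q + costBound v q)) → Q τ) :
    wp v N setPenalties Q σ := by
  refine wp_frame_lists (Q := fun τ => (∀ i < n, ∀ g < n + m, τ.real 1 i g = penaltyCost v q i g) ∧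
      ∀ i < n, τ.real 2 0 i = -(costBound v q + costBound v q)) [20, 21] [1, 2] ?_ (by decide)
    (by decide) fun τ h1 h2 h3 => hQ τ h1 h2 h3.1 h3.2
  refine wp_for n (fun k τ => (∀ i < n, ∀ g < n + m, τ.real 1 i g =
      if i < k then penaltyCost v q i g else edgeCost v q i g) ∧
      ∀ i < k, τ.real 2 0 i = -(costBound v q + costBound v q)) (by decide) (by decide)
    (by simp [h.agents]) (by omega) ?_ ?_ ?_
  · simpa using h1
  · rintro k τ hk hxk hfr hfr' ⟨h1, h2⟩
    have hτ : ∀ c, c ∉ [20, 21] → τ.nat c = σ.nat c := fun c hc =>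
      hfr c (fun h => hc (by revert h; simp [natWrites, forLoop]; tauto))
        fun h => hc (by simp [h])
    have hτ4 : τ.real 4 0 0 = q := by rw [hfr' 4 (by decide)]; exact hq
    have hτ5 : τ.real 5 0 0 = costBound v q := by rw [hfr' 5 (by decide)]; exact h5
    refine wp_seq (wp_setReal ?_)
    refine wp_for (n + m) (fun j τ => (∀ i < n, ∀ g < n + m, τ.real 1 i g =
      if i < k ∨ i = k ∧ g < j then penaltyCost v q i g else edgeCost v q i g) ∧
      ∀ i < k + 1, τ.real 2 0 i = -(costBound v q + costBound v q)) (by decide) (by decide)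
      (by simp [hτ, h.agents, h.goods]) hN ?_ ?_ ?_
    · refine ⟨fun i hi g hg => by simpa using h1 i hi g hg, fun i hi => ?_⟩
      by_cases h3 : i = k
      · simp [h3, hxk, hτ5]
      · simpa [Store.updateReal_real_same, hxk, h3] using h2 i (by omega)
    · rintro j ρ hj hxj hgr hgr' ⟨h3, h4⟩
      have hρ : ∀ c, c ∉ [20, 21] → ρ.nat c = σ.nat c := fun c hc => by
        rw [hgr c (by simp [natWrites]) (fun h => hc (by simp [h])), Store.updateReal_nat, hτ c hc]
      have hρ20 : ρ.nat 20 0 0 = k := by rw [hgr 20 (by decide) (by decide)]; exact hxk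
      have hρ4 : ρ.real 4 0 0 = q := by rw [hgr' 4 (by decide)]; simpa using hτ4
      have hρ5 : ρ.real 5 0 0 = costBound v q := by rw [hgr' 5 (by decide)]; simpa using hτ5
      have hw : (RExp.weight (.var 20) (.var 21)).eval v ρ = edgeWeight v ⟨k, hk⟩ j := by
        rw [(h.congr (hρ 0 (by decide)) (hρ 7 (by decide)) (hρ 8 (by decide))).eval_weight
          (i' := ⟨k, hk⟩) (by simpa using hρ20)]
        simp [hxj]
      have key : ∀ x : ℝ, x = penaltyCost v q k j → ∀ i < n, ∀ g < n + m,
          (if i = k ∧ g = j then x else ρ.real 1 i g) =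
            if i < k ∨ i = k ∧ g < j + 1 then penaltyCost v q i g else edgeCost v q i g := by
        intro x hx i hi g hg
        by_cases h6 : i = k ∧ g = j
        · rw [if_pos h6, if_pos (by omega), hx, h6.1, h6.2]
        · rw [if_neg h6, h3 i hi g hg]
          have h7 : (i < k ∨ i = k ∧ g < j) ↔ (i < k ∨ i = k ∧ g < j + 1) := by omega
          simp only [h7]
      refine wp_ite (fun hb => wp_setReal ⟨?_, ?_⟩) fun hb => wp_skip ⟨?_, ?_⟩
      · simp only [BExp.Holds, RExp.eval_ofNat, RExp.eval_get, NExp.eval, hρ4, hw, Nat.cast_zero]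
          at hb
        have := key _ (if_pos ⟨hk, hb⟩ : penaltyCost v q k j = _).symm
        simpa [Store.updateReal_real_same, hρ20, hxj, hρ5] using this
      · simpa using h4
      · simp only [BExp.Holds, RExp.eval_ofNat, RExp.eval_get, NExp.eval, hρ4, hw, Nat.cast_zero]
          at hb
        have := key (edgeCost v q k j)
          (if_neg fun ⟨_, h7⟩ => hb h7 : penaltyCost v q k j = _).symm
        intro i hi g hg
        rw [← this i hi g hg, Store.updateNat_real]
        split_ifs with h6
        · rw [h6.1, h6.2, h3 k hk j hj, if_neg (by omega)]
        · rfl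
      · simpa using h4
    · rintro ρ - ⟨h3, h4⟩
      refine ⟨fun i hi g hg => ?_, h4⟩
      rw [Store.updateNat_real, h3 i hi g hg]
      have h7 : (i < k ∨ i = k ∧ g < n + m) ↔ i < k + 1 := by omega
      simp only [h7]
  · rintro τ - ⟨h1, h2⟩
    refine ⟨fun i hi g hg => ?_, h2⟩
    rw [h1 i hi g hg, if_pos hi]

/-- Termwise `|x| < x * x + 1`. The right-hand side uses only field operations, so the program can
compute the bound. -/
theorem sum_abs_edgeCost_lt (hn : 0 < n) (q : ℝ) {a : Fin n → ℕ} (ha : ∀ i, a i < n + m) :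
    ∑ i : Fin n, |edgeCost v q i (a i)| < costBound v q := by
  have : Nonempty (Fin n) := ⟨⟨0, hn⟩⟩
  rw [costBound, Finset.sum_range]
  refine Finset.sum_lt_sum_of_nonempty Finset.univ_nonempty fun i _ => ?_
  have h0 : ∀ x : ℝ, |x| < x * x + 1 := fun x => by
    rcases abs_cases x with ⟨h, _⟩ | ⟨h, _⟩ <;> rw [h] <;> nlinarith [sq_nonneg (x - 1 / 2),
      sq_nonneg (x + 1 / 2)]
  refine (h0 _).trans_le (Finset.single_le_sum
    (f := fun g => edgeCost v q i g * edgeCost v q i g + 1) (fun g _ => ?_)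
    (Finset.mem_range.2 (ha i)))
  nlinarith [sq_nonneg (edgeCost v q i g)]

/-- This makes the initial dual solution feasible, which is constant on the rows and zero on the
columns. -/
theorem neg_le_penaltyCost (q : ℝ) {i g : ℕ} (hi : i < n) (hg : g < n + m) :
    -(costBound v q + costBound v q) ≤ penaltyCost v q i g := by
  have h1 := sum_abs_edgeCost_lt (v := v) (by omega : 0 < n) q (a := fun _ => g) fun _ => hg
  have h2 := Finset.single_le_sum (f := fun i : Fin n => |edgeCost v q i g|)
    (fun _ _ => abs_nonneg _) (Finset.mem_univ ⟨i, hi⟩)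
  have h3 := neg_abs_le (edgeCost v q i g)
  have h4 := abs_nonneg (edgeCost v q i g)
  simp only at h2
  rw [penaltyCost]
  split_ifs <;> linarith

/-- A matching that is optimal for the costs with penalties avoids the bad edges if this is
possible, and is then optimal for the original costs. -/
theorem sum_edgeCost_le (hn : 0 < n) {q : ℝ} {a μ : Fin n → ℕ} (ha : ∀ i, a i < n + m)
    (hμ : ∀ i, μ i < n + m)
    (h : ∑ i : Fin n, penaltyCost v q i (a i) ≤ ∑ i : Fin n, penaltyCost v q i (μ i))
    (hμ' : ∀ i : Fin n, ¬ IsAvoided v q i (μ i)) :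
    (∀ i : Fin n, ¬ IsAvoided v q i (a i)) ∧
      ∑ i : Fin n, edgeCost v q i (a i) ≤ ∑ i : Fin n, edgeCost v q i (μ i) := by
  have h1 : ∑ i : Fin n, penaltyCost v q i (μ i) = ∑ i : Fin n, edgeCost v q i (μ i) :=
    Finset.sum_congr rfl fun i _ => if_neg (hμ' i)
  rw [h1] at h
  suffices h2 : ∀ i : Fin n, ¬ IsAvoided v q i (a i) by
    refine ⟨h2, le_trans (le_of_eq ?_) h⟩
    exact Finset.sum_congr rfl fun i _ => (if_neg (h2 i)).symm
  intro i₁ hi₁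
  have h3 := sum_abs_edgeCost_lt (v := v) hn q ha
  have h4 := sum_abs_edgeCost_lt (v := v) hn q hμ
  have hD : 0 < costBound v q :=
    (Finset.sum_nonneg fun i _ => abs_nonneg _).trans_lt h3
  have h5 : ∑ i : Fin n, edgeCost v q i (μ i) ≤ ∑ i : Fin n, |edgeCost v q i (μ i)| :=
    Finset.sum_le_sum fun i _ => le_abs_self _
  -- A single avoided edge costs `2 * costBound`, and all other edges together recover less than
  -- `costBound`. So the total would exceed `costBound`, whereas `μ` costs less than that.
  have h6 : costBound v q + costBound v q ≤
      ∑ i : Fin n, (penaltyCost v q i (a i) + |edgeCost v q i (a i)|) := by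
    have h7 := Finset.single_le_sum
      (f := fun i : Fin n => penaltyCost v q i (a i) + |edgeCost v q i (a i)|)
      (fun i _ => ?_) (Finset.mem_univ i₁)
    · refine le_trans ?_ h7
      simp only [penaltyCost, if_pos hi₁]
      linarith [abs_nonneg (edgeCost v q i₁ (a i₁))]
    · have := neg_abs_le (edgeCost v q i (a i))
      have := abs_nonneg (edgeCost v q i (a i))
      simp only [penaltyCost]
      split_ifs <;> linarith
  rw [Finset.sum_add_distrib] at h6
  linarith

end Specs

/-! ### The whole algorithm and its guarantees -/

namespace BProgram

/-- Every agent receives the good matched to her. -/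
def initBundles : BProgram :=
  forLoop 20 .agents (.setNat 1 (.var 20) (.get 9 (.lit 0) (.var 20)) (.lit 1))

/-- The whole algorithm. -/
def algorithm (c : Bool) : BProgram :=
  .seq weights (.seq assignment (.seq initBundles (mainLoop c)))

end BProgram

section Specs

variable {n m : ℕ} {v : Fin n → Finset (Fin m) → ℝ} {N : ℕ} {Q Q' : Store → Prop} {σ : Store}
  {ε : ℝ} {p : WithBot ℝ} {c : Bool}

theorem wp_initBundles (hn0 : σ.nat 0 0 0 = n) (hN : n ≤ N) (h1 : ∀ r k, σ.nat 1 r k = 0)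
    (hQ : ∀ τ : Store, (∀ c, c ∉ [1, 20] → τ.nat c = σ.nat c) → τ.real = σ.real →
      (∀ i : Fin n, τ.output n m i = goodSet m (σ.nat 9 0 i)) → Q τ) : wp v N initBundles Q σ := by
  refine wp_frame_list (Q := fun τ => ∀ i : Fin n, τ.output n m i = goodSet m (σ.nat 9 0 i)) [1, 20]
    ?_ (by decide) rfl hQ
  refine wp_for n (fun k τ => ∀ i j, τ.nat 1 i j = if i < k ∧ j = σ.nat 9 0 i then 1 else 0)
    (by decide) (by decide) (by simp [hn0]) hN ?_ ?_ ?_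
  · simpa using h1
  · rintro k τ hk hxk hfr - h2
    refine wp_setNat fun i j => ?_
    have h9 : τ.nat 9 = σ.nat 9 := hfr 9 (by decide) (by decide)
    simp only [NExp.eval, hxk, h9, ne_eq, Nat.reduceEqDiff, not_false_eq_true,
      Store.updateNat_nat_ne, Store.updateNat_nat_same, h2]
    by_cases h3 : i = k
    · subst h3
      simp
    · have h4 : i < k + 1 ↔ i < k := by omega
      simp [h3, h4]
  · rintro τ - h2 i
    ext g
    rw [Store.output, Store.mem_row, h2, mem_goodSet]
    simp

theorem wp_weights (hv : ∀ i, IsSubadditiveValuation (v i)) (hN : n + m ≤ N)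
    (hQ : ∀ τ : Store,
      (∀ c, c ∉ [7, 8, 20, 21, 22, 25] → τ.nat c = (inputStore n m ε p).nat c) →
      τ.real 0 = (inputStore n m ε p).real 0 →
      (∀ i < n, ∀ g < n + m, τ.real 1 i g = penaltyCost v (effectiveExponent n p) i g) →
      τ.HasDualMatching n (n + m) (τ.real 1) 0 → Q τ) :
    wp v N weights Q (inputStore n m ε p) := by
  set σ := inputStore n m ε p with hσ
  have hn0 : σ.nat 0 0 0 = n := by simp [hσ, inputStore]
  have hm0 : σ.nat 0 0 1 = m := by simp [hσ, inputStore]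
  have hz : ∀ c, c ≠ 0 → ∀ r k, σ.nat c r k = 0 := fun c hc r k => by simp [hσ, inputStore, hc]
  have hzr : ∀ c, c ≠ 0 → ∀ r k, σ.real c r k = 0 := fun c hc r k => by simp [hσ, inputStore, hc]
  have hp : p = ⊥ ∧ σ.nat 0 0 2 = 1 ∨ σ.nat 0 0 2 = 0 ∧ p = (σ.real 0 0 1 : ℝ) := by
    induction p with
    | bot => exact .inl ⟨rfl, by simp [hσ, inputStore]⟩
    | coe q => exact .inr ⟨by simp [hσ, inputStore], by simp [hσ, inputStore]⟩
  refine wp_seq (wp_singleSets hm0 (by omega) (hz 7 (by decide)) fun τ₁ f1 r1 h7 => ?_)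
  refine wp_seq (wp_lowSets (by rw [f1 0 (by decide), hn0]) (by rw [f1 0 (by decide), hm0]) hN h7
    (fun r k => by rw [f1 8 (by decide), hz 8 (by decide)]) fun τ₂ f2 r2 h8 => ?_)
  have h0 : τ₂.nat 0 = σ.nat 0 := by rw [f2 0 (by decide), f1 0 (by decide)]
  have hr : τ₂.real = σ.real := by rw [r2, r1]
  have hs : τ₂.HasSets v := ⟨by rw [h0, hn0], by rw [h0, hm0],
    fun g => by rw [Store.row_congr (f2 7 (by decide)), h7], h8⟩
  refine wp_seq (wp_setExponent (p := p) hs.agents (by rw [h0, hr]; exact hp)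
    fun τ₃ f3 r3 h4 => ?_)
  have hs3 : τ₃.HasSets v := hs.congr (by rw [f3]) (by rw [f3]) (by rw [f3])
  refine wp_seq (wp_setCosts hv hs3 hN h4 (by rw [r3 5 (by decide), hr, hzr 5 (by decide)])
    fun τ₄ f4 r4 h1 h5 => ?_)
  refine wp_setPenalties (hs3.congr (f4 0 (by decide)) (f4 7 (by decide)) (f4 8 (by decide))) hN
    (by rw [r4 4 (by decide), h4]) h5 h1 fun τ₅ f5 r5 h6 h2 => ?_
  have h3 : ∀ g, τ₅.real 3 0 g = 0 := fun g => by
    rw [r5 3 (by decide), r4 3 (by decide), r3 3 (by decide), hr, hzr 3 (by decide)]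
  refine hQ τ₅ (fun c hc => ?_) ?_ h6
    ⟨fun i hi g hg => ?_, fun g _ => (h3 g).le, by simp, by simp, by simp, fun g _ hg =>
      absurd (h3 g) hg⟩
  · simp only [List.mem_cons, List.not_mem_nil, or_false, not_or] at hc
    rw [f5 c (by simp; tauto), f4 c (by simp; tauto), f3, f2 c (by simp; tauto),
      f1 c (by simp; tauto)]
  · rw [r5 0 (by decide), r4 0 (by decide), r3 0 (by decide), hr]
  · rw [h3, add_zero, h2 i hi, h6 i hi g hg]
    exact neg_le_penaltyCost _ hi hg

/-- Optimality for the penalized costs is translated into the two demands of `pMeanWelfare_ge`: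
positive weights throughout whenever these are achievable and the exponent is not positive, and then
a minimal sum of `meanCost`. -/
theorem IsDualMatching.welfare_ge (hv : ∀ i, IsSubadditiveValuation (v i)) (hn : 0 < n)
    {C : ℕ → ℕ → ℝ} {u w : ℕ → ℝ} {ma : ℕ → ℕ} (h : IsDualMatching n (n + m) C n u w ma)
    (hC : ∀ i < n, ∀ g < n + m, C i g = penaltyCost v (effectiveExponent n p) i g)
    {α : ℝ} (hα : α ≤ 1) {Z X : Fin n → Finset (Fin m)} (hZ : IsAlphaCEFX v α c Z)
    (hle : ∀ i : Fin n, v i (goodSet m (ma i)) ≤ v i (Z i)) (hX : IsAllocation X) :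
    α / (4 * ((n : ℝ) + 1)) * pMeanWelfare p v X ≤ pMeanWelfare p v Z := by
  refine pMeanWelfare_ge hv hn p hα hZ (a := fun i => ma i) hle (fun μ h1 h2 => ?_) hX
  rw [add_comm] at h2
  have ha : ∀ i : Fin n, ma i < n + m := fun i => h.lt i i.2
  have h3 := h.sum_le h1 h2
  rw [Finset.sum_congr rfl fun (i : Fin n) _ => hC i i.2 _ (ha i),
    Finset.sum_congr rfl fun (i : Fin n) _ => hC i i.2 _ (h2 i)] at h3
  have h4 := sum_edgeCost_le hn ha h2 h3
  simp only [edgeCost_val] at h4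
  refine ⟨fun hq hμ i => ?_, fun hμ => (h4 fun i => ?_).2⟩
  · by_contra h5
    exact (h4 fun i ⟨_, _, h6⟩ => h6 (hμ i)).1 i ⟨i.2, not_lt.2 hq, h5⟩
  · rintro ⟨_, h5, h6⟩
    exact hμ.elim h5 fun h7 => h6 (h7 i)

theorem wp_algorithm (hv : ∀ i, IsSubadditiveValuation (v i)) (hn : 0 < n) (hε : 0 < ε)
    (hN : n + m + ⌈1 / ε⌉₊ + 5 ≤ N) :
    wp v N (algorithm c) (fun τ =>
      IsAlphaCEFX v (if c then 1 / 2 - ε else 1 - ε) c (τ.output n m) ∧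
      ∀ X : Fin n → Finset (Fin m), IsAllocation X →
        (if c then 1 / 2 - ε else 1 - ε) / (4 * ((n : ℝ) + 1)) * pMeanWelfare p v X ≤
          pMeanWelfare p v (τ.output n m)) (inputStore n m ε p) := by
  set σ := inputStore n m ε p with hσ
  have hn0 : σ.nat 0 0 0 = n := by simp [hσ, inputStore]
  have hm0 : σ.nat 0 0 1 = m := by simp [hσ, inputStore]
  have hz : ∀ c, c ≠ 0 → ∀ r k, σ.nat c r k = 0 := fun c hc r k => by simp [hσ, inputStore, hc]
  refine wp_seq (wp_weights hv (by omega) fun τ₁ f1 r1 hC h1 => ?_)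
  refine wp_seq (wp_assignment (by rw [f1 0 (by decide)]; exact hn0)
    (by rw [f1 0 (by decide)]; exact hm0) (by omega) h1 fun τ₂ f2 r2 h2 => ?_)
  have hf : ∀ c, c ∉ [7, 8, 9, 10, 11, 20, 21, 22, 23, 25, 31, 32, 33, 34, 35, 36] →
      τ₂.nat c = σ.nat c := fun c hc => by
    simp only [List.mem_cons, List.not_mem_nil, or_false, not_or] at hc
    rw [f2 c (by simp; tauto), f1 c (by simp; tauto)]
  refine wp_seq (wp_initBundles (m := m) (by rw [hf 0 (by decide), hn0]) (by omega)
    (fun r k => by rw [hf 1 (by decide), hz 1 (by decide)]) fun τ₃ f3 r3 h3 => ?_)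
  have hout : τ₃.output n m = fun i : Fin n => goodSet m (τ₂.nat 9 0 i) := funext h3
  have hbag : τ₃.row m 2 0 = ∅ := by
    ext g
    simp [Store.mem_row, f3, hf, hz]
  have hα : (if c then 1 / 2 - ε else 1 - ε) ≤ (1 : ℝ) := by split_ifs <;> linarith
  refine wp_mono (wp_mainLoop (c := c) (Y := τ₃.output n m) hv hε hn
    (by rw [f3 0 (by decide), hf 0 (by decide), hn0])
    (by rw [f3 0 (by decide), hf 0 (by decide), hm0]) (ε := ε) ?_ hN ?_ ?_) ?_
  · rw [r3, r2 0 (by decide), r1]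
    simp [inputStore]
  · rw [hbag]
    -- A dummy column yields the empty bundle and a proper column a single good; the matching is
    -- injective, so the bundles are disjoint.
    refine FairState.init hv (fun i j hij => ?_) fun i => ?_
    · rw [hout, Finset.disjoint_left]
      intro g hi hj
      rw [mem_goodSet] at hi hj
      exact hij (Fin.ext (h2.inj i i.2 j j.2 (hi.symm.trans hj)))
    · rw [hout]
      exact card_goodSet_le _
  · rw [f3 26 (by decide), hf 26 (by decide), hz 26 (by decide)]
  · rintro τ ⟨h4, h5⟩
    refine ⟨h4, fun X hX => h2.welfare_ge hv hn hC hα h4 (fun i => ?_) hX⟩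
    have := h5 i
    rwa [h3] at this

theorem algorithm_correct (c : Bool) : ∃ C k : ℕ, ∀ (n m : ℕ) (v : Fin n → Finset (Fin m) → ℝ)
    (ε : ℝ) (p : WithBot ℝ), 0 < n → (∀ i, IsSubadditiveValuation (v i)) → 0 < ε →
      ∃ (t : ℕ) (τ : Store), Runs v (algorithm c).erase (inputStore n m ε p) t τ ∧
        (t : ℝ) ≤ C * ((n : ℝ) + m + 1 / ε) ^ k ∧
        IsAlphaCEFX v (if c then 1 / 2 - ε else 1 - ε) c (τ.output n m) ∧
        ∀ X : Fin n → Finset (Fin m), IsAllocation X →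
          (if c then 1 / 2 - ε else 1 - ε) / (4 * ((n : ℝ) + 1)) * pMeanWelfare p v X ≤
            pMeanWelfare p v (τ.output n m) := by
  obtain ⟨C, k, hC⟩ := (algorithm c).exists_cost_le
  refine ⟨C * 7 ^ k, k, fun n m v ε p hn hv hε => ?_⟩
  obtain ⟨t, τ, h1, h2, h3, h4⟩ := wp_algorithm (c := c) (p := p) hv hn hε le_rfl
  refine ⟨t, τ, h1, ?_, h3, h4⟩
  have h5 := h2.trans (hC _ (by omega))
  -- Rounding up adds at most `1`, and the resulting constant `6` is absorbed by `6 * n`.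
  have h6 : ((n + m + ⌈1 / ε⌉₊ + 5 : ℕ) : ℝ) ≤ 7 * ((n : ℝ) + m + 1 / ε) := by
    have h7 := (Nat.ceil_lt_add_one (by positivity : 0 ≤ 1 / ε)).le
    have h8 : (1 : ℝ) ≤ n := by exact_mod_cast hn
    have h9 : (0 : ℝ) ≤ m := by positivity
    have h10 : 0 < 1 / ε := by positivity
    push_cast
    linarith
  calc (t : ℝ) ≤ ((C * (n + m + ⌈1 / ε⌉₊ + 5) ^ k : ℕ) : ℝ) := by exact_mod_cast h5
    _ = C * ((n + m + ⌈1 / ε⌉₊ + 5 : ℕ) : ℝ) ^ k := by push_cast; ring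
    _ ≤ C * (7 * ((n : ℝ) + m + 1 / ε)) ^ k := by gcongr
    _ = _ := by rw [mul_pow]; push_cast; ring

end Specs

theorem theorem2 :
    -- `(1 - ε)`-EFX and EF1 with bounded charity
    (∃ (A : Program) (C k : ℕ), ∀ (n m : ℕ) (v : Fin n → Finset (Fin m) → ℝ) (ε : ℝ)
        (p : WithBot ℝ),
      0 < n → (∀ i, IsSubadditiveValuation (v i)) → 0 < ε → p ≤ ((1 : ℝ) : WithBot ℝ) →
      ∃ (t : ℕ) (τ : Store), Runs v A (inputStore n m ε p) t τ ∧
        (t : ℝ) ≤ C * ((n : ℝ) + m + 1 / ε) ^ k ∧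
        IsAlphaCEFX v (1 - ε) false (τ.output n m) ∧
        ∀ X : Fin n → Finset (Fin m), IsAllocation X →
          (1 - ε) / (4 * ((n : ℝ) + 1)) * pMeanWelfare p v X ≤ pMeanWelfare p v (τ.output n m)) ∧
    -- `(1/2 - ε)`-EFX and EF1, complete
    (∃ (A : Program) (C k : ℕ), ∀ (n m : ℕ) (v : Fin n → Finset (Fin m) → ℝ) (ε : ℝ)
        (p : WithBot ℝ),
      0 < n → (∀ i, IsSubadditiveValuation (v i)) → 0 < ε → p ≤ ((1 : ℝ) : WithBot ℝ) →
      ∃ (t : ℕ) (τ : Store), Runs v A (inputStore n m ε p) t τ ∧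
        (t : ℝ) ≤ C * ((n : ℝ) + m + 1 / ε) ^ k ∧
        IsAlphaCEFX v (1 / 2 - ε) true (τ.output n m) ∧
        ∀ X : Fin n → Finset (Fin m), IsAllocation X →
          (1 / 2 - ε) / (4 * ((n : ℝ) + 1)) * pMeanWelfare p v X
            ≤ pMeanWelfare p v (τ.output n m)) ∧
    -- `O(n)`-approximation of the Nash welfare, with the parameters fixed to `ε = 1/4`, `p = 0`
    (∃ (A : Program) (C k K : ℕ), ∀ (n m : ℕ) (v : Fin n → Finset (Fin m) → ℝ),
      0 < n → (∀ i, IsSubadditiveValuation (v i)) →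
      ∃ (t : ℕ) (τ : Store), Runs v A (inputStore n m (1 / 4) ((0 : ℝ) : WithBot ℝ)) t τ ∧
        (t : ℝ) ≤ C * ((n : ℝ) + m) ^ k ∧
        IsAllocation (τ.output n m) ∧ unallocated (τ.output n m) = ∅ ∧
        ∀ X : Fin n → Finset (Fin m), IsAllocation X →
          pMeanWelfare ((0 : ℝ) : WithBot ℝ) v X
            ≤ K * n * pMeanWelfare ((0 : ℝ) : WithBot ℝ) v (τ.output n m)) := by
  refine ⟨?_, ?_, ?_⟩
  · obtain ⟨C, k, h⟩ := algorithm_correct false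
    exact ⟨_, C, k, fun n m v ε p hn hv hε _ => h n m v ε p hn hv hε⟩
  · obtain ⟨C, k, h⟩ := algorithm_correct true
    exact ⟨_, C, k, fun n m v ε p hn hv hε _ => h n m v ε p hn hv hε⟩
  · obtain ⟨C, k, h⟩ := algorithm_correct true
    -- For `ε = 1 / 4` the term `1 / ε = 4` is at most `4 * n`, whence the `5`. The ratio is `α = 1
    -- / 4`, and `16 * (n + 1) ≤ 32 * n`.
    refine ⟨(algorithm true).erase, C * 5 ^ k, k, 32, fun n m v hn hv => ?_⟩
    obtain ⟨t, τ, h1, h2, h3, h4⟩ := h n m v (1 / 4) ((0 : ℝ) : WithBot ℝ) hn hv (by norm_num)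
    have hn' : (1 : ℝ) ≤ n := by exact_mod_cast hn
    refine ⟨t, τ, h1, ?_, h3.alloc, h3.complete rfl, fun X hX => ?_⟩
    · calc (t : ℝ) ≤ C * ((n : ℝ) + m + 1 / (1 / 4)) ^ k := h2
        _ ≤ C * (5 * ((n : ℝ) + m)) ^ k := by
          have : (0 : ℝ) ≤ m := by positivity
          gcongr
          linarith
        _ = _ := by rw [mul_pow]; push_cast; ring
    · have h5 := h4 X hX
      have h6 : 0 ≤ pMeanWelfare ((0 : ℝ) : WithBot ℝ) v (τ.output n m) :=
        pMean_nonneg _ fun i => (hv i).nonneg _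
      rw [if_pos rfl, div_mul_eq_mul_div, div_le_iff₀ (by positivity)] at h5
      rw [Nat.cast_ofNat]
      linarith [mul_nonneg (sub_nonneg.2 hn') h6]
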